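/- Let $N \ge 1$ be an integer. For a complex polynomial $f(x) = a\prod_{n}(x-\gamma_n)$ let $\mu(f) = |a|\prod_{n}\max\{1,|\gamma_n|\}$ be its Mahler measure, and for $\mathbf b = (b_1,\dots,b_N) \in \mathbb C^N$ put \[ \widetilde\mu(\mathbf b) = \mu\Big(x^N + \sum_{n=1}^N b_n x^{N-n}\Big). \] Let $\lambda_N$ and $\lambda_{2N}$ denote Lebesgue measure on $\mathbb R^N$ and on $\mathbb C^N \cong \mathbb R^{2N}$ respectively, and define the real and complex moment functions \[ F_N(\mu;s) = \int_{\mathbb R^N} \widetilde\mu(\mathbf b)^{-s}\, d\lambda_N(\mathbf b), \qquad H_N(\mu;s) = \int_{\mathbb C^N} \widetilde\mu(\mathbf b)^{-2s}\, d\lambda_{2N}(\mathbf b). \] Both integrals converge absolutely for all complex $s$ with $\Re(s) > N$ and define analytic functions of $s$ in this half plane, and $F_N(\mu;s)$ and $H_N(\mu;s)$ continue analytically to rational functions of $s$, which have no poles in this half plane. Explicitly, \[ H_N(\mu;s) = \frac{\pi^N}{N!}\prod_{n=1}^N \frac{s}{s-n}, \] and, with $M$ the integer part of $(N-1)/2$,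 \[ F_N(\mu;s) = \mathcal C_N \prod_{m=0}^M \frac{s}{s-(N-2m)}, \qquad \text{where} \qquad \mathcal C_N = 2^N \prod_{m=1}^M \left(\frac{2m}{2m+1}\right)^{N-2m}; \] these formulas hold as identities of the integrals for $\Re(s) > N$, and as identities of rational functions for the continuations. -/

import Mathlib

open MeasureTheory
open scoped Polynomial

noncomputable section

/-- The monic polynomial `x ^ N + b₁ x ^ (N - 1) + ⋯ + b_N`; the coordinate `b i` of the vector,
with `i = 0, …, N - 1`, is the coefficient `b_{i + 1}` of `x ^ (N - (i + 1))`. -/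
def monicPoly {N : ℕ} (b : Fin N → ℂ) : ℂ[X] :=
  Polynomial.X ^ N +
    ∑ i : Fin N, Polynomial.C (b i) * Polynomial.X ^ (N - ((i : ℕ) + 1))

/-- The degree `N` monic restriction of a function `Φ` on complex polynomials. -/
def monicRestriction (Φ : ℂ[X] → ℝ) {N : ℕ} (b : Fin N → ℂ) : ℝ :=
  Φ (monicPoly b)

/-- The integrand of the complex moment function. -/
def complexMomentIntegrand (Φ : ℂ[X] → ℝ) (N : ℕ) (s : ℂ) (b : Fin N → ℂ) : ℂ :=
  (monicRestriction Φ b : ℂ) ^ (-(2 * s))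

/-- The integrand of the real moment function. -/
def realMomentIntegrand (Φ : ℂ[X] → ℝ) (N : ℕ) (s : ℂ) (b : Fin N → ℝ) : ℂ :=
  (monicRestriction Φ (fun i => (b i : ℂ)) : ℂ) ^ (-s)

/-- The complex degree `N` moment function of `Φ`, an integral for Lebesgue measure on `ℂ ^ N`. -/
def complexMoment (Φ : ℂ[X] → ℝ) (N : ℕ) (s : ℂ) : ℂ :=
  ∫ b : Fin N → ℂ, complexMomentIntegrand Φ N s b

/-- The real degree `N` moment function of `Φ`, an integral for Lebesgue measure on `ℝ ^ N`. -/
def realMoment (Φ : ℂ[X] → ℝ) (N : ℕ) (s : ℂ) : ℂ :=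
  ∫ b : Fin N → ℝ, realMomentIntegrand Φ N s b

/-- Mahler's measure `Polynomial.mahlerMeasure` is `|a| * ∏ max 1 |γ|` over the roots `γ` counted
with multiplicity, where `a` is the leading coefficient. -/
theorem mahlerMeasure_eq_root_product (f : ℂ[X]) :
    f.mahlerMeasure = ‖f.leadingCoeff‖ * (f.roots.map (fun γ => max 1 ‖γ‖)).prod :=
  Polynomial.mahlerMeasure_eq_leadingCoeff_mul_prod_roots f

/-- The function `F` is analytic on the half plane `Re s > σ`, and `R` is a rational function
without poles there that agrees with `F` there. Since `R` is meromorphic on all of `ℂ`,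
it is the analytic continuation of `F`. -/
def ContinuesToRational (F : ℂ → ℂ) (σ : ℝ) (R : RatFunc ℂ) : Prop :=
  AnalyticOnNhd ℂ F {s : ℂ | σ < s.re} ∧
    ∀ s : ℂ, σ < s.re →
      R.denom.eval s ≠ 0 ∧ F s = R.eval (RingHom.id ℂ) s

/-- The constant `2 ^ N * ∏_{m = 1}^M (2 m / (2 m + 1)) ^ (N - 2 m)` with `M = ⌊(N - 1) / 2⌋`. -/
def mahlerConst (N : ℕ) : ℚ :=
  2 ^ N * ∏ m ∈ Finset.Icc 1 ((N - 1) / 2),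
    ((2 * (m : ℚ)) / (2 * (m : ℚ) + 1)) ^ (N - 2 * m)

end

/-! ### Signed change of variables and the degree formula -/

section AreaFormula

open Set Function
open scoped ENNReal NNReal

variable {E : Type*} [NormedAddCommGroup E] [NormedSpace ℝ E] [FiniteDimensional ℝ E]
  [MeasurableSpace E] [BorelSpace E] (μ : Measure E) [μ.IsAddHaarMeasure]

/-! Enlarge the problem: integrate `μ(f)^(-s)` times a product of values `f(t_i)` over real monic
`f` of degree `n`, or `μ(f)^(-2s)` times the product of `|f(t_i)|^2` over complex ones. With no
points `t_i` these are the moment functions, and with points they satisfy a recursion in the degree.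

The recursion splits off a factor `q`. Multiplication `(f, q) ↦ f q` of coefficient vectors has
differential `(h, k) ↦ f k + h q`, so its matrix is the Sylvester matrix and its Jacobian is the
resultant. The degree formula `integral_det_fderiv_mul_comp` keeps the sign of the Jacobian and
counts the monic divisors of a generic polynomial with sign. For complex linear factors the real
Jacobian is `|f(z)|^2` and the count is the degree `n` of the product. For real polynomials
quadratic factors are used, with Jacobian `f(α) f(β)`: linear factors would cancel to `0` in even
degree, whereas the signed count of quadratic divisors is `⌊n / 2⌋`
(`sum_sign_resultant_quadratic`). Since `μ` is multiplicative and the Jacobian consists of values of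
`f` at the roots of `q`, these roots simply join the points `t_i` (`realAverage_add_two`,
`complexAverage_succ`).

Multiplying by the Vandermonde determinant of the points makes the recursion linear: the factors
`t_i - z` complete it to the Vandermonde determinant of the longer list, which is a wedge of power
vectors. Over `ℂ` the moments of `z^p` against conjugate powers are orthogonal, and the answer is
the product of the one-variable moments. Over `ℝ` the answer is a power of a two-form `Ω` in the
moments of quadratics, wedged with a vector of linear moments if `N` is odd. Only pairs of exponents
of opposite parity contribute, so `Ω` is a sum of `k = ⌊N / 2⌋` decomposable terms and `Ω^k` is `k!`
times their product. What remains is a determinant of size `⌈N / 2⌉`, a scaled Cauchy matrix with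
nodes `2a` and `2b + 1`, and a last node `s - 1` if `N` is odd.

The moments of one factor come from `integral_cpow_mul_of_sublevel`: if the integral over `{M ≤ T}`
is `A T^κ`, then the integral against `M^(-s)` is `A s / (s - κ)`. For real quadratics `x^2 + u x +
v` the sublevel set is the trapezoid `|v| ≤ T`, `|u| ≤ T + v / T`, on which the antisymmetrised
moments have explicit primitives. Analyticity is read off from the final formulas. -/

/-- A set on which the derivative is invertible is a countable disjoint union of measurable sets
on which the map is injective. -/
theorem exists_partition_injOn_of_det_ne_zero {f : E → E} {f' : E → E →L[ℝ] E} {s : Set E}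
    (hf' : ∀ x, HasFDerivAt f (f' x) x) (hdet : ∀ x ∈ s, (f' x).det ≠ 0) :
    ∃ t : ℕ → Set E, Pairwise (Disjoint on t) ∧ (∀ n, MeasurableSet (t n)) ∧ (s ⊆ ⋃ n, t n) ∧
      ∀ n, InjOn f (s ∩ t n) := by
  classical
  -- A map within distance less than `‖A⁻¹‖⁻¹` of an invertible `A` is injective, so half of that is
  -- a safe tolerance; the value `1` is a filler for the remaining `A`.
  let r : (E →L[ℝ] E) → ℝ≥0 := fun A =>
    if h : ∃ B : E ≃L[ℝ] E, (B : E →L[ℝ] E) = A ∧ ‖(B.symm : E →L[ℝ] E)‖₊ ≠ 0 then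
      ‖(h.choose.symm : E →L[ℝ] E)‖₊⁻¹ / 2 else 1
  have hr : ∀ A, r A ≠ 0 := by
    intro A
    simp only [r]
    split_ifs with h
    · have := h.choose_spec.2
      positivity
    · exact one_ne_zero
  obtain ⟨t, A, h1, h2, h3, h4, h5⟩ :=
    exists_partition_approximatesLinearOn_of_hasFDerivWithinAt f s f'
      (fun x _ => (hf' x).hasFDerivWithinAt) r hr
  refine ⟨t, h1, h2, h3, fun n => ?_⟩
  rcases s.eq_empty_or_nonempty with rfl | hs
  · simp
  obtain ⟨y, hy, hA⟩ := h5 hs n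
  rcases subsingleton_or_nontrivial E with hE | hE
  · exact fun x _ y _ _ => Subsingleton.elim x y
  let B := ContinuousLinearMap.toContinuousLinearEquivOfDetNeZero (f' y) (hdet y hy)
  have hB : (B : E →L[ℝ] E) = A n := by rw [hA]; ext; simp [B]
  have hex : ∃ B : E ≃L[ℝ] E, (B : E →L[ℝ] E) = A n ∧ ‖(B.symm : E →L[ℝ] E)‖₊ ≠ 0 :=
    ⟨B, hB, B.nnnorm_symm_pos.ne'⟩
  have h6 := h4 n
  have h7 : r (A n) = ‖(hex.choose.symm : E →L[ℝ] E)‖₊⁻¹ / 2 := by simp only [r]; rw [dif_pos hex]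
  rw [h7] at h6
  have h8 : ApproximatesLinearOn f (hex.choose : E →L[ℝ] E) (s ∩ t n)
      (‖(hex.choose.symm : E →L[ℝ] E)‖₊⁻¹ / 2) := by rw [hex.choose_spec.1]; exact h6
  refine h8.injOn (Or.inr ?_)
  exact NNReal.half_lt_self (inv_ne_zero hex.choose_spec.2)

/-- On each piece of the partition this is the injective change of variables. Summing the indicators
of the images of the pieces counts the preimages of `y`. -/
theorem setLIntegral_abs_det_fderiv_eq_lintegral_encard {f : E → E} {f' : E → E →L[ℝ] E}
    {s B : Set E} (hs : MeasurableSet s) (hf' : ∀ x, HasFDerivAt f (f' x) x)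
    (hdet : ∀ x ∈ s, (f' x).det ≠ 0) (hB : MeasurableSet B) :
    ∫⁻ x in s ∩ f ⁻¹' B, ENNReal.ofReal |(f' x).det| ∂μ =
      ∫⁻ y in B, ((s ∩ f ⁻¹' {y}).encard : ℝ≥0∞) ∂μ := by
  obtain ⟨t, ht1, ht2, ht3, ht4⟩ := exists_partition_injOn_of_det_ne_zero hf' hdet
  have hfm : Measurable f :=
    (continuous_iff_continuousAt.2 fun x => (hf' x).continuousAt).measurable
  have hst : ∀ n, MeasurableSet (s ∩ t n) := fun n => hs.inter (ht2 n)
  have himg : ∀ n, MeasurableSet (f '' (s ∩ t n)) := fun n =>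
    measurable_image_of_fderivWithin (hst n) (fun x _ => (hf' x).hasFDerivWithinAt) (ht4 n)
  have hU : s ∩ f ⁻¹' B = ⋃ n, (s ∩ t n) ∩ f ⁻¹' B := by
    ext x
    simp only [mem_inter_iff, mem_iUnion]
    constructor
    · rintro ⟨h1, h2⟩
      obtain ⟨n, hn⟩ := mem_iUnion.1 (ht3 h1)
      exact ⟨n, ⟨h1, hn⟩, h2⟩
    · rintro ⟨n, ⟨h1, _⟩, h2⟩
      exact ⟨h1, h2⟩
  have hdisj : Pairwise (Disjoint on fun n => (s ∩ t n) ∩ f ⁻¹' B) := fun i j hij =>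
    (ht1 hij).mono (fun x hx => hx.1.2) (fun x hx => hx.1.2)
  rw [hU, lintegral_iUnion (fun n => (hst n).inter (hfm hB)) hdisj]
  have h1 : ∀ n, ∫⁻ x in (s ∩ t n) ∩ f ⁻¹' B, ENNReal.ofReal |(f' x).det| ∂μ =
      ∫⁻ y in B, (f '' (s ∩ t n)).indicator 1 y ∂μ := by
    intro n
    rw [lintegral_abs_det_fderiv_eq_addHaar_image μ ((hst n).inter (hfm hB))
      (fun x _ => (hf' x).hasFDerivWithinAt) ((ht4 n).mono inter_subset_left),
      lintegral_indicator_one (himg n), Measure.restrict_apply (himg n), image_inter_preimage]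
  simp_rw [h1]
  rw [← lintegral_tsum fun n => (measurable_one.indicator (himg n)).aemeasurable]
  refine lintegral_congr fun y => ?_
  have hfib : s ∩ f ⁻¹' {y} = ⋃ n, (s ∩ t n) ∩ f ⁻¹' {y} := by
    ext x
    simp only [mem_inter_iff, mem_iUnion]
    constructor
    · rintro ⟨h1, h2⟩
      obtain ⟨n, hn⟩ := mem_iUnion.1 (ht3 h1)
      exact ⟨n, ⟨h1, hn⟩, h2⟩
    · rintro ⟨n, ⟨h1, _⟩, h2⟩
      exact ⟨h1, h2⟩
  have hsub : ∀ n, ((s ∩ t n) ∩ f ⁻¹' {y}).Subsingleton := fun n a ha b hb =>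
    ht4 n ha.1 hb.1 (ha.2.trans hb.2.symm)
  have hmeas : ∀ n, MeasurableSet ((s ∩ t n) ∩ f ⁻¹' {y}) := fun n => (hsub n).measurableSet
  rw [← Measure.count_apply (by rw [hfib]; exact .iUnion hmeas), hfib,
    measure_iUnion (fun i j hij => (ht1 hij).mono (fun x hx => hx.1.2) (fun x hx => hx.1.2)) hmeas]
  refine tsum_congr fun n => ?_
  by_cases h : y ∈ f '' (s ∩ t n)
  · obtain ⟨x, hx, rfl⟩ := h
    have : (s ∩ t n) ∩ f ⁻¹' {f x} = {x} := (hsub n).eq_singleton_of_mem ⟨hx, rfl⟩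
    rw [this, indicator_of_mem (mem_image_of_mem f hx)]
    simp
  · have : (s ∩ t n) ∩ f ⁻¹' {y} = ∅ := by
      ext x
      simp only [mem_inter_iff, mem_empty_iff_false, iff_false]
      rintro ⟨hx, rfl⟩
      exact h ⟨x, hx, rfl⟩
    rw [this, indicator_of_notMem h]
    simp

/-- The degree formula: if almost every fiber of `f` is finite of bounded cardinality and the signs
of the Jacobian determinant along it add up to `d`, then `∫ det f' * (g ∘ f) = d * ∫ g`. -/
theorem integral_det_fderiv_mul_comp {f : E → E} {f' : E → E →L[ℝ] E}
    (hf' : ∀ x, HasFDerivAt f (f' x) x) (hcont : Continuous fun x => (f' x).det) (d C : ℕ)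
    (hfib : ∀ᵐ y ∂μ, ∃ T : Finset E, (T : Set E) = f ⁻¹' {y} ∧ T.card ≤ C ∧
      ∑ x ∈ T, (SignType.sign (f' x).det : ℤ) = (d : ℤ))
    {g : E → ℂ} (hg : Integrable g μ) :
    Integrable (fun x => ((f' x).det : ℂ) * g (f x)) μ ∧
      ∫ x, ((f' x).det : ℂ) * g (f x) ∂μ = d * ∫ y, g y ∂μ := by
  classical
  have hfm : Measurable f :=
    (continuous_iff_continuousAt.2 fun x => (hf' x).continuousAt).measurable
  have hdm : Measurable fun x => ENNReal.ofReal |(f' x).det| :=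
    (hcont.abs.measurable).ennreal_ofReal
  -- Critical points lie in neither set and have sign `0`. The measure `|det f'| μ` is pushed
  -- forward from `P` and from `Q` separately; the fiber counts differ by `d` almost everywhere, so
  -- the two images differ by `d μ`.
  let P : Set E := {x | 0 < (f' x).det}
  let Q : Set E := {x | (f' x).det < 0}
  have hP : MeasurableSet P := (isOpen_lt continuous_const hcont).measurableSet
  have hQ : MeasurableSet Q := (isOpen_lt hcont continuous_const).measurableSet
  let J : Set E → Measure E := fun s =>
    ((μ.restrict s).withDensity fun x => ENNReal.ofReal |(f' x).det|)
  let ν : Set E → Measure E := fun s => (J s).map f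
  have hν : ∀ s, MeasurableSet s → (∀ x ∈ s, (f' x).det ≠ 0) → ∀ B, MeasurableSet B →
      ν s B = ∫⁻ y in B, ((s ∩ f ⁻¹' {y}).encard : ℝ≥0∞) ∂μ := by
    intro s hs hdet B hB
    rw [← setLIntegral_abs_det_fderiv_eq_lintegral_encard μ hs hf' hdet hB]
    simp only [ν, J]
    rw [Measure.map_apply hfm hB, withDensity_apply _ (hfm hB),
      Measure.restrict_restrict (hfm hB), inter_comm]
  have hPd : ∀ x ∈ P, (f' x).det ≠ 0 := fun x hx => ne_of_gt hx
  have hQd : ∀ x ∈ Q, (f' x).det ≠ 0 := fun x hx => ne_of_lt hx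
  have hcount : ∀ᵐ y ∂μ, ∃ p q : ℕ, (P ∩ f ⁻¹' {y}).encard = p ∧ (Q ∩ f ⁻¹' {y}).encard = q ∧
      p = q + d ∧ p ≤ C ∧ q ≤ C := by
    filter_upwards [hfib] with y ⟨T, hT, hC, hd⟩
    refine ⟨(T.filter (· ∈ P)).card, (T.filter (· ∈ Q)).card, ?_, ?_, ?_, ?_, ?_⟩
    · rw [← hT, ← Set.encard_coe_eq_coe_finsetCard, Finset.coe_filter]
      congr 1; ext x; simp [and_comm]
    · rw [← hT, ← Set.encard_coe_eq_coe_finsetCard, Finset.coe_filter]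
      congr 1; ext x; simp [and_comm]
    · have : ∀ x, (SignType.sign (f' x).det : ℤ) = (if x ∈ P then 1 else 0) -
          (if x ∈ Q then 1 else 0) := by
        intro x
        simp only [P, Q, mem_ofPred_eq]
        rcases lt_trichotomy (f' x).det 0 with h | h | h
        · simp [h, sign_neg h, h.not_gt]
        · simp [h]
        · simp [h, sign_pos h, h.not_gt]
      simp_rw [this] at hd
      rw [Finset.sum_sub_distrib, Finset.sum_boole, Finset.sum_boole] at hd
      lia
    · exact (Finset.card_filter_le _ _).trans hC
    · exact (Finset.card_filter_le _ _).trans hC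
  -- The bound on the fibers dominates both images by a multiple of `μ`; hence `g` is integrable for
  -- each and the difference may be taken.
  have hle : ∀ s, (s = P ∨ s = Q) → ν s ≤ (C : ℝ≥0∞) • μ := by
    intro s hs
    refine Measure.le_iff.2 fun B hB => ?_
    have : ν s B = ∫⁻ y in B, ((s ∩ f ⁻¹' {y}).encard : ℝ≥0∞) ∂μ := by
      rcases hs with rfl | rfl
      · exact hν _ hP hPd B hB
      · exact hν _ hQ hQd B hB
    rw [this, Measure.smul_apply, smul_eq_mul, ← setLIntegral_const]
    refine lintegral_mono_ae ?_
    filter_upwards [ae_restrict_of_ae hcount] with y ⟨p, q, hp, hq, _, h1, h2⟩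
    rcases hs with rfl | rfl
    · rw [hp]; exact_mod_cast h1
    · rw [hq]; exact_mod_cast h2
  have hintν : ∀ s, (s = P ∨ s = Q) → Integrable g (ν s) := fun s hs =>
    (hg.smul_measure (ENNReal.natCast_ne_top C)).mono_measure (hle s hs)
  have hadd : ν P = ν Q + (d : ℝ≥0∞) • μ := by
    ext B hB
    rw [Measure.add_apply, hν P hP hPd B hB, hν Q hQ hQd B hB, Measure.smul_apply, smul_eq_mul,
      ← setLIntegral_const, ← lintegral_add_right _ measurable_const]
    refine lintegral_congr_ae ?_
    filter_upwards [ae_restrict_of_ae hcount] with y ⟨p, q, hp, hq, h, _⟩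
    rw [hp, hq, h]
    norm_cast
  have hintP := hintν P (Or.inl rfl)
  have hintQ := hintν Q (Or.inr rfl)
  have hlt : ∀ s : Set E, ∀ᵐ x ∂(μ.restrict s), ENNReal.ofReal |(f' x).det| < ∞ := fun s =>
    Filter.Eventually.of_forall fun x => ENNReal.ofReal_lt_top
  have key : ∀ s, Integrable g (ν s) → IntegrableOn (fun x => |(f' x).det| • g (f x)) s μ ∧
      ∫ y, g y ∂(ν s) = ∫ x in s, |(f' x).det| • g (f x) ∂μ := by
    intro s hs
    have h1 : Integrable (g ∘ f) (J s) := (integrable_map_measure hs.1 hfm.aemeasurable).1 hs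
    constructor
    · have := (integrable_withDensity_iff_integrable_smul' hdm (hlt s)).1 h1
      refine this.congr (Filter.Eventually.of_forall fun x => ?_)
      simp [ENNReal.toReal_ofReal (abs_nonneg _)]
    · simp only [ν]
      rw [integral_map hfm.aemeasurable hs.1]
      simp only [J]
      rw [integral_withDensity_eq_integral_toReal_smul hdm (hlt s)]
      simp [ENNReal.toReal_ofReal (abs_nonneg _)]
  obtain ⟨iP, eP⟩ := key P hintP
  obtain ⟨iQ, eQ⟩ := key Q hintQ
  have hsplit : (fun x => ((f' x).det : ℂ) * g (f x)) =
      fun x => P.indicator (fun x => |(f' x).det| • g (f x)) x -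
        Q.indicator (fun x => |(f' x).det| • g (f x)) x := by
    funext x
    rcases lt_trichotomy (f' x).det 0 with h | h | h
    · have h1 : x ∉ P := fun h' => lt_asymm h h'
      have h2 : x ∈ Q := h
      simp [h1, h2, abs_of_neg h]
    · have h1 : x ∉ P := fun h' => h.not_gt h'
      have h2 : x ∉ Q := fun h' => h.not_lt h'
      simp [h1, h2, h]
    · have h1 : x ∉ Q := fun h' => lt_asymm h h'
      have h2 : x ∈ P := h
      simp [h1, h2, abs_of_pos h]
  have iP' := iP.integrable_indicator hP
  have iQ' := iQ.integrable_indicator hQ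
  rw [hsplit]
  refine ⟨iP'.sub iQ', ?_⟩
  rw [integral_sub iP' iQ', integral_indicator hP, integral_indicator hQ, ← eP, ← eQ, hadd,
    integral_add_measure hintQ (hg.smul_measure (ENNReal.natCast_ne_top d)), integral_smul_measure]
  simp

end AreaFormula

/-! ### The multiplication map on monic polynomials and its Jacobian -/

section MulCoeffs

open Polynomial

/-- The polynomial of degree `< n` with given coefficients. -/
noncomputable def lowPoly {R : Type*} [CommRing R] {n : ℕ} (a : Fin n → R) : R[X] :=
  ∑ i : Fin n, C (a i) * X ^ (i : ℕ)

/-- The monic polynomial of degree `n` with given lower coefficients. -/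
noncomputable def monPoly {R : Type*} [CommRing R] {n : ℕ} (a : Fin n → R) : R[X] :=
  X ^ n + lowPoly a

section Ring

variable {R : Type*} [CommRing R] {m n : ℕ}

theorem coeff_lowPoly (a : Fin n → R) (k : ℕ) :
    (lowPoly a).coeff k = if h : k < n then a ⟨k, h⟩ else 0 := by
  simp only [lowPoly, finsetSum_coeff, coeff_C_mul, coeff_X_pow, mul_ite, mul_one, mul_zero]
  split_ifs with h
  · rw [Finset.sum_eq_single ⟨k, h⟩]
    · simp
    · intro b _ hb
      rw [if_neg]
      rintro rfl
      exact hb rfl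
    · simp
  · refine Finset.sum_eq_zero fun i _ => if_neg ?_
    rintro rfl
    exact h i.2

theorem degree_lowPoly_lt (a : Fin n → R) : (lowPoly a).degree < n := by
  rw [degree_lt_iff_coeff_zero]
  intro k hk
  rw [coeff_lowPoly, dif_neg (not_lt.2 hk)]

theorem coeff_monPoly (a : Fin n → R) (k : ℕ) :
    (monPoly a).coeff k = if h : k < n then a ⟨k, h⟩ else if k = n then 1 else 0 := by
  rw [monPoly, coeff_add, coeff_X_pow, coeff_lowPoly]
  split_ifs <;> first | lia | simp

theorem monic_monPoly (a : Fin n → R) : (monPoly a).Monic :=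
  monic_X_pow_add (degree_lowPoly_lt a)

theorem natDegree_monPoly [Nontrivial R] (a : Fin n → R) : (monPoly a).natDegree = n := by
  rw [monPoly, add_comm, natDegree_add_eq_right_of_degree_lt]
  · simp
  · simpa using degree_lowPoly_lt a

theorem exists_monPoly_eq [Nontrivial R] {p : R[X]} (hp : p.Monic) (hd : p.natDegree = n) :
    monPoly (fun i : Fin n => p.coeff i) = p := by
  ext k
  rw [coeff_monPoly]
  split_ifs with h1 h2
  · rfl
  · rw [h2, ← hd, coeff_natDegree, hp.leadingCoeff]
  · rw [coeff_eq_zero_of_natDegree_lt]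
    lia

theorem monPoly_injective : Function.Injective (monPoly : (Fin n → R) → R[X]) := by
  intro a b h
  funext i
  have := congrArg (fun p => p.coeff (i : ℕ)) h
  simpa [coeff_monPoly] using this

theorem map_monPoly {S : Type*} [CommRing S] (φ : R →+* S) (a : Fin n → R) :
    (monPoly a).map φ = monPoly fun i => φ (a i) := by
  simp [monPoly, lowPoly, Polynomial.map_sum]

/-- The coefficients of the product of the monic polynomials whose lower coefficients are the
first `m` and the last `n` entries of a vector. -/
noncomputable def mulCoeffs (m n : ℕ) (x : Fin (m + n) → R) : Fin (m + n) → R := fun i =>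
  (monPoly (fun j => x (Fin.castAdd n j)) * monPoly (fun j => x (Fin.natAdd m j))).coeff i

theorem monPoly_mulCoeffs [Nontrivial R] (x : Fin (m + n) → R) : monPoly (mulCoeffs m n x) =
    monPoly (fun j => x (Fin.castAdd n j)) * monPoly (fun j => x (Fin.natAdd m j)) := by
  refine exists_monPoly_eq ((monic_monPoly _).mul (monic_monPoly _)) ?_
  rw [(monic_monPoly _).natDegree_mul (monic_monPoly _), natDegree_monPoly, natDegree_monPoly]

/-- The Sylvester matrix is the linear map `(h, k) ↦ f k + h g`, the differential of multiplication
at `(f, g)`: the first `m` coordinates vary the first factor, the last `n` the second. -/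
theorem sylvester_mulVec (f g : R[X]) (hf : f.natDegree ≤ m) (hg : g.natDegree ≤ n)
    (h : Fin (m + n) → R) (i : Fin (m + n)) :
    (sylvester f g m n).mulVec h i =
      (f * lowPoly (fun j => h (Fin.natAdd m j)) +
        lowPoly (fun j => h (Fin.castAdd n j)) * g).coeff i := by
  rw [Matrix.mulVec, dotProduct, Fin.sum_univ_add, coeff_add, add_comm]
  congr 1
  · simp only [lowPoly, Finset.mul_sum, finsetSum_coeff, sylvester, Matrix.of_apply,
      Fin.addCases_right]
    refine Finset.sum_congr rfl fun j _ => ?_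
    rw [show f * (C (h (Fin.natAdd m j)) * X ^ (j : ℕ)) =
      C (h (Fin.natAdd m j)) * (f * X ^ (j : ℕ)) by ring, coeff_C_mul, coeff_mul_X_pow', mul_comm]
    congr 1
    simp only [Set.mem_Icc]
    split_ifs with h1 h2 h2 <;> first | rfl | lia | skip
    rw [coeff_eq_zero_of_natDegree_lt]; lia
  · simp only [lowPoly, Finset.sum_mul, finsetSum_coeff, sylvester, Matrix.of_apply,
      Fin.addCases_left]
    refine Finset.sum_congr rfl fun j _ => ?_
    rw [show (C (h (Fin.castAdd n j)) * X ^ (j : ℕ)) * g =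
      C (h (Fin.castAdd n j)) * (g * X ^ (j : ℕ)) by ring, coeff_C_mul, coeff_mul_X_pow', mul_comm]
    congr 1
    simp only [Set.mem_Icc]
    split_ifs with h1 h2 h2 <;> first | rfl | lia | skip
    rw [coeff_eq_zero_of_natDegree_lt]; lia

end Ring

section Deriv

variable {K : Type*} [NontriviallyNormedField K] {m n : ℕ}

theorem hasFDerivAt_coeff_monPoly [CompleteSpace K] {ι : Type*} [Fintype ι]
    (e : Fin n → ι) (x : ι → K) (k : ℕ) :
    ∃ L : (ι → K) →L[K] K, (∀ h, L h = (lowPoly fun j => h (e j)).coeff k) ∧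
      HasFDerivAt (fun x : ι → K => (monPoly fun j => x (e j)).coeff k) L x := by
  by_cases hk : k < n
  · refine ⟨ContinuousLinearMap.proj (e ⟨k, hk⟩), fun h => ?_, ?_⟩
    · simp [coeff_lowPoly, hk]
    · have : (fun x : ι → K => (monPoly fun j => x (e j)).coeff k) = fun x => x (e ⟨k, hk⟩) := by
        funext x; simp [coeff_monPoly, hk]
      rw [this]
      exact (ContinuousLinearMap.proj (R := K) (φ := fun _ : ι => K) (e ⟨k, hk⟩)).hasFDerivAt
  · refine ⟨0, fun h => ?_, ?_⟩
    · simp [coeff_lowPoly, hk]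
    · have : (fun x : ι → K => (monPoly fun j => x (e j)).coeff k) =
          fun x => if k = n then 1 else 0 := by
        funext x; simp [coeff_monPoly, hk]
      rw [this]
      exact hasFDerivAt_const _ _

/-- The derivative of `mulCoeffs`: the Sylvester matrix of the two factors. -/
noncomputable def mulCoeffsDeriv [CompleteSpace K] (m n : ℕ) (x : Fin (m + n) → K) :
    (Fin (m + n) → K) →L[K] (Fin (m + n) → K) :=
  LinearMap.toContinuousLinearMap (Matrix.toLin' (sylvester (monPoly fun j => x (Fin.castAdd n j))
    (monPoly fun j => x (Fin.natAdd m j)) m n))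

theorem hasFDerivAt_mulCoeffs [CompleteSpace K] (x : Fin (m + n) → K) :
    HasFDerivAt (mulCoeffs m n) (mulCoeffsDeriv m n x) x := by
  rw [hasFDerivAt_pi']
  intro i
  choose L1 hL1 hD1 using fun k => hasFDerivAt_coeff_monPoly (K := K)
    (Fin.castAdd n : Fin m → Fin (m + n)) x k
  choose L2 hL2 hD2 using fun k => hasFDerivAt_coeff_monPoly (K := K)
    (Fin.natAdd m : Fin n → Fin (m + n)) x k
  have hD : HasFDerivAt (fun x => mulCoeffs m n x i)
      (∑ p ∈ Finset.HasAntidiagonal.antidiagonal (i : ℕ),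
        ((monPoly fun j => x (Fin.castAdd n j)).coeff p.1 • L2 p.2 +
          (monPoly fun j => x (Fin.natAdd m j)).coeff p.2 • L1 p.1)) x := by
    have : (fun x : Fin (m + n) → K => mulCoeffs m n x i) = fun x =>
        ∑ p ∈ Finset.HasAntidiagonal.antidiagonal (i : ℕ), (monPoly fun j => x (Fin.castAdd n j)).coeff p.1 *
          (monPoly fun j => x (Fin.natAdd m j)).coeff p.2 := by
      funext x
      simp [mulCoeffs, coeff_mul]
    rw [this]
    exact HasFDerivAt.fun_sum fun p _ => (hD1 p.1).mul (hD2 p.2)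
  refine hD.congr_fderiv ?_
  ext1 h
  have := sylvester_mulVec (monPoly fun j => x (Fin.castAdd n j))
    (monPoly fun j => x (Fin.natAdd m j)) (natDegree_monPoly _).le (natDegree_monPoly _).le h i
  simp only [mulCoeffsDeriv, ContinuousLinearMap.coe_comp, Function.comp_apply,
    LinearMap.coe_toContinuousLinearMap', Matrix.toLin'_apply, ContinuousLinearMap.proj_apply]
  rw [this, coeff_add, coeff_mul, coeff_mul, ← Finset.sum_add_distrib]
  simp only [_root_.sum_apply, _root_.add_apply,
    _root_.smul_apply, hL1, hL2, smul_eq_mul]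
  exact Finset.sum_congr rfl fun p _ => by ring

theorem det_mulCoeffsDeriv [CompleteSpace K] (x : Fin (m + n) → K) :
    (mulCoeffsDeriv m n x : (Fin (m + n) → K) →ₗ[K] (Fin (m + n) → K)).det =
      resultant (monPoly fun j => x (Fin.castAdd n j)) (monPoly fun j => x (Fin.natAdd m j)) m n := by
  rw [mulCoeffsDeriv, LinearMap.coe_toContinuousLinearMap, LinearMap.det_toLin', resultant]

theorem continuous_resultant_monPoly :
    Continuous fun x : Fin (m + n) → K => resultant (monPoly fun j => x (Fin.castAdd n j))
      (monPoly fun j => x (Fin.natAdd m j)) m n := by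
  unfold resultant
  refine Continuous.matrix_det (continuous_matrix fun i j => ?_)
  have h : ∀ {ι : Type} [Fintype ι] {n : ℕ} (e : Fin n → ι) (k : ℕ),
      Continuous fun x : ι → K => (monPoly fun j => x (e j)).coeff k := by
    intro ι _ n e k
    simp only [coeff_monPoly]
    split_ifs <;> fun_prop
  refine Fin.addCases (fun j => ?_) (fun j => ?_) j
  · simp only [sylvester, Matrix.of_apply, Fin.addCases_left]
    split_ifs
    · exact h _ _
    · exact continuous_const
  · simp only [sylvester, Matrix.of_apply, Fin.addCases_right]
    split_ifs
    · exact h _ _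
    · exact continuous_const

end Deriv

end MulCoeffs

/-! ### Fibers of multiplication, critical values, and the complex degree -/

section Fibers

open Polynomial

section Field

variable {K : Type*} [Field K] {m n : ℕ}

/-- The vector of lower coefficients of the cofactor of `q` in `monPoly y`, followed by those
of `q`. -/
noncomputable def splitCoeffs (m n : ℕ) (y : Fin (m + n) → K) (q : K[X]) : Fin (m + n) → K :=
  Fin.append (fun i : Fin m => (monPoly y /ₘ q).coeff i) (fun i : Fin n => q.coeff i)

theorem monPoly_splitCoeffs_right {y : Fin (m + n) → K} {q : K[X]} (hq : q.Monic)
    (hd : q.natDegree = n) :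
    monPoly (fun j => splitCoeffs m n y q (Fin.natAdd m j)) = q := by
  simp only [splitCoeffs, Fin.append_right]
  exact exists_monPoly_eq hq hd

theorem monPoly_splitCoeffs_left {y : Fin (m + n) → K} {q : K[X]} (hq : q.Monic)
    (hd : q.natDegree = n) (hdvd : q ∣ monPoly y) :
    monPoly (fun j => splitCoeffs m n y q (Fin.castAdd n j)) = monPoly y /ₘ q := by
  simp only [splitCoeffs, Fin.append_left]
  obtain ⟨g, hg⟩ := hdvd
  have hgm : g.Monic := hq.of_mul_monic_left (hg ▸ monic_monPoly y)
  have : monPoly y /ₘ q = g := by rw [hg, mul_divByMonic_cancel_left _ hq]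
  rw [this]
  refine exists_monPoly_eq hgm ?_
  have := congrArg natDegree hg
  rw [natDegree_monPoly, hq.natDegree_mul hgm, hd] at this
  lia

theorem mul_divByMonic_eq {f q : K[X]} (hq : q.Monic) (hdvd : q ∣ f) : f /ₘ q * q = f := by
  obtain ⟨g, rfl⟩ := hdvd
  rw [mul_divByMonic_cancel_left _ hq, mul_comm]

theorem mulCoeffs_splitCoeffs {y : Fin (m + n) → K} {q : K[X]} (hq : q.Monic)
    (hd : q.natDegree = n) (hdvd : q ∣ monPoly y) : mulCoeffs m n (splitCoeffs m n y q) = y := by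
  apply monPoly_injective
  rw [monPoly_mulCoeffs, monPoly_splitCoeffs_right hq hd, monPoly_splitCoeffs_left hq hd hdvd,
    mul_divByMonic_eq hq hdvd]

theorem splitCoeffs_mulCoeffs (x : Fin (m + n) → K) :
    splitCoeffs m n (mulCoeffs m n x) (monPoly fun j => x (Fin.natAdd m j)) = x := by
  funext i
  refine Fin.addCases (fun j => ?_) (fun j => ?_) i
  · rw [splitCoeffs, monPoly_mulCoeffs, mul_comm, mul_divByMonic_cancel_left _ (monic_monPoly _),
      Fin.append_left]
    simp [coeff_monPoly]
  · simp [splitCoeffs, coeff_monPoly]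

/-- The fiber of `mulCoeffs` over `y` corresponds to the monic divisors of `monPoly y`. -/
theorem fiber_mulCoeffs [DecidableEq K] {y : Fin (m + n) → K} {D : Finset K[X]}
    (hD : ∀ q, q ∈ D ↔ q.Monic ∧ q.natDegree = n ∧ q ∣ monPoly y) :
    ((D.image (splitCoeffs m n y) : Finset (Fin (m + n) → K)) : Set (Fin (m + n) → K)) =
      mulCoeffs m n ⁻¹' {y} := by
  ext x
  simp only [Finset.coe_image, Set.mem_image, SetLike.mem_coe, Set.mem_preimage,
    Set.mem_singleton_iff]
  constructor
  · rintro ⟨q, hq, rfl⟩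
    obtain ⟨h1, h2, h3⟩ := (hD q).1 hq
    exact mulCoeffs_splitCoeffs h1 h2 h3
  · rintro rfl
    refine ⟨_, (hD _).2 ⟨monic_monPoly _, natDegree_monPoly _, ?_⟩, splitCoeffs_mulCoeffs x⟩
    rw [monPoly_mulCoeffs]
    exact dvd_mul_left _ _

theorem sum_fiber_mulCoeffs [DecidableEq K] {M : Type*} [AddCommMonoid M]
    {y : Fin (m + n) → K} {D : Finset K[X]}
    (hD : ∀ q, q ∈ D ↔ q.Monic ∧ q.natDegree = n ∧ q ∣ monPoly y) (F : K[X] → K[X] → M) :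
    ∑ x ∈ D.image (splitCoeffs m n y), F (monPoly fun j => x (Fin.castAdd n j))
      (monPoly fun j => x (Fin.natAdd m j)) = ∑ q ∈ D, F (monPoly y /ₘ q) q := by
  rw [Finset.sum_image]
  · refine Finset.sum_congr rfl fun q hq => ?_
    obtain ⟨h1, h2, h3⟩ := (hD q).1 hq
    rw [monPoly_splitCoeffs_left h1 h2 h3, monPoly_splitCoeffs_right h1 h2]
  · intro q hq q' hq' h
    obtain ⟨h1, h2, h3⟩ := (hD q).1 hq
    obtain ⟨h1', h2', h3'⟩ := (hD q').1 hq'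
    rw [← monPoly_splitCoeffs_right (m := m) (y := y) h1 h2, h,
      monPoly_splitCoeffs_right h1' h2']

end Field

section Null

variable {K : Type*} [RCLike K] {m n : ℕ}

/-- The real determinant of a `K`-linear map is the norm of its determinant over `K`: the resultant
itself for `ℝ`, its squared modulus for `ℂ`. -/
theorem det_restrictScalars_mulCoeffsDeriv (x : Fin (m + n) → K) :
    ((mulCoeffsDeriv m n x).restrictScalars ℝ).det = Algebra.norm ℝ
      (resultant (monPoly fun j => x (Fin.castAdd n j)) (monPoly fun j => x (Fin.natAdd m j)) m n)
        := by
  rw [← det_mulCoeffsDeriv, ← LinearMap.det_restrictScalars]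
  rfl

theorem hasFDerivAt_real_mulCoeffs (x : Fin (m + n) → K) :
    HasFDerivAt (mulCoeffs m n) ((mulCoeffsDeriv m n x).restrictScalars ℝ) x :=
  (hasFDerivAt_mulCoeffs x).restrictScalars ℝ

theorem resultant_monPoly_ne_zero_iff {x : Fin (m + n) → K} :
    resultant (monPoly fun j => x (Fin.castAdd n j)) (monPoly fun j => x (Fin.natAdd m j)) m n ≠ 0 ↔
      IsCoprime (monPoly fun j => x (Fin.castAdd n j)) (monPoly fun j => x (Fin.natAdd m j)) := by
  have h := resultant_eq_zero_iff (f := monPoly fun j => x (Fin.castAdd n j))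
    (g := monPoly fun j => x (Fin.natAdd m j))
  rw [natDegree_monPoly, natDegree_monPoly] at h
  rw [ne_eq, h]
  simp [(monic_monPoly _).ne_zero]

/-- Almost every monic polynomial is not divisible by the square of a monic polynomial of given
positive degree. -/
theorem ae_not_sq_dvd [MeasurableSpace K] [BorelSpace K]
    (μ : Measure (Fin (m + n) → K)) [μ.IsAddHaarMeasure] (hn : n ≠ 0) :
    ∀ᵐ y ∂μ, ∀ p : K[X], p.Monic → p.natDegree = n → ¬ p * p ∣ monPoly y := by
  -- The easy case of Sard's theorem: critical values form a null set. If `p * p` divides `monPoly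
  -- y`, then `y` is the image of the pair formed by the cofactor of `p` and `p`, which have a
  -- common factor and hence resultant zero.
  have h := addHaar_image_eq_zero_of_det_fderivWithin_eq_zero μ
    (s := {x : Fin (m + n) → K | ((mulCoeffsDeriv m n x).restrictScalars ℝ).det = 0})
    (fun x _ => (hasFDerivAt_real_mulCoeffs x).hasFDerivWithinAt) (fun x hx => hx)
  rw [ae_iff]
  refine measure_mono_null (fun y hy => ?_) h
  simp only [not_forall, not_not, Set.mem_ofPred_eq] at hy
  obtain ⟨p, hp, hd, hdvd⟩ := hy
  have hdvd' : p ∣ monPoly y := (dvd_mul_left p p).trans hdvd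
  refine ⟨splitCoeffs m n y p, ?_, mulCoeffs_splitCoeffs hp hd hdvd'⟩
  simp only [Set.mem_ofPred_eq]
  rw [det_restrictScalars_mulCoeffsDeriv]
  have : resultant (monPoly fun j => splitCoeffs m n y p (Fin.castAdd n j))
      (monPoly fun j => splitCoeffs m n y p (Fin.natAdd m j)) m n = 0 := by
    by_contra hne
    have := resultant_monPoly_ne_zero_iff.1 hne
    rw [monPoly_splitCoeffs_left hp hd hdvd', monPoly_splitCoeffs_right hp hd] at this
    have h2 : p ∣ monPoly y /ₘ p := by
      obtain ⟨r, hr⟩ := hdvd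
      rw [hr, mul_assoc, mul_divByMonic_cancel_left _ hp]
      exact dvd_mul_right _ _
    have h3 := (this.isUnit_of_dvd' h2 dvd_rfl)
    rw [hp.isUnit_iff] at h3
    rw [h3] at hd
    simp at hd
    exact hn hd.symm
  rw [this]
  simp

end Null

/-- Each linear factor contributes a value of `g` with sign `(-1)^m`; the two signs cancel. -/
theorem resultant_quadratic_right {R : Type*} [CommRing R] [IsDomain R] (g : R[X]) (a b : R) (m : ℕ)
    (hg : g.natDegree ≤ m) :
    resultant g ((X - C a) * (X - C b)) m 2 = g.eval a * g.eval b := by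
  have h := resultant_mul_right g (X - C a) (X - C b) m hg
  rw [natDegree_X_sub_C, natDegree_X_sub_C, resultant_X_sub_C_right _ _ _ hg,
    resultant_X_sub_C_right _ _ _ hg] at h
  rw [show (2 : ℕ) = 1 + 1 from rfl, h, mul_mul_mul_comm, ← pow_add, ← two_mul, pow_mul]
  simp

/-- The degree of the multiplication map for complex linear factors. -/
theorem ae_fiber_linear_complex (m : ℕ) : ∀ᵐ y : Fin (m + 1) → ℂ,
    ∃ T : Finset (Fin (m + 1) → ℂ), (T : Set (Fin (m + 1) → ℂ)) = mulCoeffs m 1 ⁻¹' {y} ∧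
      T.card ≤ m + 1 ∧
      ∑ x ∈ T, (SignType.sign ((mulCoeffsDeriv m 1 x).restrictScalars ℝ).det : ℤ) =
        ((m + 1 : ℕ) : ℤ) := by
  classical
  filter_upwards [ae_not_sq_dvd volume (m := m) (n := 1) (K := ℂ) one_ne_zero] with y hy
  have hnd : (monPoly y).roots.Nodup := by
    rw [Multiset.nodup_iff_count_le_one]
    intro a
    rw [count_roots]
    by_contra! h
    refine hy (X - C a) (monic_X_sub_C a) (natDegree_X_sub_C a) ?_
    rw [← sq]
    exact (pow_dvd_pow _ h).trans (pow_rootMultiplicity_dvd _ _)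
  let D : Finset ℂ[X] := (monPoly y).roots.toFinset.image fun z => X - C z
  have hD : ∀ q, q ∈ D ↔ q.Monic ∧ q.natDegree = 1 ∧ q ∣ monPoly y := by
    intro q
    simp only [D, Finset.mem_image, Multiset.mem_toFinset, mem_roots (monic_monPoly y).ne_zero]
    constructor
    · rintro ⟨z, hz, rfl⟩
      exact ⟨monic_X_sub_C z, natDegree_X_sub_C z, dvd_iff_isRoot.2 hz⟩
    · rintro ⟨h1, h2, h3⟩
      have : q = X - C (-q.coeff 0) := by
        rw [map_neg, sub_neg_eq_add]
        exact h1.eq_X_add_C h2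
      refine ⟨-q.coeff 0, ?_, this.symm⟩
      rw [← dvd_iff_isRoot, ← this]
      exact h3
  have hDcard : D.card = m + 1 := by
    rw [Finset.card_image_of_injective]
    · rw [Multiset.toFinset_card_of_nodup hnd, ← (IsAlgClosed.splits _).natDegree_eq_card_roots,
        natDegree_monPoly]
    · intro a b h
      simpa using h
  refine ⟨D.image (splitCoeffs m 1 y), fiber_mulCoeffs hD,
    Finset.card_image_le.trans hDcard.le, ?_⟩
  simp only [det_restrictScalars_mulCoeffsDeriv]
  rw [sum_fiber_mulCoeffs hD fun f g =>
    (SignType.sign (Algebra.norm ℝ (resultant f g m 1)) : ℤ)]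
  -- The real Jacobian is the squared modulus of a nonzero resultant, so every point of the fiber
  -- counts `+1` and the signed count is the number of roots.
  rw [Finset.sum_congr rfl (g := fun _ => (1 : ℤ))]
  · simp [hDcard]
  intro q hq
  obtain ⟨h1, h2, h3⟩ := (hD q).1 hq
  have hne : resultant (monPoly y /ₘ q) q m 1 ≠ 0 := by
    have := (resultant_monPoly_ne_zero_iff (x := splitCoeffs m 1 y q)).2
    rw [monPoly_splitCoeffs_left h1 h2 h3, monPoly_splitCoeffs_right h1 h2] at this
    apply this
    have hirr : Irreducible q := irreducible_of_degree_eq_one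
      ((degree_eq_iff_natDegree_eq_of_pos one_pos).2 h2)
    rw [isCoprime_comm, hirr.coprime_iff_not_dvd]
    intro h
    refine hy q h1 h2 ?_
    rw [← mul_divByMonic_eq h1 h3]
    exact mul_dvd_mul_right h q
  rw [Algebra.norm_complex_apply, sign_pos (Complex.normSq_pos.2 hne)]
  rfl

end Fibers

/-! ### Signed count of the quadratic divisors of a real polynomial -/

section RealFibers

open Polynomial

/-- The alternating signs of the derivative at the roots add up to `0` or `1`. -/
theorem sum_sign_prod_sub (A : Finset ℝ) :
    ∑ x ∈ A, (SignType.sign (∏ a ∈ A.erase x, (x - a)) : ℤ) = (A.card % 2 : ℕ) := by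
  classical
  induction A using Finset.induction_on_max with
  | empty => simp
  | insert M A hM ih =>
    have hMA : M ∉ A := fun h => lt_irrefl _ (hM M h)
    rw [Finset.sum_insert hMA, Finset.erase_insert hMA, Finset.card_insert_of_notMem hMA]
    have h1 : (SignType.sign (∏ a ∈ A, (M - a)) : ℤ) = 1 := by
      rw [sign_pos (Finset.prod_pos fun a ha => sub_pos.2 (hM a ha))]
      rfl
    -- A new maximum `M` brings a negative factor `x - M` to every earlier point, so the sum `σ`
    -- turns into `1 - σ`.
    have h2 : ∑ x ∈ A, (SignType.sign (∏ a ∈ (insert M A).erase x, (x - a)) : ℤ) =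
        ∑ x ∈ A, -(SignType.sign (∏ a ∈ A.erase x, (x - a)) : ℤ) := by
      refine Finset.sum_congr rfl fun x hx => ?_
      rw [Finset.erase_insert_of_ne (hM x hx).ne',
        Finset.prod_insert (fun h => hMA (Finset.mem_of_mem_erase h)), sign_mul,
        sign_neg (sub_neg.2 (hM x hx))]
      simp
    rw [h1, h2, Finset.sum_neg_distrib, ih]
    lia

theorem two_mul_sum_lt_mul {A : Finset ℝ} (ε : ℝ → ℤ) :
    2 * ∑ p ∈ (A ×ˢ A).filter (fun p => p.1 < p.2), ε p.1 * ε p.2 =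
      (∑ x ∈ A, ε x) ^ 2 - ∑ x ∈ A, ε x ^ 2 := by
  classical
  have h1 : (∑ x ∈ A, ε x) ^ 2 = ∑ p ∈ A ×ˢ A, ε p.1 * ε p.2 := by
    rw [sq, Finset.sum_mul_sum, Finset.sum_product]
  have h2 : ∑ p ∈ A ×ˢ A, ε p.1 * ε p.2 =
      ∑ p ∈ (A ×ˢ A).filter (fun p => p.1 < p.2), ε p.1 * ε p.2 +
      (∑ p ∈ (A ×ˢ A).filter (fun p => p.2 < p.1), ε p.1 * ε p.2 +
      ∑ p ∈ (A ×ˢ A).filter (fun p => p.1 = p.2), ε p.1 * ε p.2) := by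
    rw [← Finset.sum_filter_add_sum_filter_not (A ×ˢ A) (fun p => p.1 < p.2)]
    congr 1
    rw [← Finset.sum_filter_add_sum_filter_not ((A ×ˢ A).filter _) (fun p => p.2 < p.1),
      Finset.filter_filter, Finset.filter_filter]
    congr 1
    · refine Finset.sum_congr (Finset.filter_congr fun p _ => ?_) fun _ _ => rfl
      exact ⟨fun h => h.2, fun h => ⟨h.not_gt, h⟩⟩
    · refine Finset.sum_congr (Finset.filter_congr fun p _ => ?_) fun _ _ => rfl
      exact ⟨fun h => le_antisymm (not_lt.1 h.2) (not_lt.1 h.1), fun h => by simp [h]⟩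
  have h3 : ∑ p ∈ (A ×ˢ A).filter (fun p => p.2 < p.1), ε p.1 * ε p.2 =
      ∑ p ∈ (A ×ˢ A).filter (fun p => p.1 < p.2), ε p.1 * ε p.2 := by
    refine Finset.sum_bij' (fun p _ => p.swap) (fun p _ => p.swap) ?_ ?_ ?_ ?_ ?_
    · intro p hp; simp only [Finset.mem_filter, Finset.mem_product, Prod.fst_swap,
        Prod.snd_swap] at hp ⊢; tauto
    · intro p hp; simp only [Finset.mem_filter, Finset.mem_product, Prod.fst_swap,
        Prod.snd_swap] at hp ⊢; tauto
    · intro p _; simp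
    · intro p _; simp
    · intro p _; simp [mul_comm]
  have h4 : ∑ p ∈ (A ×ˢ A).filter (fun p => p.1 = p.2), ε p.1 * ε p.2 = ∑ x ∈ A, ε x ^ 2 := by
    symm
    refine Finset.sum_bij (fun x _ => (x, x)) ?_ ?_ ?_ ?_
    · intro x hx; simp [hx]
    · intro x _ y _ h; simpa using h
    · rintro ⟨x, y⟩ hp
      simp only [Finset.mem_filter, Finset.mem_product] at hp
      obtain ⟨⟨hx, _⟩, rfl⟩ := hp
      exact ⟨x, hx, rfl⟩
    · intro x _; simp [sq]
  rw [h1, h2, h3, h4]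
  ring

/-- A monic real polynomial without real roots is positive. -/
theorem eval_pos_of_no_roots {h : ℝ[X]} (hm : h.Monic) (hr : ∀ x, ¬ h.IsRoot x) (x : ℝ) :
    0 < h.eval x := by
  by_contra! hx
  by_cases hd : 0 < h.degree
  · have ht := tendsto_atTop_of_leadingCoeff_nonneg h hd (by rw [hm.leadingCoeff]; exact zero_le_one)
    obtain ⟨y, hxy, hy⟩ := ((Filter.eventually_ge_atTop x).and (ht.eventually_ge_atTop 0)).exists
    obtain ⟨c, _, hc⟩ := intermediate_value_Icc hxy h.continuous.continuousOn ⟨hx, hy⟩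
    exact hr c hc
  · have := eq_C_of_degree_le_zero (not_lt.1 hd)
    have h1 := hm.leadingCoeff
    rw [this, leadingCoeff_C] at h1
    rw [this, eval_C, h1] at hx
    norm_num at hx

/-- Write `f` as the product of the `X - C a` over its simple real roots times a monic `h` without
real roots. As `h > 0`, the sign of `f'` at a root is that of the product of the differences to the
other roots. -/
theorem sum_sign_derivative {f : ℝ[X]} (hf : f.Monic) (hnd : f.roots.Nodup) :
    ∑ x ∈ f.roots.toFinset, (SignType.sign (f.derivative.eval x) : ℤ) =
      (f.roots.toFinset.card % 2 : ℕ) := by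
  classical
  rw [← sum_sign_prod_sub]
  refine Finset.sum_congr rfl fun x hx => ?_
  obtain ⟨h, hh, _, hroots⟩ := exists_prod_multiset_X_sub_C_mul f
  have hpm : (f.roots.map fun a => X - C a).prod.Monic := monic_multisetProd_X_sub_C _
  have hmon : h.Monic := hpm.of_mul_monic_left (by rw [hh]; exact hf)
  have hpos := eval_pos_of_no_roots hmon (fun y hy => by
    have : y ∈ h.roots := (mem_roots hmon.ne_zero).2 hy
    rw [hroots] at this
    simp at this)
  have hprod : (f.roots.map fun a => X - C a).prod = ∏ a ∈ f.roots.toFinset, (X - C a) := by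
    rw [Finset.prod, Multiset.toFinset_val, hnd.dedup]
  have hd : f.derivative.eval x = (∏ a ∈ f.roots.toFinset.erase x, (x - a)) * h.eval x := by
    rw [hprod, ← Finset.mul_prod_erase _ _ hx] at hh
    have h2 := congrArg (fun p => p.derivative.eval x) hh
    simp only [mul_assoc, derivative_mul, eval_add, eval_mul, derivative_X_sub_C,
      eval_prod, eval_sub, eval_X, eval_C, sub_self, zero_mul, add_zero, one_mul] at h2
    exact h2.symm
  rw [hd, sign_mul, sign_pos (hpos x), mul_one]

/-- The monic real quadratic with roots `z` and its conjugate. -/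
noncomputable def conjQuadratic (z : ℂ) : ℝ[X] := X ^ 2 - C (2 * z.re) * X + C (Complex.normSq z)

theorem map_conjQuadratic (z : ℂ) :
    (conjQuadratic z).map (algebraMap ℝ ℂ) = (X - C z) * (X - C (starRingEnd ℂ z)) := by
  have h1 : z + starRingEnd ℂ z = ((2 * z.re : ℝ) : ℂ) := Complex.add_conj z
  have h2 : z * starRingEnd ℂ z = (Complex.normSq z : ℂ) := Complex.mul_conj z
  simp only [conjQuadratic, Polynomial.map_add, Polynomial.map_sub, Polynomial.map_mul,
    Polynomial.map_pow, map_X, map_C, Complex.coe_algebraMap]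
  rw [← h1, ← h2, C_add, C_mul]
  ring

theorem conjQuadratic_eq (z : ℂ) :
    conjQuadratic z = X ^ 2 + C (-(2 * z.re)) * X + C (Complex.normSq z) := by
  rw [conjQuadratic, C_neg]; ring

theorem monic_conjQuadratic (z : ℂ) : (conjQuadratic z).Monic := by
  rw [conjQuadratic_eq, add_assoc]
  refine monic_X_pow_add ?_
  rw [degree_lt_iff_coeff_zero]
  intro k hk
  rw [coeff_add, coeff_C_mul, coeff_X, coeff_C]
  split_ifs <;> first | lia | simp

theorem natDegree_conjQuadratic (z : ℂ) : (conjQuadratic z).natDegree = 2 := by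
  rw [conjQuadratic_eq, ← one_mul (X ^ 2 : ℝ[X]), ← C_1]
  exact natDegree_quadratic one_ne_zero

theorem conjQuadratic_dvd {f : ℝ[X]} {z : ℂ} (hz : z.im ≠ 0)
    (h : (f.map (algebraMap ℝ ℂ)).IsRoot z) : conjQuadratic z ∣ f := by
  have := quadratic_dvd_of_aeval_eq_zero_im_ne_zero f
    (by rwa [IsRoot.def, eval_map_algebraMap] at h) hz
  rwa [Complex.sq_norm] at this

/-- Irreducible real polynomials have degree at most two, so these two degrees suffice for
squarefreeness, which is separability over a perfect field. -/
theorem separable_of_not_sq_dvd {f : ℝ[X]} (h1 : ∀ p : ℝ[X], p.Monic → p.natDegree = 1 → ¬ p * p ∣ f)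
    (h2 : ∀ p : ℝ[X], p.Monic → p.natDegree = 2 → ¬ p * p ∣ f) : f.Separable := by
  have hf0 : f ≠ 0 := by
    rintro rfl
    exact h1 X monic_X natDegree_X (dvd_zero _)
  rw [PerfectField.separable_iff_squarefree,
    squarefree_iff_irreducible_sq_not_dvd_of_ne_zero hf0]
  intro p hp hdvd
  have hm := monic_mul_leadingCoeff_inv hp.ne_zero
  have hdeg : (p * C p.leadingCoeff⁻¹).natDegree = p.natDegree :=
    natDegree_mul_leadingCoeff_inv p hp.ne_zero
  have hle := hp.degree_le_two
  have hpos := hp.natDegree_pos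
  have hle' : p.natDegree ≤ 2 := natDegree_le_of_degree_le hle
  have hu : IsUnit (C p.leadingCoeff⁻¹ : ℝ[X]) :=
    isUnit_C.2 (isUnit_iff_ne_zero.2 (inv_ne_zero (leadingCoeff_ne_zero.2 hp.ne_zero)))
  have hd : p * C p.leadingCoeff⁻¹ * (p * C p.leadingCoeff⁻¹) ∣ f := by
    rw [mul_mul_mul_comm]
    exact ((hu.mul hu).mul_right_dvd).2 hdvd
  rcases (show p.natDegree = 1 ∨ p.natDegree = 2 by lia) with h | h
  · exact h1 _ hm (by rw [hdeg, h]) hd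
  · exact h2 _ hm (by rw [hdeg, h]) hd

/-- The number of complex roots of a separable real polynomial, split into real roots and
conjugate pairs. -/
theorem natDegree_eq_card_real_add_two_mul {f : ℝ[X]} (hsep : f.Separable) (hf0 : f ≠ 0) :
    f.natDegree = f.roots.toFinset.card +
      2 * ((f.map (algebraMap ℝ ℂ)).roots.toFinset.filter fun z => 0 < z.im).card := by
  classical
  set F := f.map (algebraMap ℝ ℂ) with hF
  have hF0 : F ≠ 0 := (Polynomial.map_ne_zero_iff (algebraMap ℝ ℂ).injective).2 hf0
  have hnd : F.roots.Nodup := nodup_roots hsep.map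
  have hcard : F.roots.toFinset.card = f.natDegree := by
    rw [Multiset.toFinset_card_of_nodup hnd, ← (IsAlgClosed.splits F).natDegree_eq_card_roots, hF,
      natDegree_map]
  have hmem : ∀ z, z ∈ F.roots.toFinset ↔ aeval z f = 0 := by
    intro z
    rw [Multiset.mem_toFinset, mem_roots hF0, IsRoot.def, hF, eval_map_algebraMap]
  have hconj : ∀ z, aeval (starRingEnd ℂ z) f = starRingEnd ℂ (aeval z f) := fun z =>
    aeval_conj f z
  have hsplit : F.roots.toFinset.card = (F.roots.toFinset.filter fun z => z.im = 0).card +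
      ((F.roots.toFinset.filter fun z => 0 < z.im).card +
        (F.roots.toFinset.filter fun z => z.im < 0).card) := by
    rw [← Finset.card_filter_add_card_filter_not (s := F.roots.toFinset) (fun z => z.im = 0)]
    congr 1
    rw [← Finset.card_filter_add_card_filter_not
      (s := F.roots.toFinset.filter fun z => ¬ z.im = 0) (fun z => 0 < z.im),
      Finset.filter_filter, Finset.filter_filter]
    congr 2
    · exact Finset.filter_congr fun z _ => ⟨fun h => h.2, fun h => ⟨h.ne', h⟩⟩
    · exact Finset.filter_congr fun z _ => ⟨fun h => lt_of_le_of_ne (not_lt.1 h.2) h.1,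
        fun h => ⟨h.ne, h.not_gt⟩⟩
  have hreal : (F.roots.toFinset.filter fun z => z.im = 0).card = f.roots.toFinset.card := by
    symm
    refine Finset.card_bij (fun (a : ℝ) _ => (a : ℂ)) ?_ ?_ ?_
    · intro a ha
      rw [Multiset.mem_toFinset, mem_roots hf0, IsRoot.def] at ha
      rw [Finset.mem_filter, hmem]
      refine ⟨?_, Complex.ofReal_im a⟩
      have := aeval_algebraMap_apply ℂ a f
      rw [Complex.coe_algebraMap] at this
      rw [this, coe_aeval_eq_eval, ha, Complex.ofReal_zero]
    · intro a _ b _ h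
      exact_mod_cast h
    · intro z hz
      rw [Finset.mem_filter, hmem] at hz
      have hzr : ((z.re : ℝ) : ℂ) = z := by
        apply Complex.ext <;> simp [hz.2]
      refine ⟨z.re, ?_, hzr⟩
      rw [Multiset.mem_toFinset, mem_roots hf0, IsRoot.def]
      have := aeval_algebraMap_apply ℂ z.re f
      rw [Complex.coe_algebraMap, hzr, hz.1, coe_aeval_eq_eval] at this
      exact_mod_cast this.symm
  have hlow : (F.roots.toFinset.filter fun z => z.im < 0).card =
      (F.roots.toFinset.filter fun z => 0 < z.im).card := by
    refine Finset.card_bij (fun z _ => starRingEnd ℂ z) ?_ ?_ ?_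
    · intro z hz
      rw [Finset.mem_filter, hmem] at hz ⊢
      rw [hconj, hz.1, map_zero]
      simpa using hz.2
    · intro a _ b _ h
      exact (starRingEnd ℂ).injective h
    · intro z hz
      rw [Finset.mem_filter, hmem] at hz
      refine ⟨starRingEnd ℂ z, ?_, by simp⟩
      rw [Finset.mem_filter, hmem, hconj, hz.1, map_zero]
      simpa using hz.2
  rw [← hcard, hsplit, hreal, hlow]
  ring

/-- The monic quadratic divisors of a separable monic real polynomial. -/
theorem mem_quadratic_divisors {f : ℝ[X]} (hsep : f.Separable) (hf0 : f ≠ 0) (q : ℝ[X]) :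
    q ∈ (((f.map (algebraMap ℝ ℂ)).roots.toFinset.filter fun z => 0 < z.im).image conjQuadratic ∪
      ((f.roots.toFinset ×ˢ f.roots.toFinset).filter fun p => p.1 < p.2).image
        fun p => (X - C p.1) * (X - C p.2)) ↔ q.Monic ∧ q.natDegree = 2 ∧ q ∣ f := by
  classical
  have hF0 : f.map (algebraMap ℝ ℂ) ≠ 0 :=
    (Polynomial.map_ne_zero_iff (algebraMap ℝ ℂ).injective).2 hf0
  rw [Finset.mem_union, Finset.mem_image, Finset.mem_image]
  constructor
  · rintro (⟨z, hz, rfl⟩ | ⟨⟨a, b⟩, hab, rfl⟩)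
    · rw [Finset.mem_filter, Multiset.mem_toFinset, mem_roots hF0] at hz
      exact ⟨monic_conjQuadratic z, natDegree_conjQuadratic z, conjQuadratic_dvd hz.2.ne' hz.1⟩
    · simp only [Finset.mem_filter, Finset.mem_product, Multiset.mem_toFinset,
        mem_roots hf0] at hab
      refine ⟨(monic_X_sub_C a).mul (monic_X_sub_C b), ?_, ?_⟩
      · rw [(monic_X_sub_C a).natDegree_mul (monic_X_sub_C b), natDegree_X_sub_C,
          natDegree_X_sub_C]
      · exact (isCoprime_X_sub_C_of_isUnit_sub (isUnit_iff_ne_zero.2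
          (sub_ne_zero.2 hab.2.ne))).mul_dvd (dvd_iff_isRoot.2 hab.1.1) (dvd_iff_isRoot.2 hab.1.2)
  · rintro ⟨hm, hd, hdvd⟩
    have hq0 : q.map (algebraMap ℝ ℂ) ≠ 0 :=
      (Polynomial.map_ne_zero_iff (algebraMap ℝ ℂ).injective).2 hm.ne_zero
    obtain ⟨z, hz⟩ := IsAlgClosed.exists_root (q.map (algebraMap ℝ ℂ)) (by
      rw [degree_map, degree_eq_natDegree hm.ne_zero, hd]; norm_num)
    -- A real root splits `q` into two linear factors, distinct because `f` is squarefree; a nonreal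
    -- root in the upper half plane, after conjugation if needed, determines `q`.
    by_cases him : z.im = 0
    · right
      have hzr : ((z.re : ℝ) : ℂ) = z := by apply Complex.ext <;> simp [him]
      have hroot : q.IsRoot z.re := by
        rw [← hzr, IsRoot.def, eval_map_algebraMap] at hz
        have := aeval_algebraMap_apply ℂ z.re q
        rw [Complex.coe_algebraMap, hz, coe_aeval_eq_eval] at this
        rw [IsRoot.def]
        exact_mod_cast this.symm
      obtain ⟨r, hr⟩ := dvd_iff_isRoot.2 hroot
      have hrm : r.Monic := (monic_X_sub_C z.re).of_mul_monic_left (hr ▸ hm)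
      have hrd : r.natDegree = 1 := by
        have := congrArg natDegree hr
        rw [(monic_X_sub_C z.re).natDegree_mul hrm, natDegree_X_sub_C, hd] at this
        lia
      have hrX : r = X - C (-r.coeff 0) := by
        rw [map_neg, sub_neg_eq_add]
        exact hrm.eq_X_add_C hrd
      set b := -r.coeff 0 with hb
      have hne : z.re ≠ b := by
        intro h
        rw [hrX, ← h] at hr
        have h3 := (hsep.squarefree (X - C z.re) (hr ▸ hdvd))
        exact not_isUnit_X_sub_C _ h3
      have ha : z.re ∈ f.roots.toFinset := by
        rw [Multiset.mem_toFinset, mem_roots hf0]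
        exact hroot.dvd hdvd
      have hb' : b ∈ f.roots.toFinset := by
        rw [Multiset.mem_toFinset, mem_roots hf0, ← dvd_iff_isRoot, ← hrX]
        exact (hr ▸ dvd_mul_left r _ : r ∣ q).trans hdvd
      rcases lt_or_gt_of_ne hne with h | h
      · exact ⟨(z.re, b), by
            simp only [Finset.mem_filter, Finset.mem_product]
            exact ⟨⟨ha, hb'⟩, h⟩, by simp only; rw [← hrX, hr]⟩
      · exact ⟨(b, z.re), by
            simp only [Finset.mem_filter, Finset.mem_product]
            exact ⟨⟨hb', ha⟩, h⟩, by simp only; rw [← hrX, hr, mul_comm]⟩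
    · left
      have key : ∀ w : ℂ, 0 < w.im → (q.map (algebraMap ℝ ℂ)).IsRoot w →
          ∃ a ∈ (f.map (algebraMap ℝ ℂ)).roots.toFinset.filter fun z => 0 < z.im,
            conjQuadratic a = q := by
        intro w hw hroot
        refine ⟨w, ?_, ?_⟩
        · rw [Finset.mem_filter, Multiset.mem_toFinset, mem_roots hF0]
          exact ⟨hroot.dvd (Polynomial.map_dvd _ hdvd), hw⟩
        · exact (eq_of_monic_of_dvd_of_natDegree_le (monic_conjQuadratic w) hm
            (conjQuadratic_dvd hw.ne' hroot) (by rw [hd, natDegree_conjQuadratic])).symm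
      rcases lt_or_gt_of_ne him with h | h
      · refine key (starRingEnd ℂ z) (by simpa using h) ?_
        rw [IsRoot.def, eval_map_algebraMap] at hz ⊢
        rw [aeval_conj, hz, map_zero]
      · exact key z h hz

theorem injective_X_sub_C_mul_X_sub_C {a b c d : ℝ} (hab : a < b) (hcd : c < d)
    (h : (X - C a) * (X - C b) = (X - C c) * (X - C d)) : a = c ∧ b = d := by
  have h0 := congrArg (fun p => p.eval 0) h
  have h1 := congrArg (fun p => p.eval 1) h
  simp only [eval_mul, eval_sub, eval_X, eval_C] at h0 h1
  have h2 : a + b = c + d := by linarith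
  have h3 : (a - c) * (a - d) = 0 := by
    have : b = c + d - a := by linarith
    subst this
    linarith
  rcases mul_eq_zero.1 h3 with h4 | h4
  · constructor <;> linarith
  · exfalso; linarith

theorem injOn_conjQuadratic : Set.InjOn conjQuadratic {z : ℂ | 0 < z.im} := by
  intro z hz w hw h
  have h0 := congrArg (fun p => p.coeff 0) h
  have h1 := congrArg (fun p => p.coeff 1) h
  simp [conjQuadratic, coeff_X, Complex.normSq_apply] at h0 h1
  simp only [Set.mem_ofPred_eq] at hz hw
  refine Complex.ext h1 ?_
  rw [h1] at h0
  nlinarith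

/-- The signed number of monic quadratic divisors of a separable monic real polynomial of degree
`m + 2`. -/
theorem sum_sign_resultant_quadratic {f : ℝ[X]} (hsep : f.Separable) (hm : f.Monic) {m : ℕ}
    (hd : f.natDegree = m + 2) {D : Finset ℝ[X]}
    (hD : ∀ q, q ∈ D ↔ q.Monic ∧ q.natDegree = 2 ∧ q ∣ f) :
    ∑ q ∈ D, (SignType.sign (resultant (f /ₘ q) q m 2) : ℤ) = (((m + 2) / 2 : ℕ) : ℤ) := by
  classical
  have hf0 := hm.ne_zero
  set U := (f.map (algebraMap ℝ ℂ)).roots.toFinset.filter fun z => 0 < z.im with hU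
  set A := f.roots.toFinset with hA
  have hnd : f.roots.Nodup := nodup_roots hsep
  set P := (A ×ˢ A).filter fun p => p.1 < p.2 with hP
  have hDU : D = U.image conjQuadratic ∪ P.image fun p => (X - C p.1) * (X - C p.2) := by
    ext q
    rw [hD, ← mem_quadratic_divisors hsep hf0]
  have hF0 : f.map (algebraMap ℝ ℂ) ≠ 0 :=
    (Polynomial.map_ne_zero_iff (algebraMap ℝ ℂ).injective).2 hf0
  have hUim : ∀ z ∈ U, 0 < z.im := fun z hz => (Finset.mem_filter.1 hz).2
  have hcof : ∀ q ∈ D, (f /ₘ q).natDegree ≤ m := by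
    intro q hq
    obtain ⟨h1, h2, h3⟩ := (hD q).1 hq
    rw [natDegree_divByMonic _ h1, hd, h2]
    lia
  have hdisj : Disjoint (U.image conjQuadratic) (P.image fun p => (X - C p.1) * (X - C p.2)) := by
    rw [Finset.disjoint_left]
    intro q hq hq'
    obtain ⟨z, hz, rfl⟩ := Finset.mem_image.1 hq
    obtain ⟨⟨a, b⟩, hab, h⟩ := Finset.mem_image.1 hq'
    have h1 := congrArg (fun p => (p.map (algebraMap ℝ ℂ)).eval (a : ℂ)) h
    simp only [map_conjQuadratic, Polynomial.map_mul, Polynomial.map_sub, map_X, map_C, eval_mul,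
      eval_sub, eval_X, eval_C, Complex.coe_algebraMap, sub_self, zero_mul] at h1
    have h2 := hUim z hz
    rcases mul_eq_zero.1 h1.symm with h3 | h3
    · have := congrArg Complex.im h3
      simp at this
      linarith
    · have := congrArg Complex.im h3
      simp at this
      linarith
  have hirr : ∀ a ∈ A, f.derivative.eval a ≠ 0 := by
    intro a ha h
    rw [hA, Multiset.mem_toFinset, mem_roots hf0] at ha
    obtain ⟨u, v, huv⟩ := hsep
    have := congrArg (fun p => p.eval a) huv
    simp only [eval_add, eval_mul, h, ha.eq_zero, mul_zero, add_zero, eval_one] at this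
    exact zero_ne_one this
  rw [hDU, Finset.sum_union hdisj, Finset.sum_image fun z hz w hw h =>
    injOn_conjQuadratic (hUim z hz) (hUim w hw) h, Finset.sum_image]
  swap
  · rintro ⟨a, b⟩ h1 ⟨c, d⟩ h2 h
    obtain ⟨h3, h4⟩ := injective_X_sub_C_mul_X_sub_C (Finset.mem_filter.1 h1).2
      (Finset.mem_filter.1 h2).2 h
    simp only at h3 h4
    rw [h3, h4]
  -- A conjugate pair counts `+1`: the resultant is `g(z)` times its conjugate, and `g(z) ≠ 0` since
  -- `f` is squarefree.
  have hsU : ∑ z ∈ U, (SignType.sign (resultant (f /ₘ conjQuadratic z) (conjQuadratic z) m 2) : ℤ)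
      = U.card := by
    rw [Finset.sum_congr rfl (g := fun _ => (1 : ℤ))]
    · simp
    intro z hz
    have hqD : conjQuadratic z ∈ D := by
      rw [hDU]; exact Finset.mem_union_left _ (Finset.mem_image_of_mem _ hz)
    obtain ⟨h1, h2, h3⟩ := (hD _).1 hqD
    have hmul := mul_divByMonic_eq h1 h3
    set g := f /ₘ conjQuadratic z with hg
    have hr : ((resultant g (conjQuadratic z) m 2 : ℝ) : ℂ) =
        Complex.normSq ((g.map (algebraMap ℝ ℂ)).eval z) := by
      rw [← Complex.coe_algebraMap, ← resultant_map_map, map_conjQuadratic,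
        resultant_quadratic_right _ _ _ _ (natDegree_map_le.trans (hcof _ hqD)),
        eval_map_algebraMap, eval_map_algebraMap, aeval_conj, Complex.mul_conj]
      rfl
    have hne : (g.map (algebraMap ℝ ℂ)).eval z ≠ 0 := by
      intro h0
      have h4 : conjQuadratic z ∣ g := conjQuadratic_dvd (hUim z hz).ne' h0
      have h5 := hsep.squarefree (conjQuadratic z) (by
        rw [← hmul]
        exact mul_dvd_mul_right h4 _)
      rw [h1.isUnit_iff] at h5
      rw [h5] at h2
      simp at h2
    have hr' : resultant g (conjQuadratic z) m 2 =
        Complex.normSq ((g.map (algebraMap ℝ ℂ)).eval z) := by exact_mod_cast hr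
    rw [hr', sign_pos (Complex.normSq_pos.2 hne)]
    rfl
  -- For real roots `a < b` the resultant is `g(a) g(b)`, while `f'(a) = g(a) (a - b)` and `f'(b) =
  -- g(b) (b - a)`; the opposite signs of the differences produce the minus sign.
  have hsP : ∑ p ∈ P, (SignType.sign (resultant (f /ₘ ((X - C p.1) * (X - C p.2)))
      ((X - C p.1) * (X - C p.2)) m 2) : ℤ) =
      -∑ p ∈ P, (SignType.sign (f.derivative.eval p.1) : ℤ) *
        (SignType.sign (f.derivative.eval p.2) : ℤ) := by
    rw [← Finset.sum_neg_distrib]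
    refine Finset.sum_congr rfl fun p hp => ?_
    have hqD : (X - C p.1) * (X - C p.2) ∈ D := by
      rw [hDU]
      exact Finset.mem_union_right _
        (Finset.mem_image_of_mem (fun p : ℝ × ℝ => (X - C p.1) * (X - C p.2)) hp)
    obtain ⟨h1, h2, h3⟩ := (hD _).1 hqD
    have hlt : p.1 < p.2 := (Finset.mem_filter.1 hp).2
    have hmul := mul_divByMonic_eq h1 h3
    have hcof' := hcof _ hqD
    set g := f /ₘ ((X - C p.1) * (X - C p.2)) with hg
    rw [resultant_quadratic_right _ _ _ _ hcof']
    have e1 : f.derivative.eval p.1 = g.eval p.1 * (p.1 - p.2) := by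
      rw [← hmul]
      simp [derivative_mul]
    have e2 : f.derivative.eval p.2 = g.eval p.2 * (p.2 - p.1) := by
      rw [← hmul]
      simp [derivative_mul]
    rw [e1, e2, sign_mul, sign_mul, sign_mul, sign_neg (sub_neg.2 hlt), sign_pos (sub_pos.2 hlt)]
    simp
  rw [hsU, hsP]
  -- With `r` real roots the signs of `f'` add up to `r % 2` and their squares to `r`, so the real
  -- pairs contribute `(r - r % 2) / 2 = ⌊r / 2⌋`. Together with the conjugate pairs this is half
  -- the degree, rounded down.
  have h2 := two_mul_sum_lt_mul (A := A) fun x => (SignType.sign (f.derivative.eval x) : ℤ)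
  rw [sum_sign_derivative hm hnd] at h2
  have h3 : ∑ x ∈ A, (SignType.sign (f.derivative.eval x) : ℤ) ^ 2 = A.card := by
    rw [Finset.sum_congr rfl (g := fun _ => (1 : ℤ))]
    · simp
    intro x hx
    rcases lt_or_gt_of_ne (hirr x hx) with h | h
    · simp [sign_neg h]
    · simp [sign_pos h]
  rw [h3] at h2
  have h4 := natDegree_eq_card_real_add_two_mul hsep hf0
  rw [hd] at h4
  have h5 : ((A.card % 2 : ℕ) : ℤ) ^ 2 = ((A.card % 2 : ℕ) : ℤ) := by
    rcases Nat.mod_two_eq_zero_or_one A.card with h | h <;> simp [h]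
  rw [h5] at h2
  lia

/-- The degree of the multiplication map for real quadratic factors. -/
theorem ae_fiber_quadratic_real (m : ℕ) : ∀ᵐ y : Fin (m + 2) → ℝ,
    ∃ T : Finset (Fin (m + 2) → ℝ), (T : Set (Fin (m + 2) → ℝ)) = mulCoeffs m 2 ⁻¹' {y} ∧
      T.card ≤ (m + 2) + (m + 2) * (m + 2) ∧
      ∑ x ∈ T, (SignType.sign ((mulCoeffsDeriv m 2 x).restrictScalars ℝ).det : ℤ) =
        (((m + 2) / 2 : ℕ) : ℤ) := by
  classical
  have hae1 := ae_not_sq_dvd volume (m := m + 1) (n := 1) (K := ℝ) one_ne_zero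
  have hae2 := ae_not_sq_dvd volume (m := m) (n := 2) (K := ℝ) two_ne_zero
  filter_upwards [hae1, hae2] with y hy1 hy2
  have hsep := separable_of_not_sq_dvd hy1 hy2
  have hf0 : monPoly y ≠ 0 := (monic_monPoly y).ne_zero
  obtain ⟨D, hDeq⟩ : ∃ D, D = _ := ⟨_, rfl⟩
  have hD : ∀ q, q ∈ D ↔ q.Monic ∧ q.natDegree = 2 ∧ q ∣ monPoly y := fun q => by
    rw [← mem_quadratic_divisors hsep hf0 q, hDeq]
  have hA : (monPoly y).roots.toFinset.card ≤ m + 2 :=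
    (Multiset.toFinset_card_le _).trans ((card_roots' _).trans_eq (natDegree_monPoly y))
  have hDcard : D.card ≤ (m + 2) + (m + 2) * (m + 2) := by
    rw [hDeq]
    refine (Finset.card_union_le _ _).trans (add_le_add ?_ ?_)
    · refine Finset.card_image_le.trans ((Finset.card_filter_le _ _).trans
        ((Multiset.toFinset_card_le _).trans ((card_roots' _).trans_eq ?_)))
      rw [natDegree_map, natDegree_monPoly]
    · refine Finset.card_image_le.trans ((Finset.card_filter_le _ _).trans ?_)
      rw [Finset.card_product]
      exact Nat.mul_le_mul hA hA
  refine ⟨D.image (splitCoeffs m 2 y), fiber_mulCoeffs hD, Finset.card_image_le.trans hDcard, ?_⟩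
  simp only [det_restrictScalars_mulCoeffsDeriv]
  rw [sum_fiber_mulCoeffs hD fun f g =>
    (SignType.sign (Algebra.norm ℝ (resultant f g m 2)) : ℤ)]
  simp only [Algebra.norm_self, MonoidHom.id_apply]
  exact sum_sign_resultant_quadratic hsep (monic_monPoly y) (natDegree_monPoly y) hD

end RealFibers

/-! ### Growth of Mahler's measure and the averages with auxiliary points -/

section MahlerIntegrals

open Polynomial

variable {n : ℕ}

theorem one_le_mahlerMeasure_monPoly (a : Fin n → ℂ) : 1 ≤ (monPoly a).mahlerMeasure := by
  have := leadingCoeff_le_mahlerMeasure (monPoly a)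
  rwa [(monic_monPoly a).leadingCoeff, norm_one] at this

theorem mahlerMeasure_monPoly_pos (a : Fin n → ℂ) : 0 < (monPoly a).mahlerMeasure :=
  one_pos.trans_le (one_le_mahlerMeasure_monPoly a)

theorem eval_monPoly {R : Type*} [CommRing R] (a : Fin n → R) (t : R) :
    (monPoly a).eval t = t ^ n + ∑ i, a i * t ^ (i : ℕ) := by
  simp [monPoly, lowPoly, eval_finsetSum]

/-- Mahler's measure is the exponential of the mean of `log |f|` over the unit circle, a parameter
integral of a jointly measurable function. -/
theorem measurable_mahlerMeasure_monPoly :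
    Measurable fun a : Fin n → ℂ => (monPoly a).mahlerMeasure := by
  have h : (fun a : Fin n → ℂ => (monPoly a).mahlerMeasure) = fun a => Real.exp
      ((2 * Real.pi)⁻¹ * ∫ x in Set.Ioc 0 (2 * Real.pi),
        Real.log ‖(monPoly a).eval (circleMap 0 1 x)‖) := by
    funext a
    rw [mahlerMeasure_def_of_ne_zero (monic_monPoly a).ne_zero,
      intervalIntegral.integral_of_le (by positivity)]
  rw [h]
  have hm : Measurable (Function.uncurry fun (a : Fin n → ℂ) (x : ℝ) =>
      Real.log ‖(monPoly a).eval (circleMap 0 1 x)‖) := by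
    have : Continuous (fun p : (Fin n → ℂ) × ℝ => (monPoly p.1).eval (circleMap 0 1 p.2)) := by
      simp only [eval_monPoly]
      have := continuous_circleMap 0 1
      fun_prop
    exact Real.measurable_log.comp this.norm.measurable
  exact Real.measurable_exp.comp
    ((hm.stronglyMeasurable.integral_prod_right (ν := volume.restrict _)).measurable.const_mul _)

/-- Each coefficient is at most a binomial coefficient times Mahler's measure. This linear lower
bound in the coefficient vector is the source of all convergence below. -/
theorem one_add_norm_le_mahlerMeasure (a : Fin n → ℂ) :
    1 + ‖a‖ ≤ (1 + 2 ^ n) * (monPoly a).mahlerMeasure := by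
  have h1 := one_le_mahlerMeasure_monPoly a
  have h2 : ‖a‖ ≤ 2 ^ n * (monPoly a).mahlerMeasure := by
    rw [pi_norm_le_iff_of_nonneg (by positivity)]
    intro i
    have h3 := norm_coeff_le_choose_mul_mahlerMeasure (i : ℕ) (monPoly a)
    rw [natDegree_monPoly, coeff_monPoly, dif_pos i.2] at h3
    refine h3.trans (mul_le_mul_of_nonneg_right ?_ (by linarith))
    exact_mod_cast Nat.choose_le_two_pow n i
  linarith

theorem norm_eval_monPoly_le (a : Fin n → ℂ) (t : ℂ) :
    ‖(monPoly a).eval t‖ ≤ (1 + ‖t‖) ^ n * (monPoly a).mahlerMeasure := by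
  rw [eval_eq_sum_range, natDegree_monPoly]
  refine (norm_sum_le _ _).trans ?_
  rw [add_comm (1 : ℝ), add_pow, Finset.sum_mul]
  refine Finset.sum_le_sum fun i _ => ?_
  have h3 := norm_coeff_le_choose_mul_mahlerMeasure i (monPoly a)
  rw [natDegree_monPoly] at h3
  rw [norm_mul, norm_pow, one_pow, mul_one]
  calc _ ≤ (n.choose i * (monPoly a).mahlerMeasure) * ‖t‖ ^ i := by gcongr
    _ = _ := by ring

theorem norm_prod_eval_monPoly_le {m : ℕ} (a : Fin n → ℂ) (t : Fin m → ℂ) :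
    ‖∏ i, (monPoly a).eval (t i)‖ ≤
      (∏ i, (1 + ‖t i‖) ^ n) * (monPoly a).mahlerMeasure ^ m := by
  rw [norm_prod]
  calc _ ≤ ∏ i, ((1 + ‖t i‖) ^ n * (monPoly a).mahlerMeasure) :=
        Finset.prod_le_prod (fun _ _ => norm_nonneg _) fun i _ => norm_eval_monPoly_le a (t i)
    _ = _ := by simp [Finset.prod_mul_distrib]

/-- Integrability of a complex power of Mahler's measure against a function of moderate growth. -/
theorem integrable_mahlerMeasure_cpow_mul {E : Type*} [NormedAddCommGroup E] [NormedSpace ℝ E]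
    [FiniteDimensional ℝ E] [MeasurableSpace E] [BorelSpace E] (μ : Measure E)
    [μ.IsAddHaarMeasure] {c : E → Fin n → ℂ} (hc : Continuous c) (hcn : ∀ a, ‖c a‖ = ‖a‖)
    {w : ℂ} {F : E → ℂ} (hF : Continuous F) {B : ℝ} {k : ℕ}
    (hFB : ∀ a, ‖F a‖ ≤ B * (monPoly (c a)).mahlerMeasure ^ k)
    (hw : (Module.finrank ℝ E : ℝ) < w.re - k) :
    Integrable (fun a => ((monPoly (c a)).mahlerMeasure : ℂ) ^ (-w) * F a) μ := by
  have hint := (integrable_one_add_norm (μ := μ) hw).const_mul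
    (|B| * (1 + 2 ^ n : ℝ) ^ (w.re - k))
  refine hint.mono' ?_ (Filter.Eventually.of_forall fun a => ?_)
  · refine Measurable.aestronglyMeasurable ?_
    have := (measurable_mahlerMeasure_monPoly (n := n)).comp hc.measurable
    exact ((Complex.measurable_ofReal.comp this).pow_const _).mul hF.measurable
  · set M := (monPoly (c a)).mahlerMeasure with hM
    have hM1 : 1 ≤ M := one_le_mahlerMeasure_monPoly _
    have hMpos : 0 < M := mahlerMeasure_monPoly_pos _
    have hpos : (0 : ℝ) < w.re - k := lt_of_le_of_lt (Nat.cast_nonneg _) hw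
    rw [norm_mul, Complex.norm_cpow_eq_rpow_re_of_pos hMpos, Complex.neg_re]
    have h1 : (1 + ‖a‖) / (1 + 2 ^ n) ≤ M := by
      rw [div_le_iff₀ (by positivity), ← hcn, mul_comm]
      exact one_add_norm_le_mahlerMeasure _
    have h2 : M ^ (-(w.re - k)) ≤ ((1 + ‖a‖) / (1 + 2 ^ n)) ^ (-(w.re - k)) :=
      Real.rpow_le_rpow_of_nonpos (by positivity) h1 (by linarith)
    calc M ^ (-w.re) * ‖F a‖ ≤ M ^ (-w.re) * (|B| * M ^ k) := by
          refine mul_le_mul_of_nonneg_left ?_ (Real.rpow_nonneg hMpos.le _)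
          exact (hFB a).trans (mul_le_mul_of_nonneg_right (le_abs_self B) (by positivity))
      _ = |B| * M ^ (-(w.re - k)) := by
          rw [neg_sub, sub_eq_neg_add, Real.rpow_add hMpos, Real.rpow_natCast]; ring
      _ ≤ |B| * ((1 + ‖a‖) / (1 + 2 ^ n)) ^ (-(w.re - k)) := by gcongr
      _ = _ := by
          rw [Real.div_rpow (by positivity) (by positivity),
            Real.rpow_neg (by positivity : (0 : ℝ) ≤ 1 + 2 ^ n), div_inv_eq_mul]
          ring

/-- A vector of length `m + n` as a pair of vectors of lengths `m` and `n`. -/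
def splitVec (K : Type*) [MeasurableSpace K] (m n : ℕ) :
    (Fin (m + n) → K) ≃ᵐ (Fin m → K) × (Fin n → K) :=
  (MeasurableEquiv.piCongrLeft (fun _ => K) finSumFinEquiv).symm.trans
    (MeasurableEquiv.sumPiEquivProdPi fun _ => K)

theorem splitVec_apply {K : Type*} [MeasurableSpace K] (m n : ℕ) (x : Fin (m + n) → K) :
    splitVec K m n x = (fun j => x (Fin.castAdd n j), fun j => x (Fin.natAdd m j)) := by
  rfl

theorem volume_preserving_splitVec (K : Type*) [MeasureSpace K]
    [SigmaFinite (volume : Measure K)] (m n : ℕ) :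
    MeasurePreserving (splitVec K m n) volume volume :=
  (volume_measurePreserving_sumPiEquivProdPi _).comp
    ((volume_measurePreserving_piCongrLeft (fun _ => K) finSumFinEquiv).symm _)

/-- The integral over real monic polynomials `f` of degree `n` of `μ(f)⁻ˢ ∏ f(tᵢ)`. -/
noncomputable def realAverage (s : ℂ) (n : ℕ) {m : ℕ} (t : Fin m → ℂ) : ℂ :=
  ∫ a : Fin n → ℝ, ((monPoly fun i => (a i : ℂ)).mahlerMeasure : ℂ) ^ (-s) *
    ∏ i, (monPoly fun i => (a i : ℂ)).eval (t i)

/-- The integral over complex monic polynomials `f` of degree `n` of `μ(f)⁻²ˢ ∏ |f(tᵢ)|²`. -/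
noncomputable def complexAverage (s : ℂ) (n : ℕ) {m : ℕ} (t : Fin m → ℂ) : ℂ :=
  ∫ a : Fin n → ℂ, ((monPoly a).mahlerMeasure : ℂ) ^ (-(2 * s)) *
    ∏ i, (‖(monPoly a).eval (t i)‖ ^ 2 : ℂ)

theorem norm_ofReal_vec (a : Fin n → ℝ) : ‖(fun i => (a i : ℂ) : Fin n → ℂ)‖ = ‖a‖ := by
  refine le_antisymm ((pi_norm_le_iff_of_nonneg (norm_nonneg a)).2 fun i => ?_)
    ((pi_norm_le_iff_of_nonneg (norm_nonneg _)).2 fun i => ?_)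
  · rw [Complex.norm_real]
    exact norm_le_pi_norm a i
  · rw [← Complex.norm_real]
    exact norm_le_pi_norm (fun i => (a i : ℂ) : Fin n → ℂ) i

theorem continuous_eval_monPoly {E : Type*} [TopologicalSpace E] {c : E → Fin n → ℂ}
    (hc : Continuous c) (t : ℂ) : Continuous fun a => (monPoly (c a)).eval t := by
  simp only [eval_monPoly]
  fun_prop

theorem integrable_realAverage {s : ℂ} {m : ℕ} (t : Fin m → ℂ) (hs : ((n + m : ℕ) : ℝ) < s.re) :
    Integrable fun a : Fin n → ℝ => ((monPoly fun i => (a i : ℂ)).mahlerMeasure : ℂ) ^ (-s) *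
      ∏ i, (monPoly fun i => (a i : ℂ)).eval (t i) := by
  have hc : Continuous fun (a : Fin n → ℝ) (i : Fin n) => (a i : ℂ) := by fun_prop
  have hF : Continuous fun a : Fin n → ℝ => ∏ i, (monPoly fun i => (a i : ℂ)).eval (t i) :=
    continuous_finsetProd _ fun i _ => continuous_eval_monPoly hc (t i)
  have hB : ∀ a : Fin n → ℝ, ‖∏ i, (monPoly fun i => (a i : ℂ)).eval (t i)‖ ≤
      (∏ i, (1 + ‖t i‖) ^ n) * (monPoly fun i => (a i : ℂ)).mahlerMeasure ^ m :=
    fun a => norm_prod_eval_monPoly_le _ t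
  have hw : (Module.finrank ℝ (Fin n → ℝ) : ℝ) < s.re - m := by
    push_cast at hs
    rw [Module.finrank_fin_fun]
    linarith
  exact integrable_mahlerMeasure_cpow_mul volume hc norm_ofReal_vec hF hB hw

theorem integrable_complexAverage {s : ℂ} {m : ℕ} (t : Fin m → ℂ)
    (hs : ((n + m : ℕ) : ℝ) < s.re) :
    Integrable fun a : Fin n → ℂ => ((monPoly a).mahlerMeasure : ℂ) ^ (-(2 * s)) *
      ∏ i, (‖(monPoly a).eval (t i)‖ ^ 2 : ℂ) := by
  -- Exponent, growth and real dimension all double: `2n < 2 Re s - 2m` is again `n + m < Re s`.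
  refine integrable_mahlerMeasure_cpow_mul volume (c := fun a => a) (k := 2 * m) continuous_id
    (fun a => rfl) (B := (∏ i, (1 + ‖t i‖) ^ n) ^ 2) ?_ (fun a => ?_) ?_
  · refine continuous_finsetProd _ fun i _ => ?_
    have := continuous_eval_monPoly (n := n) continuous_id (t i)
    exact (Complex.continuous_ofReal.comp this.norm).pow 2
  · have := norm_prod_eval_monPoly_le a t
    have h2 : ‖∏ i, (‖(monPoly a).eval (t i)‖ ^ 2 : ℂ)‖ = ‖∏ i, (monPoly a).eval (t i)‖ ^ 2 := by
      simp [norm_prod, Finset.prod_pow]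
    rw [h2, mul_comm 2 m, pow_mul, ← mul_pow]
    gcongr
  · push_cast at hs
    rw [Module.finrank_pi_fintype]
    simp
    linarith

end MahlerIntegrals

/-! ### Recursions that split off one factor -/

section PeelingFactors

open Polynomial

theorem map_ofReal_monPoly {n : ℕ} (a : Fin n → ℝ) :
    (monPoly a).map Complex.ofRealHom = monPoly fun i => (a i : ℂ) :=
  map_monPoly _ a

theorem monPoly_ofReal_mulCoeffs {m n : ℕ} (x : Fin (m + n) → ℝ) :
    (monPoly fun i => ((mulCoeffs m n x i : ℝ) : ℂ)) =
      (monPoly fun j => (x (Fin.castAdd n j) : ℂ)) * monPoly fun j => (x (Fin.natAdd m j) : ℂ) := by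
  rw [← map_ofReal_monPoly, monPoly_mulCoeffs, Polynomial.map_mul, map_ofReal_monPoly,
    map_ofReal_monPoly]

theorem mahlerMeasure_mul_cpow (p q : ℂ[X]) (w : ℂ) :
    (((p * q).mahlerMeasure : ℝ) : ℂ) ^ w =
      (p.mahlerMeasure : ℂ) ^ w * (q.mahlerMeasure : ℂ) ^ w := by
  rw [mahlerMeasure_mul, Complex.ofReal_mul,
    Complex.mul_cpow_ofReal_nonneg (mahlerMeasure_nonneg p) (mahlerMeasure_nonneg q)]

/-- Splitting a monic real quadratic factor off a monic real polynomial. -/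
theorem realAverage_add_two {s : ℂ} {n m : ℕ} (t : Fin m → ℂ)
    (hs : ((n + 2 + m : ℕ) : ℝ) < s.re) (α β : (Fin 2 → ℝ) → ℂ)
    (hαβ : ∀ q : Fin 2 → ℝ, (monPoly fun i => (q i : ℂ)) = (X - C (α q)) * (X - C (β q))) :
    (((n + 2) / 2 : ℕ) : ℂ) * realAverage s (n + 2) t =
      ∫ q : Fin 2 → ℝ, ((monPoly fun i => (q i : ℂ)).mahlerMeasure : ℂ) ^ (-s) *
        (∏ i, (monPoly fun i => (q i : ℂ)).eval (t i)) *
          realAverage s n (Fin.cons (α q) (Fin.cons (β q) t) : Fin (m + 2) → ℂ) := by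
  have hint := integrable_realAverage (n := n + 2) t hs
  have hdet : ∀ x : Fin (n + 2) → ℝ, ((mulCoeffsDeriv n 2 x).restrictScalars ℝ).det =
      resultant (monPoly fun j => x (Fin.castAdd 2 j)) (monPoly fun j => x (Fin.natAdd n j)) n 2 := by
    intro x
    rw [det_restrictScalars_mulCoeffsDeriv, Algebra.norm_self, MonoidHom.id_apply]
  have hcont : Continuous fun x : Fin (n + 2) → ℝ =>
      ((mulCoeffsDeriv n 2 x).restrictScalars ℝ).det := by
    simp_rw [hdet]
    exact continuous_resultant_monPoly
  obtain ⟨hI, hE⟩ := integral_det_fderiv_mul_comp volume hasFDerivAt_real_mulCoeffs hcont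
    ((n + 2) / 2) _ (ae_fiber_quadratic_real n) hint
  let G : (Fin n → ℝ) × (Fin 2 → ℝ) → ℂ := fun p =>
    ((monPoly fun i => (p.2 i : ℂ)).mahlerMeasure : ℂ) ^ (-s) *
      (∏ i, (monPoly fun i => (p.2 i : ℂ)).eval (t i)) *
    (((monPoly fun i => (p.1 i : ℂ)).mahlerMeasure : ℂ) ^ (-s) *
      ∏ i, (monPoly fun i => (p.1 i : ℂ)).eval
        ((Fin.cons (α p.2) (Fin.cons (β p.2) t) : Fin (m + 2) → ℂ) i))
  have hG : ∀ x : Fin (n + 2) → ℝ, (((mulCoeffsDeriv n 2 x).restrictScalars ℝ).det : ℂ) *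
      (((monPoly fun i => ((mulCoeffs n 2 x i : ℝ) : ℂ)).mahlerMeasure : ℂ) ^ (-s) *
        ∏ i, (monPoly fun i => ((mulCoeffs n 2 x i : ℝ) : ℂ)).eval (t i)) = G (splitVec ℝ n 2 x) := by
    intro x
    -- The Jacobian is the product of the values of the cofactor at the two roots of the quadratic,
    -- which thereby become two further evaluation points.
    have hres : (((mulCoeffsDeriv n 2 x).restrictScalars ℝ).det : ℂ) =
        (monPoly fun j => (x (Fin.castAdd 2 j) : ℂ)).eval (α fun j => x (Fin.natAdd n j)) *
        (monPoly fun j => (x (Fin.castAdd 2 j) : ℂ)).eval (β fun j => x (Fin.natAdd n j)) := by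
      rw [hdet, ← Complex.ofRealHom_eq_coe, ← resultant_map_map, map_ofReal_monPoly,
        map_ofReal_monPoly, hαβ fun j => x (Fin.natAdd n j),
        resultant_quadratic_right _ _ _ _ (natDegree_monPoly _).le]
    rw [hres, monPoly_ofReal_mulCoeffs, mahlerMeasure_mul_cpow, splitVec_apply]
    simp only [G, Fin.prod_univ_succ, Fin.cons_zero, Fin.cons_succ, eval_mul,
      Finset.prod_mul_distrib]
    ring
  simp_rw [hG] at hI hE
  have hmp := volume_preserving_splitVec ℝ n 2
  rw [hmp.integral_comp' (g := G)] at hE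
  -- Integrability is transported from the composed integrand, so the choice of the roots `α`, `β`
  -- need not be measurable.
  have hIG : Integrable G := (hmp.integrable_comp_emb (splitVec ℝ n 2).measurableEmbedding).1 hI
  rw [Measure.volume_eq_prod] at hIG hE
  rw [integral_prod_symm G hIG] at hE
  rw [realAverage]
  rw [← hE]
  refine integral_congr_ae (Filter.Eventually.of_forall fun q => ?_)
  simp only [G, realAverage]
  rw [integral_const_mul]

/-- Splitting a linear factor off a monic complex polynomial. -/
theorem complexAverage_succ {s : ℂ} {n m : ℕ} (t : Fin m → ℂ)
    (hs : ((n + 1 + m : ℕ) : ℝ) < s.re) :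
    ((n + 1 : ℕ) : ℂ) * complexAverage s (n + 1) t =
      ∫ z : ℂ, ((max 1 ‖z‖ : ℝ) : ℂ) ^ (-(2 * s)) * (∏ i, (‖t i - z‖ ^ 2 : ℂ)) *
          complexAverage s n (Fin.cons z t : Fin (m + 1) → ℂ) := by
  have hint := integrable_complexAverage (n := n + 1) t hs
  have hdet : ∀ x : Fin (n + 1) → ℂ, ((mulCoeffsDeriv n 1 x).restrictScalars ℝ).det =
      ‖resultant (monPoly fun j => x (Fin.castAdd 1 j))
        (monPoly fun j => x (Fin.natAdd n j)) n 1‖ ^ 2 := by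
    intro x
    rw [det_restrictScalars_mulCoeffsDeriv, Algebra.norm_complex_apply, Complex.normSq_eq_norm_sq]
  have hcont : Continuous fun x : Fin (n + 1) → ℂ =>
      ((mulCoeffsDeriv n 1 x).restrictScalars ℝ).det := by
    simp_rw [hdet]
    exact continuous_resultant_monPoly.norm.pow 2
  obtain ⟨hI, hE⟩ := integral_det_fderiv_mul_comp volume hasFDerivAt_real_mulCoeffs hcont
    (n + 1) _ (ae_fiber_linear_complex n) hint
  have hlin : ∀ q : Fin 1 → ℂ, monPoly q = X - C (-q 0) := by
    intro q
    simp [monPoly, lowPoly]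
  let H : ℂ → (Fin n → ℂ) → ℂ := fun z f =>
    ((max 1 ‖z‖ : ℝ) : ℂ) ^ (-(2 * s)) * (∏ i, (‖t i - z‖ ^ 2 : ℂ)) *
    (((monPoly f).mahlerMeasure : ℂ) ^ (-(2 * s)) *
      ∏ i, (‖(monPoly f).eval ((Fin.cons z t : Fin (m + 1) → ℂ) i)‖ ^ 2 : ℂ))
  let G : (Fin n → ℂ) × (Fin 1 → ℂ) → ℂ := fun p => H (-p.2 0) p.1
  have hG : ∀ x : Fin (n + 1) → ℂ, (((mulCoeffsDeriv n 1 x).restrictScalars ℝ).det : ℂ) *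
      (((monPoly (mulCoeffs n 1 x)).mahlerMeasure : ℂ) ^ (-(2 * s)) *
        ∏ i, (‖(monPoly (mulCoeffs n 1 x)).eval (t i)‖ ^ 2 : ℂ)) = G (splitVec ℂ n 1 x) := by
    intro x
    rw [hdet, monPoly_mulCoeffs, mahlerMeasure_mul_cpow, splitVec_apply,
      hlin fun j => x (Fin.natAdd n j), resultant_X_sub_C_right _ _ _ (natDegree_monPoly _).le,
      mahlerMeasure_X_sub_C]
    simp only [G, H, Fin.prod_univ_succ, Fin.cons_zero, Fin.cons_succ, eval_mul, eval_sub, eval_X,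
      eval_C, norm_mul, Complex.ofReal_mul, mul_pow, Finset.prod_mul_distrib, norm_pow, norm_neg,
      norm_one, one_pow, one_mul, Complex.ofReal_pow]
    ring
  simp_rw [hG] at hI hE
  have hmp := volume_preserving_splitVec ℂ n 1
  rw [hmp.integral_comp' (g := G)] at hE
  have hIG : Integrable G := (hmp.integrable_comp_emb (splitVec ℂ n 1).measurableEmbedding).1 hI
  rw [Measure.volume_eq_prod] at hIG hE
  rw [integral_prod_symm G hIG] at hE
  have h1 := (volume_preserving_funUnique (Fin 1) ℂ).integral_comp'
    (g := fun u => ∫ f, H (-u) f)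
  -- The linear polynomial with constant term `u` has root `-u`; the integral is rewritten over the
  -- root.
  have h2 : ∫ u : ℂ, ∫ f, H (-u) f = ∫ u : ℂ, ∫ f, H u f :=
    integral_neg_eq_self (fun u : ℂ => ∫ f, H u f) volume
  have h3 : ∫ q : Fin 1 → ℂ, ∫ f, G (f, q) = ∫ u : ℂ, ∫ f, H u f := by
    rw [← h2, ← h1]
    rfl
  rw [h3] at hE
  rw [complexAverage]
  rw [← hE]
  refine integral_congr_ae (Filter.Eventually.of_forall fun z => ?_)
  simp only [H, complexAverage]
  rw [integral_const_mul]

end PeelingFactors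

/-! ### Powers of a function from integrals over its sublevel sets -/

section LayerCake

open Set

theorem integral_Ici_cpow_mul {s : ℂ} {κ : ℕ} (hs : (κ : ℝ) < s.re) :
    ∫ T : ℝ in Ici 1, (T : ℂ) ^ (-s - 1) * (T : ℂ) ^ κ = 1 / (s - κ) := by
  rw [integral_Ici_eq_integral_Ioi]
  have h1 : ∫ T : ℝ in Ioi 1, (T : ℂ) ^ (-s - 1) * (T : ℂ) ^ κ =
      ∫ T : ℝ in Ioi 1, (T : ℂ) ^ (-s - 1 + κ) := by
    refine setIntegral_congr_fun measurableSet_Ioi fun T hT => ?_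
    have : (T : ℂ) ≠ 0 := by
      have : (0 : ℝ) < T := one_pos.trans hT
      exact_mod_cast this.ne'
    rw [Complex.cpow_add _ _ this, Complex.cpow_natCast]
  have hne : s - κ ≠ 0 := by
    intro h
    have := congrArg Complex.re h
    simp at this
    linarith
  rw [h1, integral_Ioi_cpow_of_lt (by simp; linarith) one_pos, Complex.ofReal_one,
    Complex.one_cpow, show -s - 1 + (κ : ℂ) + 1 = -(s - κ) by ring, neg_div_neg_eq]

theorem integral_Ici_cpow {s : ℂ} {M : ℝ} (hM : 0 < M) (hs : 0 < s.re) :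
    ∫ T : ℝ in Ici M, (T : ℂ) ^ (-s - 1) = (M : ℂ) ^ (-s) / s := by
  rw [integral_Ici_eq_integral_Ioi, integral_Ioi_cpow_of_lt (by simp; linarith) hM,
    show -s - 1 + 1 = -s by ring, neg_div_neg_eq]

theorem integral_Ici_norm_cpow {s : ℂ} {M : ℝ} (hM : 0 < M) (hs : 0 < s.re) :
    ∫ T : ℝ in Ici M, ‖(T : ℂ) ^ (-s - 1)‖ = M ^ (-s.re) / s.re := by
  have h1 : ∫ T : ℝ in Ici M, ‖(T : ℂ) ^ (-s - 1)‖ = ∫ T : ℝ in Ici M, T ^ (-s.re - 1) := by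
    refine setIntegral_congr_fun measurableSet_Ici fun T hT => ?_
    rw [Complex.norm_cpow_eq_rpow_re_of_pos (hM.trans_le hT)]
    simp
  rw [h1, integral_Ici_eq_integral_Ioi, integral_Ioi_rpow_of_lt (by linarith) hM,
    show -s.re - 1 + 1 = -s.re by ring, neg_div_neg_eq]

/-- If the integral of `S` over the sublevel sets of `M` is a monomial in the level, then so is
the integral of `S` against a power of `M`, up to a linear denominator. -/
theorem integral_cpow_mul_of_sublevel {X : Type*} [MeasurableSpace X] {μ : Measure X} [SFinite μ]
    {M : X → ℝ} (hM : Measurable M) (hM1 : ∀ x, 1 ≤ M x) {S : X → ℂ} (hS : Measurable S) {s A : ℂ}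
    {κ : ℕ} (hs : (κ : ℝ) < s.re) (hint : Integrable (fun x => (M x : ℂ) ^ (-s) * S x) μ)
    (hG : ∀ T : ℝ, 1 ≤ T → ∫ x in {x | M x ≤ T}, S x ∂μ = A * (T : ℂ) ^ κ) :
    ∫ x, (M x : ℂ) ^ (-s) * S x ∂μ = A * (s / (s - κ)) := by
  have hs0 : 0 < s.re := lt_of_le_of_lt (Nat.cast_nonneg _) hs
  have hsne : s ≠ 0 := by rintro rfl; simp at hs0
  have hMpos : ∀ x, 0 < M x := fun x => one_pos.trans_le (hM1 x)
  set ν : Measure ℝ := volume.restrict (Ici 1)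
  let B : Set (X × ℝ) := {p | M p.1 ≤ p.2}
  have hB : MeasurableSet B := measurableSet_le (hM.comp measurable_fst) measurable_snd
  -- Here `M^(-s) = s ∫ T^(-s - 1) dT` over `T ≥ M`, and Fubini on the region `M x ≤ T` exchanges
  -- the integrals. Since `M ≥ 1`, restricting to `T ≥ 1` loses nothing.
  let F : X × ℝ → ℂ := B.indicator fun p => S p.1 * (p.2 : ℂ) ^ (-s - 1)
  have hFm : Measurable F := by
    refine Measurable.indicator ?_ hB
    exact (hS.comp measurable_fst).mul
      ((Complex.measurable_ofReal.comp measurable_snd).pow_const _)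
  have hFx : ∀ x, (fun T => F (x, T)) = (Ici (M x)).indicator fun T => S x * (T : ℂ) ^ (-s - 1) := by
    intro x
    funext T
    simp only [F, indicator, B, mem_ofPred_eq, mem_Ici]
  have hres : ∀ x, ν.restrict (Ici (M x)) = volume.restrict (Ici (M x)) := by
    intro x
    rw [Measure.restrict_restrict measurableSet_Ici, Ici_inter_Ici, sup_eq_left.2 (hM1 x)]
  have hiT : ∀ x, IntegrableOn (fun T : ℝ => (T : ℂ) ^ (-s - 1)) (Ici (M x)) := by
    intro x
    rw [integrableOn_Ici_iff_integrableOn_Ioi]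
    exact integrableOn_Ioi_cpow_of_lt (by simp; linarith) (hMpos x)
  have hFint : Integrable F (μ.prod ν) := by
    rw [integrable_prod_iff hFm.aestronglyMeasurable]
    constructor
    · refine Filter.Eventually.of_forall fun x => ?_
      rw [hFx, integrable_indicator_iff measurableSet_Ici, IntegrableOn, hres]
      exact (hiT x).const_mul _
    · have : (fun x => ∫ T, ‖F (x, T)‖ ∂ν) = fun x => ‖(M x : ℂ) ^ (-s) * S x‖ / s.re := by
        funext x
        have h1 : (fun T => ‖F (x, T)‖) =
            (Ici (M x)).indicator fun T : ℝ => ‖S x‖ * ‖(T : ℂ) ^ (-s - 1)‖ := by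
          funext T
          have := congrFun (hFx x) T
          rw [this, norm_indicator_eq_indicator_norm]
          simp only [norm_mul]
        rw [h1, integral_indicator measurableSet_Ici, hres, integral_const_mul,
          integral_Ici_norm_cpow (hMpos x) hs0, norm_mul,
          Complex.norm_cpow_eq_rpow_re_of_pos (hMpos x), Complex.neg_re]
        ring
      rw [this]
      exact hint.norm.div_const _
  have h1 : ∫ x, (M x : ℂ) ^ (-s) * S x ∂μ = s * ∫ x, ∫ T, F (x, T) ∂ν ∂μ := by
    rw [← integral_const_mul]
    refine integral_congr_ae (Filter.Eventually.of_forall fun x => ?_)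
    simp only
    rw [hFx, integral_indicator measurableSet_Ici, hres, integral_const_mul,
      integral_Ici_cpow (hMpos x) hs0]
    field_simp
  have h2 : ∫ x, ∫ T, F (x, T) ∂ν ∂μ = ∫ T, ∫ x, F (x, T) ∂μ ∂ν :=
    integral_integral_swap hFint
  have h3 : ∫ T, ∫ x, F (x, T) ∂μ ∂ν = ∫ T : ℝ in Ici 1, A * ((T : ℂ) ^ (-s - 1) * (T : ℂ) ^ κ) := by
    refine setIntegral_congr_fun measurableSet_Ici fun T hT => ?_
    have h4 : (fun x => F (x, T)) = {x | M x ≤ T}.indicator fun x => S x * (T : ℂ) ^ (-s - 1) := by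
      funext x
      simp only [F, indicator, B, mem_ofPred_eq]
    rw [h4, integral_indicator (measurableSet_le hM measurable_const), integral_mul_const, hG T hT]
    ring
  rw [h1, h2, h3, integral_const_mul, integral_Ici_cpow_mul hs]
  ring

end LayerCake

/-! ### Moments of linear factors -/

section OneVariableMoments

open Set

theorem integral_Icc_pow_symm (T : ℝ) (hT : 0 ≤ T) (p : ℕ) :
    ∫ x in Icc (-T) T, x ^ p = (1 + (-1) ^ p) * T ^ (p + 1) / (p + 1) := by
  rw [integral_Icc_eq_integral_Ioc, ← intervalIntegral.integral_of_le (by linarith), integral_pow,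
    neg_pow, pow_succ (-1 : ℝ)]
  ring

theorem integrable_max_norm_cpow_mul {E : Type*} [NormedAddCommGroup E] [NormedSpace ℝ E]
    [FiniteDimensional ℝ E] [MeasurableSpace E] [BorelSpace E] (μ : Measure E)
    [μ.IsAddHaarMeasure] {s : ℂ} {F : E → ℂ} (hF : Measurable F) {k : ℕ}
    (hFB : ∀ x, ‖F x‖ ≤ max 1 ‖x‖ ^ k) (hs : (Module.finrank ℝ E : ℝ) < s.re - k) :
    Integrable (fun x => ((max 1 ‖x‖ : ℝ) : ℂ) ^ (-s) * F x) μ := by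
  refine ((integrable_one_add_norm (μ := μ) hs).const_mul ((2 : ℝ) ^ (s.re - k))).mono' ?_
    (Filter.Eventually.of_forall fun x => ?_)
  · refine Measurable.aestronglyMeasurable ?_
    exact ((Complex.measurable_ofReal.comp (by fun_prop)).pow_const _).mul hF
  · have hpos : (0 : ℝ) < s.re - k := lt_of_le_of_lt (Nat.cast_nonneg _) hs
    have hM : 0 < max 1 ‖x‖ := one_pos.trans_le (le_max_left _ _)
    have h1 : (1 + ‖x‖) / 2 ≤ max 1 ‖x‖ := by
      rcases le_total 1 ‖x‖ with h | h
      · rw [max_eq_right h]; linarith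
      · rw [max_eq_left h]; linarith
    rw [norm_mul, Complex.norm_cpow_eq_rpow_re_of_pos hM, Complex.neg_re]
    calc max 1 ‖x‖ ^ (-s.re) * ‖F x‖ ≤ max 1 ‖x‖ ^ (-s.re) * max 1 ‖x‖ ^ k :=
          mul_le_mul_of_nonneg_left (hFB x) (Real.rpow_nonneg hM.le _)
      _ = max 1 ‖x‖ ^ (-(s.re - k)) := by
          rw [neg_sub, sub_eq_neg_add, Real.rpow_add hM, Real.rpow_natCast]
      _ ≤ ((1 + ‖x‖) / 2) ^ (-(s.re - k)) :=
          Real.rpow_le_rpow_of_nonpos (by positivity) h1 (by linarith)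
      _ = _ := by
          rw [Real.div_rpow (by positivity) (by positivity),
            Real.rpow_neg (by positivity : (0 : ℝ) ≤ 2), div_inv_eq_mul]
          ring

theorem integrable_max_cpow_mul_pow {s : ℂ} {p : ℕ} (hs : ((p + 1 : ℕ) : ℝ) < s.re) :
    Integrable fun x : ℝ => ((max 1 |x| : ℝ) : ℂ) ^ (-s) * (x : ℂ) ^ p := by
  refine integrable_max_norm_cpow_mul volume (E := ℝ) (k := p) (by fun_prop) (fun x => ?_) ?_
  · rw [norm_pow, Complex.norm_real]
    gcongr
    exact le_max_right _ _
  · push_cast at hs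
    simp
    linarith

/-- The real moments of a linear factor. -/
theorem integral_max_cpow_mul_pow {s : ℂ} {p : ℕ} (hs : ((p + 1 : ℕ) : ℝ) < s.re) :
    ∫ x : ℝ, ((max 1 |x| : ℝ) : ℂ) ^ (-s) * (x : ℂ) ^ p =
      ((1 + (-1) ^ p) / (p + 1)) * (s / (s - (p + 1 : ℕ))) := by
  refine integral_cpow_mul_of_sublevel (by fun_prop) (fun x => le_max_left _ _) (by fun_prop) hs
    (integrable_max_cpow_mul_pow hs) fun T hT => ?_
  have h1 : {x : ℝ | max 1 |x| ≤ T} = Icc (-T) T := by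
    ext x
    simp [hT, abs_le]
  rw [h1]
  have := integral_Icc_pow_symm T (by linarith) p
  have h2 : ∫ x in Icc (-T) T, (x : ℂ) ^ p = ((∫ x in Icc (-T) T, x ^ p : ℝ) : ℂ) := by
    rw [← integral_complex_ofReal]
    simp
  rw [h2, this]
  push_cast
  ring

theorem integrable_max_cpow_mul_pow_mul_conj {s : ℂ} {p q : ℕ}
    (hs : ((p + q + 2 : ℕ) : ℝ) < s.re) :
    Integrable fun z : ℂ => ((max 1 ‖z‖ : ℝ) : ℂ) ^ (-s) * (z ^ p * starRingEnd ℂ z ^ q) := by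
  refine integrable_max_norm_cpow_mul volume (k := p + q)
    (Continuous.measurable (by fun_prop)) (fun x => ?_) ?_
  · rw [norm_mul, norm_pow, norm_pow, Complex.norm_conj, ← pow_add]
    gcongr
    exact le_max_right _ _
  · push_cast at hs
    simp
    linarith

theorem integral_Ioo_exp_mul_I (p q : ℕ) :
    ∫ θ in Ioo (-Real.pi) Real.pi, Complex.exp (θ * Complex.I) ^ p *
      starRingEnd ℂ (Complex.exp (θ * Complex.I)) ^ q =
      if p = q then (2 * Real.pi : ℂ) else 0 := by
  rw [← integral_Ioc_eq_integral_Ioo,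
    ← intervalIntegral.integral_of_le (by linarith [Real.pi_pos])]
  have h1 : ∀ θ : ℝ, Complex.exp (θ * Complex.I) ^ p *
      starRingEnd ℂ (Complex.exp (θ * Complex.I)) ^ q =
      Complex.exp (((p : ℂ) - q) * Complex.I * θ) := by
    intro θ
    rw [← Complex.exp_conj, ← Complex.exp_nat_mul, ← Complex.exp_nat_mul, ← Complex.exp_add]
    congr 1
    simp
    ring
  simp_rw [h1]
  split_ifs with h
  · subst h
    simp
    ring
  · have hc : ((p : ℂ) - q) * Complex.I ≠ 0 :=
      mul_ne_zero (sub_ne_zero.2 (by exact_mod_cast h)) Complex.I_ne_zero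
    rw [integral_exp_mul_complex hc]
    have : Complex.exp (((p : ℂ) - q) * Complex.I * Real.pi) =
        Complex.exp (((p : ℂ) - q) * Complex.I * ((-Real.pi : ℝ) : ℂ)) := by
      rw [Complex.exp_eq_exp_iff_exists_int]
      refine ⟨p - q, ?_⟩
      push_cast
      ring
    rw [this, sub_self, zero_div]

/-- In polar coordinates the angular integral of `exp(i (p - q) θ)` vanishes unless `p = q`. -/
theorem integral_closedBall_pow_mul_conj_pow {T : ℝ} (hT : 0 ≤ T) (p q : ℕ) :
    ∫ z in {z : ℂ | ‖z‖ ≤ T}, z ^ p * starRingEnd ℂ z ^ q =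
      if p = q then (Real.pi : ℂ) * T ^ (2 * p + 2) / (p + 1) else 0 := by
  have hm : MeasurableSet {z : ℂ | ‖z‖ ≤ T} := measurableSet_le (by fun_prop) measurable_const
  rw [← integral_indicator hm, ← Complex.integral_comp_polarCoord_symm]
  have h1 : ∫ x in polarCoord.target, x.1 • ({z : ℂ | ‖z‖ ≤ T}.indicator
      (fun z => z ^ p * starRingEnd ℂ z ^ q) (Complex.polarCoord.symm x)) =
      ∫ x in Ioi (0 : ℝ) ×ˢ Ioo (-Real.pi) Real.pi,
        ((Iic T).indicator (fun r : ℝ => (r : ℂ) ^ (p + q + 1)) x.1) *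
          (Complex.exp (x.2 * Complex.I) ^ p *
            starRingEnd ℂ (Complex.exp (x.2 * Complex.I)) ^ q) := by
    refine setIntegral_congr_fun (measurableSet_Ioi.prod measurableSet_Ioo) fun x hx => ?_
    have hx0 : 0 < x.1 := hx.1
    have hpc : Complex.polarCoord.symm x = x.1 * Complex.exp (x.2 * Complex.I) := by
      rw [Complex.polarCoord_symm_apply, Complex.exp_mul_I]
      simp
    have hn : ‖Complex.polarCoord.symm x‖ = x.1 := by
      rw [Complex.norm_polarCoord_symm, abs_of_pos hx0]
    simp only [indicator, mem_ofPred_eq, hn, mem_Iic]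
    split_ifs
    · rw [hpc, map_mul, Complex.conj_ofReal, Complex.real_smul]
      ring
    · simp
  rw [h1, Measure.volume_eq_prod, setIntegral_prod_mul
      (fun r : ℝ => (Iic T).indicator (fun r : ℝ => (r : ℂ) ^ (p + q + 1)) r)
      (fun θ : ℝ => Complex.exp (θ * Complex.I) ^ p *
        starRingEnd ℂ (Complex.exp (θ * Complex.I)) ^ q), integral_Ioo_exp_mul_I,
    setIntegral_indicator measurableSet_Iic, Ioi_inter_Iic,
    ← intervalIntegral.integral_of_le hT]
  split_ifs with h
  · subst h
    have h2 : ∫ r in (0 : ℝ)..T, (r : ℂ) ^ (p + p + 1) =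
        ((∫ r in (0 : ℝ)..T, r ^ (p + p + 1) : ℝ) : ℂ) := by
      rw [← intervalIntegral.integral_ofReal]
      simp
    have h3 : (p : ℂ) + 1 ≠ 0 := by exact_mod_cast Nat.succ_ne_zero p
    have h4 : (p : ℂ) + p + 1 + 1 ≠ 0 := by exact_mod_cast Nat.succ_ne_zero (p + p + 1)
    rw [h2, integral_pow]
    push_cast
    rw [zero_pow (by lia), show (p : ℂ) + p + 1 + 1 = 2 * (p + 1) by ring]
    field_simp
    ring
  · simp

/-- The complex moments of a linear factor are orthogonal. -/
theorem integral_max_norm_cpow_mul_pow {s : ℂ} {p q : ℕ} (hp : ((p + 1 : ℕ) : ℝ) < s.re)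
    (hq : ((q + 1 : ℕ) : ℝ) < s.re) :
    ∫ z : ℂ, ((max 1 ‖z‖ : ℝ) : ℂ) ^ (-(2 * s)) * (z ^ p * starRingEnd ℂ z ^ q) =
      if p = q then (Real.pi : ℂ) / (p + 1) * (s / (s - (p + 1 : ℕ))) else 0 := by
  have hre : (2 * s).re = 2 * s.re := by simp
  -- On the diagonal `κ = 2 (p + 1)`, and the factor `2` cancels against the exponent `2 s`. Off the
  -- diagonal the constant is zero, so the value of `κ` only has to satisfy the convergence
  -- condition.
  rw [integral_cpow_mul_of_sublevel (s := 2 * s) (κ := p + q + 2)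
    (A := if p = q then (Real.pi : ℂ) / (p + 1) else 0) (by fun_prop)
    (fun x => le_max_left _ _) (Continuous.measurable (by fun_prop)) (by
      rw [hre]; push_cast at hp hq ⊢; linarith)
    (integrable_max_cpow_mul_pow_mul_conj (by rw [hre]; push_cast at hp hq ⊢; linarith))]
  · split_ifs with h
    · subst h
      congr 1
      rw [show (2 * s - ((p + p + 2 : ℕ) : ℂ)) = 2 * (s - (p + 1 : ℕ)) by push_cast; ring,
        mul_div_mul_left _ _ two_ne_zero]
    · simp
  · intro T hT
    have h1 : {x : ℂ | max 1 ‖x‖ ≤ T} = {x : ℂ | ‖x‖ ≤ T} := by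
      ext x
      simp [hT]
    rw [h1, integral_closedBall_pow_mul_conj_pow (by linarith)]
    split_ifs with h
    · subst h
      rw [show p + p + 2 = 2 * p + 2 by ring]
      ring
    · simp

end OneVariableMoments

/-! ### Moments of real quadratic factors over trapezoids -/

section QuadraticMoments

open Set Polynomial

/-- The complete homogeneous symmetric polynomials `(β ^ k - α ^ k) / (β - α)` in the roots of
`x ^ 2 + u x + v`. -/
def homSym {R : Type*} [CommRing R] (v u : R) : ℕ → R
  | 0 => 0
  | 1 => 1
  | k + 2 => -u * homSym v u (k + 1) - v * homSym v u k

/-- The power sums of the roots of `x ^ 2 + u x + v`. -/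
def powSum {R : Type*} [CommRing R] (v u : R) : ℕ → R
  | 0 => 2
  | 1 => -u
  | k + 2 => -u * powSum v u (k + 1) - v * powSum v u k

theorem two_step {P : ℕ → Prop} (h0 : P 0) (h1 : P 1) (h : ∀ k, P k → P (k + 1) → P (k + 2)) :
    ∀ k, P k := by
  intro k
  induction k using Nat.twoStepInduction with
  | zero => exact h0
  | one => exact h1
  | more k ih1 ih2 => exact h k ih1 ih2

theorem sub_mul_homSym {R : Type*} [CommRing R] (α β : R) (k : ℕ) :
    (β - α) * homSym (α * β) (-(α + β)) k = β ^ k - α ^ k := by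
  induction k using two_step with
  | h0 => simp [homSym]
  | h1 => simp [homSym]
  | h k ih1 ih2 =>
    rw [homSym]
    linear_combination (α + β) * ih2 - α * β * ih1

theorem powSum_eq {R : Type*} [CommRing R] (α β : R) (k : ℕ) :
    powSum (α * β) (-(α + β)) k = α ^ k + β ^ k := by
  induction k using two_step with
  | h0 => simp [powSum]; norm_num
  | h1 => simp [powSum]
  | h k ih1 ih2 =>
    rw [powSum, ih1, ih2]
    ring

theorem powSum_succ_eq_homSym {R : Type*} [CommRing R] (v u : R) (k : ℕ) :
    powSum v u (k + 1) = -u * homSym v u (k + 1) - 2 * v * homSym v u k := by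
  induction k using two_step with
  | h0 => simp [powSum, homSym]
  | h1 => simp [powSum, homSym]; ring
  | h k ih1 ih2 =>
    rw [powSum, ih2, ih1]
    simp only [homSym]
    ring

/-- Differentiating the recursion in `u` leaves the term `-powSum v u (k + 1)`, which
`powSum_succ_eq_homSym` expresses through `homSym`. Thus, up to the factor `-k`, the power sum is a
primitive of `homSym` in `u`. -/
theorem hasDerivAt_powSum (v u : ℝ) (k : ℕ) :
    HasDerivAt (fun u => powSum v u k) (-k * homSym v u k) u := by
  induction k using two_step with
  | h0 => simpa [powSum, homSym] using hasDerivAt_const u (2 : ℝ)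
  | h1 => simpa [powSum, homSym] using hasDerivAt_neg u
  | h k ih1 ih2 =>
    have := (((hasDerivAt_id u).neg.mul ih2).sub (ih1.const_mul v))
    refine this.congr_deriv ?_
    have h := powSum_succ_eq_homSym v u k
    simp only [homSym, Pi.neg_apply, id]
    push_cast
    linear_combination -h

theorem continuous_homSym {R : Type*} [CommRing R] [TopologicalSpace R] [IsTopologicalRing R]
    {E : Type*} [TopologicalSpace E] {v u : E → R} (hv : Continuous v) (hu : Continuous u) (k : ℕ) :
    Continuous fun x => homSym (v x) (u x) k := by
  induction k using two_step with
  | h0 => exact continuous_const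
  | h1 => exact continuous_const
  | h k ih1 ih2 =>
    simp only [homSym]
    fun_prop

/-- The symmetric polynomial `(α ^ p β ^ r - α ^ r β ^ p) / (β - α)` in the roots of
`x ^ 2 + u x + v`. -/
def altSym {R : Type*} [CommRing R] (v u : R) (p r : ℕ) : R :=
  if p ≤ r then v ^ p * homSym v u (r - p) else -(v ^ r * homSym v u (p - r))

theorem sub_mul_altSym {R : Type*} [CommRing R] (α β : R) (p r : ℕ) :
    (β - α) * altSym (α * β) (-(α + β)) p r = α ^ p * β ^ r - α ^ r * β ^ p := by
  unfold altSym
  split_ifs with h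
  · obtain ⟨k, rfl⟩ := Nat.exists_eq_add_of_le h
    have := sub_mul_homSym α β k
    rw [Nat.add_sub_cancel_left, mul_left_comm, this, mul_pow]
    ring
  · obtain ⟨k, rfl⟩ := Nat.exists_eq_add_of_le (not_le.1 h).le
    have := sub_mul_homSym α β k
    rw [Nat.add_sub_cancel_left, mul_neg, mul_left_comm, this, mul_pow]
    ring

theorem altSym_swap {R : Type*} [CommRing R] (v u : R) (p r : ℕ) :
    altSym v u r p = -altSym v u p r := by
  unfold altSym
  rcases lt_trichotomy p r with h | rfl | h
  · rw [if_neg h.not_ge, if_pos h.le]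
  · simp [homSym]
  · rw [if_pos h.le, if_neg h.not_ge, neg_neg]

theorem max_one_mul_max_one_le_iff {a b T : ℝ} (hb : 0 ≤ b) (hT : 1 ≤ T) :
    max 1 a * max 1 b ≤ T ↔ a ≤ T ∧ b ≤ T ∧ a * b ≤ T := by
  constructor
  · intro h
    have h1 : max 1 a ≤ T := le_trans (le_mul_of_one_le_right (by positivity) (le_max_left _ _)) h
    have h2 : max 1 b ≤ T := le_trans (le_mul_of_one_le_left (by positivity) (le_max_left _ _)) h
    exact ⟨(le_max_right _ _).trans h1, (le_max_right _ _).trans h2,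
      le_trans (by gcongr <;> exact le_max_right _ _) h⟩
  · rintro ⟨h1, h2, h3⟩
    rcases max_cases 1 a with ⟨h, _⟩ | ⟨h, _⟩ <;> rcases max_cases 1 b with ⟨h', _⟩ | ⟨h', _⟩ <;>
      rw [h, h'] <;> linarith

/-- Multiplied by `T`, the bound on `|a + b|` says that `(T - a) (T - b)` and `(T + a) (T + b)` are
nonnegative. If one root left `[-T, T]`, the other would lie beyond the same endpoint or at it, and
`a b > T^2 ≥ T` would contradict the bound on `|a b|`. -/
theorem real_root_trapezoid_iff {a b T : ℝ} (hT : 1 ≤ T) :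
    (|a| ≤ T ∧ |b| ≤ T ∧ |a| * |b| ≤ T) ↔ |a * b| ≤ T ∧ |-(a + b)| ≤ T + a * b / T := by
  have hT0 : 0 < T := by linarith
  rw [← abs_mul, abs_neg]
  have hkey : |a + b| ≤ T + a * b / T ↔ 0 ≤ (T - a) * (T - b) ∧ 0 ≤ (T + a) * (T + b) := by
    rw [show T + a * b / T = (T * T + a * b) / T by field_simp, le_div_iff₀ hT0, abs_eq_max_neg,
      max_mul_of_nonneg _ _ hT0.le, max_le_iff]
    constructor <;> rintro ⟨h1, h2⟩ <;> constructor <;> nlinarith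
  rw [hkey]
  constructor
  · rintro ⟨h1, h2, h3⟩
    rw [abs_le] at h1 h2
    exact ⟨h3, mul_nonneg (by linarith) (by linarith), mul_nonneg (by linarith) (by linarith)⟩
  · rintro ⟨h3, h1, h2⟩
    have h4 := abs_le.1 h3
    have h5 : a ≤ T := by
      by_contra! h
      have : T ≤ b := by
        by_contra! h'
        nlinarith [mul_pos (sub_pos.2 h) (sub_pos.2 h')]
      nlinarith
    have h6 : b ≤ T := by
      by_contra! h
      have : T ≤ a := by
        by_contra! h'
        nlinarith [mul_pos (sub_pos.2 h) (sub_pos.2 h')]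
      nlinarith
    have h7 : -T ≤ a := by
      by_contra! h
      have : b ≤ -T := by
        by_contra! h'
        nlinarith [mul_pos (sub_pos.2 h) (sub_pos.2 h')]
      nlinarith
    have h8 : -T ≤ b := by
      by_contra! h
      have : a ≤ -T := by
        by_contra! h'
        nlinarith [mul_pos (sub_pos.2 h) (sub_pos.2 h')]
      nlinarith
    exact ⟨abs_le.2 ⟨h7, h5⟩, abs_le.2 ⟨h8, h6⟩, h3⟩

theorem monPoly_quadratic_eq {q : Fin 2 → ℂ} {α β : ℂ} (h0 : q 0 = α * β) (h1 : q 1 = -(α + β)) :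
    monPoly q = (X - C α) * (X - C β) := by
  rw [monPoly, lowPoly, Fin.sum_univ_two, h0, h1]
  simp
  ring

theorem exists_real_quadratic_roots (u v : ℝ) :
    (∃ a b : ℝ, v = a * b ∧ u = -(a + b)) ∨
      (u ^ 2 < 4 * v ∧ ∃ a : ℂ, (v : ℂ) = a * starRingEnd ℂ a ∧
        (u : ℂ) = -(a + starRingEnd ℂ a)) := by
  rcases le_or_gt 0 (u ^ 2 - 4 * v) with h | h
  · left
    have := Real.sq_sqrt h
    exact ⟨(-u + √(u ^ 2 - 4 * v)) / 2, (-u - √(u ^ 2 - 4 * v)) / 2, by linarith, by ring⟩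
  · right
    have h' : 0 ≤ 4 * v - u ^ 2 := by linarith
    have := Real.sq_sqrt h'
    refine ⟨by linarith, ⟨-u / 2, √(4 * v - u ^ 2) / 2⟩, ?_, ?_⟩
    · rw [Complex.mul_conj, Complex.normSq_mk]
      congr 1
      linarith
    · rw [Complex.add_conj]
      push_cast
      ring

/-- The set of real quadratics of Mahler measure at most `T` is a trapezoid. -/
theorem mahlerMeasure_quadratic_le_iff {T : ℝ} (hT : 1 ≤ T) (q : Fin 2 → ℝ) :
    (monPoly fun i => (q i : ℂ)).mahlerMeasure ≤ T ↔
      |q 0| ≤ T ∧ |q 1| ≤ T + q 0 / T := by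
  have hT0 : 0 < T := by linarith
  rcases exists_real_quadratic_roots (q 1) (q 0) with ⟨a, b, h0, h1⟩ | ⟨hlt, a, h0, h1⟩
  · rw [monPoly_quadratic_eq (α := a) (β := b) (by rw [h0]; push_cast; rfl)
      (by rw [h1]; push_cast; rfl), mahlerMeasure_mul, mahlerMeasure_X_sub_C,
      mahlerMeasure_X_sub_C, Complex.norm_real, Complex.norm_real, Real.norm_eq_abs,
      Real.norm_eq_abs, max_one_mul_max_one_le_iff (abs_nonneg _) hT,
      real_root_trapezoid_iff hT, h0, h1]
  · rw [monPoly_quadratic_eq h0 h1, mahlerMeasure_mul, mahlerMeasure_X_sub_C,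
      mahlerMeasure_X_sub_C, Complex.norm_conj,
      max_one_mul_max_one_le_iff (norm_nonneg _) hT]
    have hn : ‖a‖ * ‖a‖ = q 0 := by
      rw [Complex.mul_conj, Complex.normSq_eq_norm_sq] at h0
      have h2 : q 0 = ‖a‖ ^ 2 := by exact_mod_cast h0
      rw [h2, sq]
    have hv : 0 ≤ q 0 := hn ▸ mul_self_nonneg _
    rw [abs_of_nonneg hv, hn]
    constructor
    · rintro ⟨_, _, h⟩
      -- For conjugate roots the second condition is automatic: `u^2 < 4 v ≤ (T + v / T)^2`, by the
      -- arithmetic-geometric inequality.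
      refine ⟨h, abs_le_of_sq_le_sq ?_ (by positivity)⟩
      have h3 : T * (q 0 / T) = q 0 := by field_simp
      nlinarith [sq_nonneg (T - q 0 / T)]
    · rintro ⟨h, _⟩
      have : ‖a‖ ≤ T := by
        by_contra! h'
        nlinarith
      exact ⟨this, this, h⟩

theorem integral_homSym (v c : ℝ) (k : ℕ) :
    k * ∫ u in (-c)..c, homSym v u k = powSum v (-c) k - powSum v c k := by
  have h := intervalIntegral.integral_eq_sub_of_hasDerivAt (a := -c) (b := c)
    (fun u _ => hasDerivAt_powSum v u k)
    ((continuous_const.mul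
      (continuous_homSym continuous_const continuous_id k)).intervalIntegrable _ _)
  rw [intervalIntegral.integral_const_mul] at h
  linarith

/-- On the sloping sides `u = ∓(T + v / T)` the roots are `±T` and `±v / T`, so the boundary values
of the primitive are explicit. -/
theorem powSum_trapezoid {T : ℝ} (hT : 0 < T) (v : ℝ) (k : ℕ) :
    powSum v (-(T + v / T)) k - powSum v (T + v / T) k =
      (1 - (-1) ^ k) * (T ^ k + (v / T) ^ k) := by
  have h1 : T * (v / T) = v := by field_simp
  have h2 := powSum_eq T (v / T) k
  have h3 := powSum_eq (-T) (-(v / T)) k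
  rw [neg_mul_neg, h1, show -(-T + -(v / T)) = T + v / T by ring] at h3
  rw [h1] at h2
  rw [h2, h3, neg_pow T, neg_pow (v / T)]
  ring

theorem inner_trapezoid_altSym {T : ℝ} (hT : 0 < T) {v : ℝ} (hv : |v| ≤ T) (hT1 : 1 ≤ T)
    {p k : ℕ} (hk : 0 < k) :
    ∫ u in Icc (-(T + v / T)) (T + v / T), altSym v u p (p + k) =
      (1 - (-1) ^ k) / k * (T ^ k * v ^ p + v ^ (p + k) / T ^ k) := by
  have hc : 0 ≤ T + v / T := by
    have h1 : -1 ≤ v / T := by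
      rw [le_div_iff₀ hT]
      linarith [(abs_le.1 hv).1]
    linarith
  have h2 := integral_homSym v (T + v / T) k
  rw [powSum_trapezoid hT] at h2
  have hk0 : (k : ℝ) ≠ 0 := by positivity
  rw [integral_Icc_eq_integral_Ioc, ← intervalIntegral.integral_of_le (by linarith)]
  simp only [altSym, le_add_iff_nonneg_right, zero_le, if_true, Nat.add_sub_cancel_left]
  rw [intervalIntegral.integral_const_mul, eq_div_of_mul_eq hk0 ((mul_comm _ _).trans h2), pow_add,
    div_pow]
  field_simp

theorem setIntegral_trapezoid {T : ℝ} (hT : 0 < T) {F : ℝ → ℝ → ℝ}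
    (hF : Continuous fun q : Fin 2 → ℝ => F (q 0) (q 1)) :
    ∫ q in {q : Fin 2 → ℝ | |q 0| ≤ T ∧ |q 1| ≤ T + q 0 / T}, F (q 0) (q 1) =
      ∫ v in Icc (-T) T, ∫ u in Icc (-(T + v / T)) (T + v / T), F v u := by
  have hF' : Continuous fun z : ℝ × ℝ => F z.1 z.2 :=
    hF.comp (f := fun z : ℝ × ℝ => ![z.1, z.2]) (by fun_prop)
  set S : Set (ℝ × ℝ) := {z | |z.1| ≤ T ∧ |z.2| ≤ T + z.1 / T} with hS
  have hSc : IsClosed S := by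
    have h1 : Continuous fun z : ℝ × ℝ => |z.1| := by fun_prop
    have h2 : Continuous fun z : ℝ × ℝ => |z.2| := by fun_prop
    exact (isClosed_le h1 continuous_const).inter
      (isClosed_le h2 (g := fun z : ℝ × ℝ => T + z.1 / T) (by fun_prop))
  have hSk : IsCompact S := by
    refine (isCompact_Icc (a := ((-T, -(T + 1)) : ℝ × ℝ)) (b := (T, T + 1))).of_isClosed_subset
      hSc ?_
    rintro ⟨v, u⟩ ⟨h1, h2⟩
    simp only at h1 h2
    have h3 : v / T ≤ 1 := by
      rw [div_le_one hT]
      exact (abs_le.1 h1).2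
    have h1 := abs_le.1 h1
    have h2 := abs_le.1 h2
    exact ⟨⟨h1.1, by simp only; linarith⟩, ⟨h1.2, by simp only; linarith⟩⟩
  have e := (volume_preserving_finTwoArrow ℝ).setIntegral_preimage_emb
    (MeasurableEquiv.finTwoArrow (α := ℝ)).measurableEmbedding (fun z => F z.1 z.2) S
  have hint : Integrable (S.indicator fun z : ℝ × ℝ => F z.1 z.2) (volume.prod volume) :=
    (integrable_indicator_iff hSc.measurableSet).2 (hF'.continuousOn.integrableOn_compact hSk)
  refine e.trans ?_
  rw [← integral_indicator hSc.measurableSet, Measure.volume_eq_prod, integral_prod _ hint,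
    ← integral_indicator measurableSet_Icc]
  refine integral_congr_ae (Filter.Eventually.of_forall fun v => ?_)
  by_cases hv : v ∈ Icc (-T) T
  · simp only [indicator_of_mem hv]
    rw [← integral_indicator measurableSet_Icc]
    refine integral_congr_ae (Filter.Eventually.of_forall fun u => ?_)
    have : (v, u) ∈ S ↔ u ∈ Icc (-(T + v / T)) (T + v / T) := by
      simp [hS, abs_le, hv.1, hv.2]
    by_cases hu : (v, u) ∈ S
    · simp only [indicator_of_mem hu, indicator_of_mem (this.1 hu)]
    · simp only [indicator_of_notMem hu, indicator_of_notMem (fun h => hu (this.2 h))]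
  · simp only [indicator_of_notMem hv]
    refine integral_eq_zero_of_ae (Filter.Eventually.of_forall fun u => ?_)
    refine indicator_of_notMem (fun h => hv (abs_le.1 h.1)) _

theorem continuous_altSym {R : Type*} [CommRing R] [TopologicalSpace R] [IsTopologicalRing R]
    {E : Type*} [TopologicalSpace E] {v u : E → R} (hv : Continuous v) (hu : Continuous u)
    (p r : ℕ) : Continuous fun x => altSym (v x) (u x) p r := by
  unfold altSym
  have h1 := continuous_homSym hv hu (r - p)
  have h2 := continuous_homSym hv hu (p - r)
  split_ifs <;> fun_prop

theorem integral_trapezoid_altSym_of_lt {T : ℝ} (hT : 1 ≤ T) (p : ℕ) {k : ℕ} (hk : 0 < k) :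
    ∫ q in {q : Fin 2 → ℝ | (monPoly fun i => (q i : ℂ)).mahlerMeasure ≤ T},
      altSym (q 0) (q 1) p (p + k) =
    (1 - (-1) ^ k) / k * ((1 + (-1) ^ p) * T ^ (p + k + 1) / (p + 1) +
      (1 + (-1) ^ (p + k)) * T ^ (p + 1) / ((p + k : ℕ) + 1)) := by
  have hT0 : 0 < T := by linarith
  simp_rw [mahlerMeasure_quadratic_le_iff hT]
  rw [setIntegral_trapezoid hT0 (F := fun v u => altSym v u p (p + k))
    (continuous_altSym (continuous_apply 0) (continuous_apply 1) p (p + k))]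
  rw [setIntegral_congr_fun measurableSet_Icc
    (fun v hv => inner_trapezoid_altSym hT0 (abs_le.2 hv) hT hk)]
  have hi : ∀ n : ℕ, IntegrableOn (fun v : ℝ => v ^ n) (Icc (-T) T) := fun n =>
    (continuous_pow n).continuousOn.integrableOn_Icc
  rw [integral_const_mul, integral_add ((hi p).const_mul _) ((hi (p + k)).div_const _),
    integral_const_mul, integral_div, integral_Icc_pow_symm T hT0.le,
    integral_Icc_pow_symm T hT0.le]
  congr 2
  · ring
  · push_cast
    rw [pow_add T p 1, pow_add T (p + k) 1, pow_add T p k]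
    field_simp

/-- The integral of `altSym` over a trapezoid. -/
theorem integral_trapezoid_altSym {T : ℝ} (hT : 1 ≤ T) (p r : ℕ) :
    ∫ q in {q : Fin 2 → ℝ | (monPoly fun i => (q i : ℂ)).mahlerMeasure ≤ T},
      altSym (q 0) (q 1) p r =
    (if p % 2 = 0 ∧ r % 2 = 1 then 4 * T ^ (r + 1) / (((r : ℝ) - p) * (p + 1)) else
      if p % 2 = 1 ∧ r % 2 = 0 then 4 * T ^ (p + 1) / (((r : ℝ) - p) * (r + 1)) else 0) := by
  -- For even `k` everything vanishes. For odd `k` exactly one of the two terms survives, chosen by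
  -- the parity of `p`. The result is then a single monomial, with exponent one more than the odd
  -- index, as the sublevel argument requires.
  have key : ∀ p k : ℕ, 0 < k → (1 - (-1) ^ k) / (k : ℝ) * ((1 + (-1) ^ p) * T ^ (p + k + 1) /
      (p + 1) + (1 + (-1) ^ (p + k)) * T ^ (p + 1) / ((p + k : ℕ) + 1)) =
      (if p % 2 = 0 ∧ (p + k) % 2 = 1 then
        4 * T ^ (p + k + 1) / ((((p + k : ℕ) : ℝ) - p) * (p + 1)) else
      if p % 2 = 1 ∧ (p + k) % 2 = 0 then
        4 * T ^ (p + 1) / ((((p + k : ℕ) : ℝ) - p) * ((p + k : ℕ) + 1)) else 0) := by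
    intro p k hk
    have hk0 : (k : ℝ) ≠ 0 := by positivity
    rcases Nat.even_or_odd p with hp | hp <;> rcases Nat.even_or_odd k with hk' | hk'
    · have := hp.add hk'
      rw [Nat.even_iff] at hp this
      simp [hk'.neg_one_pow, hp, this]
    · have := hp.add_odd hk'
      rw [this.neg_one_pow, hk'.neg_one_pow, hp.neg_one_pow]
      rw [Nat.even_iff] at hp
      rw [Nat.odd_iff] at this
      simp only [hp, this, and_self, if_true]
      push_cast
      rw [add_sub_cancel_left]
      field_simp
      ring
    · have := hp.add_even hk'
      rw [Nat.odd_iff] at hp this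
      simp [hk'.neg_one_pow, hp, this]
    · have := hp.add_odd hk'
      rw [this.neg_one_pow, hk'.neg_one_pow, hp.neg_one_pow]
      rw [Nat.even_iff] at this
      rw [Nat.odd_iff] at hp
      simp only [hp, this]
      norm_num
      field_simp
      norm_num
  rcases lt_trichotomy p r with h | rfl | h
  · obtain ⟨k, rfl⟩ := Nat.exists_eq_add_of_le h.le
    rw [integral_trapezoid_altSym_of_lt hT p (by lia), key p k (by lia)]
  · have : ∀ x : ℝ, ∀ y : ℝ, altSym x y p p = 0 := by simp [altSym, homSym]
    simp only [this, integral_zero]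
    rw [if_neg (by lia), if_neg (by lia)]
  · obtain ⟨k, rfl⟩ := Nat.exists_eq_add_of_le h.le
    simp_rw [altSym_swap _ _ r (r + k)]
    rw [integral_neg, integral_trapezoid_altSym_of_lt hT r (by lia), key r k (by lia)]
    push_cast
    rcases Nat.even_or_odd r with hr | hr <;> rcases Nat.even_or_odd k with hk' | hk' <;>
      simp only [Nat.even_iff, Nat.odd_iff] at hr hk' <;>
      (first
        | have h2 : (r + k) % 2 = 0 := by lia
        | have h2 : (r + k) % 2 = 1 := by lia) <;>
      simp only [hr, h2] <;> norm_num <;> rw [← div_neg]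

theorem map_homSym {R S : Type*} [CommRing R] [CommRing S] (φ : R →+* S) (v u : R) (k : ℕ) :
    φ (homSym v u k) = homSym (φ v) (φ u) k := by
  induction k using two_step with
  | h0 => simp [homSym]
  | h1 => simp [homSym]
  | h k ih1 ih2 => simp [homSym, ih1, ih2]

theorem map_altSym {R S : Type*} [CommRing R] [CommRing S] (φ : R →+* S) (v u : R) (p r : ℕ) :
    φ (altSym v u p r) = altSym (φ v) (φ u) p r := by
  unfold altSym
  split_ifs <;> simp [map_homSym]

/-- The extra factor `B` stands for the exponent `k - 1`, the degree of `homSym` in the roots,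
without subtraction. The recursion needs `2 * 3 + 1 ≤ 9`. In the application `B` is Mahler's
measure, which bounds `|v|` and half of `|u|`. -/
theorem mul_norm_homSym_le {v u : ℂ} {B : ℝ} (hB : 1 ≤ B) (hv : ‖v‖ ≤ B) (hu : ‖u‖ ≤ 2 * B)
    (k : ℕ) : B * ‖homSym v u k‖ ≤ 3 ^ k * B ^ k := by
  have hB0 : 0 < B := by linarith
  induction k using two_step with
  | h0 => simp [homSym]
  | h1 => simp [homSym]; linarith
  | h k ih1 ih2 =>
    have h1 : ‖homSym v u (k + 2)‖ ≤
        (2 * B) * ‖homSym v u (k + 1)‖ + B * ‖homSym v u k‖ := by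
      rw [homSym]
      refine (norm_sub_le _ _).trans ?_
      rw [norm_mul, norm_mul, norm_neg]
      gcongr
    have h2 : 3 ^ k * B ^ k ≤ 3 ^ k * B ^ (k + 1) :=
      mul_le_mul_of_nonneg_left (pow_le_pow_right₀ hB k.le_succ) (by positivity)
    calc B * ‖homSym v u (k + 2)‖ ≤ B * (2 * (B * ‖homSym v u (k + 1)‖) + B * ‖homSym v u k‖) := by
          gcongr
          linarith
      _ ≤ B * (2 * (3 ^ (k + 1) * B ^ (k + 1)) + 3 ^ k * B ^ (k + 1)) := by
          exact mul_le_mul_of_nonneg_left (add_le_add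
            (mul_le_mul_of_nonneg_left ih2 two_pos.le) (ih1.trans h2)) hB0.le
      _ = 7 * (3 ^ k * B ^ (k + 2)) := by ring
      _ ≤ 9 * (3 ^ k * B ^ (k + 2)) := by gcongr; norm_num
      _ = _ := by ring

theorem norm_altSym_le {v u : ℂ} {B : ℝ} (hB : 1 ≤ B) (hv : ‖v‖ ≤ B) (hu : ‖u‖ ≤ 2 * B)
    {p r k : ℕ} (hp : p ≤ k + 1) (hr : r ≤ k + 1) :
    ‖altSym v u p r‖ ≤ 3 ^ (k + 1) * B ^ k := by
  have hB0 : 0 < B := by linarith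
  have key : ∀ p j : ℕ, p + j ≤ k + 1 → ‖v ^ p * homSym v u j‖ ≤ 3 ^ (k + 1) * B ^ k := by
    intro p j h
    have h1 := mul_norm_homSym_le hB hv hu j
    refine le_of_mul_le_mul_left ?_ hB0
    calc B * ‖v ^ p * homSym v u j‖ = ‖v‖ ^ p * (B * ‖homSym v u j‖) := by
          rw [norm_mul, norm_pow]; ring
      _ ≤ B ^ p * (3 ^ j * B ^ j) := by gcongr
      _ = 3 ^ j * B ^ (p + j) := by ring
      _ ≤ 3 ^ (k + 1) * B ^ (k + 1) := by
          have h2 : (3 : ℝ) ^ j ≤ 3 ^ (k + 1) := pow_le_pow_right₀ (by norm_num) (by lia)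
          have h3 : B ^ (p + j) ≤ B ^ (k + 1) := pow_le_pow_right₀ hB h
          gcongr
      _ = _ := by ring
  unfold altSym
  split_ifs with h
  · exact key _ _ (by lia)
  · rw [norm_neg]
    exact key _ _ (by lia)

theorem integrable_mahlerMeasure_cpow_mul_altSym {s : ℂ} {p r k : ℕ} (hp : p ≤ k + 1)
    (hr : r ≤ k + 1) (hs : ((k + 2 : ℕ) : ℝ) < s.re) :
    Integrable fun q : Fin 2 → ℝ => ((monPoly fun i => (q i : ℂ)).mahlerMeasure : ℂ) ^ (-s) *
      altSym (q 0 : ℂ) (q 1 : ℂ) p r := by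
  refine integrable_mahlerMeasure_cpow_mul volume (c := fun q : Fin 2 → ℝ => fun i => (q i : ℂ))
    (by fun_prop) norm_ofReal_vec (continuous_altSym (by fun_prop) (by fun_prop) p r)
    (B := 3 ^ (k + 1)) (k := k) (fun q => ?_) ?_
  · have h0 := norm_coeff_le_choose_mul_mahlerMeasure 0 (monPoly fun i => (q i : ℂ))
    have h1 := norm_coeff_le_choose_mul_mahlerMeasure 1 (monPoly fun i => (q i : ℂ))
    rw [natDegree_monPoly, coeff_monPoly, dif_pos (by norm_num)] at h0 h1
    refine norm_altSym_le (one_le_mahlerMeasure_monPoly _) ?_ ?_ hp hr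
    · simpa using h0
    · simpa using h1
  · simp only [Module.finrank_fintype_fun_eq_card, Fintype.card_fin]
    push_cast at hs ⊢
    linarith

/-- The moments of a real quadratic factor. -/
noncomputable def quadMoment (s : ℂ) (p r : ℕ) : ℂ :=
  ∫ q : Fin 2 → ℝ, ((monPoly fun i => (q i : ℂ)).mahlerMeasure : ℂ) ^ (-s) *
    altSym (q 0 : ℂ) (q 1 : ℂ) p r

theorem quadMoment_swap (s : ℂ) (p r : ℕ) : quadMoment s r p = -quadMoment s p r := by
  simp_rw [quadMoment, altSym_swap _ _ p r, mul_neg]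
  exact integral_neg _

theorem measurable_mahlerMeasure_quadratic :
    Measurable fun q : Fin 2 → ℝ => (monPoly fun i => (q i : ℂ)).mahlerMeasure :=
  measurable_mahlerMeasure_monPoly.comp (f := fun q : Fin 2 → ℝ => fun i => (q i : ℂ)) (by fun_prop)

theorem setIntegral_altSym_complex {T : ℝ} (hT : 1 ≤ T) (p r : ℕ) :
    ∫ q in {q : Fin 2 → ℝ | (monPoly fun i => (q i : ℂ)).mahlerMeasure ≤ T},
      altSym (q 0 : ℂ) (q 1 : ℂ) p r =
    (((if p % 2 = 0 ∧ r % 2 = 1 then 4 * T ^ (r + 1) / (((r : ℝ) - p) * (p + 1)) else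
      if p % 2 = 1 ∧ r % 2 = 0 then 4 * T ^ (p + 1) / (((r : ℝ) - p) * (r + 1)) else 0) : ℝ) : ℂ) := by
  rw [← integral_trapezoid_altSym hT, ← integral_complex_ofReal]
  refine integral_congr_ae (Filter.Eventually.of_forall fun q => ?_)
  exact (map_altSym Complex.ofRealHom _ _ _ _).symm

theorem quadMoment_even_odd {s : ℂ} {p r k : ℕ} (hp : p ≤ k + 1)
    (hr : r ≤ k + 1) (hs : ((k + 2 : ℕ) : ℝ) < s.re) (hp2 : p % 2 = 0) (hr2 : r % 2 = 1) :
    quadMoment s p r = 4 / (((r : ℂ) - p) * (p + 1)) * (s / (s - (r + 1 : ℕ))) := by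
  refine integral_cpow_mul_of_sublevel measurable_mahlerMeasure_quadratic
    (fun q => one_le_mahlerMeasure_monPoly _)
    (continuous_altSym (by fun_prop) (by fun_prop) p r).measurable (lt_of_le_of_lt ?_ hs)
    (integrable_mahlerMeasure_cpow_mul_altSym hp hr hs) fun T hT => ?_
  · exact_mod_cast (by lia : r + 1 ≤ k + 2)
  · rw [setIntegral_altSym_complex hT, if_pos ⟨hp2, hr2⟩]
    push_cast
    ring

theorem quadMoment_same_parity {s : ℂ} {p r k : ℕ} (hp : p ≤ k + 1)
    (hr : r ≤ k + 1) (hs : ((k + 2 : ℕ) : ℝ) < s.re) (h : p % 2 = r % 2) :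
    quadMoment s p r = 0 := by
  have := integral_cpow_mul_of_sublevel (A := 0) (κ := k + 2) measurable_mahlerMeasure_quadratic
    (fun q => one_le_mahlerMeasure_monPoly _)
    (continuous_altSym (by fun_prop) (by fun_prop) p r).measurable hs
    (integrable_mahlerMeasure_cpow_mul_altSym hp hr hs) fun T hT => by
      rw [setIntegral_altSym_complex hT, if_neg (by lia), if_neg (by lia)]
      simp
  rw [quadMoment, this, zero_mul]

end QuadraticMoments

/-! ### The real average as a wedge power and a determinant -/

section RealExterior

open Polynomial ExteriorAlgebra

/-- The determinant as a linear form on the exterior algebra. -/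
noncomputable def detForm (n : ℕ) : ExteriorAlgebra ℂ (Fin n → ℂ) →ₗ[ℂ] ℂ :=
  liftAlternating fun i =>
    if h : i = n then (Matrix.detRowAlternating (R := ℂ) (n := Fin n)).domDomCongr
      (finCongr h.symm) else 0

theorem detForm_ιMulti {n : ℕ} (v : Fin n → Fin n → ℂ) :
    detForm n (ιMulti ℂ n v) = (Matrix.of v).det := by
  rw [detForm, liftAlternating_apply_ιMulti, dif_pos rfl]
  rfl

/-- The vector of coefficients of the monomial `X ^ p`. -/
def monomialVec (n p : ℕ) : Fin n → ℂ := fun j => if (j : ℕ) = p then 1 else 0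

/-- The vector of powers of `x`. -/
def powerVec (n : ℕ) (x : ℂ) : Fin n → ℂ := fun j => x ^ (j : ℕ)

theorem sum_smul_monomialVec {n : ℕ} (c : ℕ → ℂ) :
    ∑ p ∈ Finset.range n, c p • monomialVec n p = fun j : Fin n => c j := by
  ext j
  simp [monomialVec]

theorem powerVec_eq_sum (n : ℕ) (x : ℂ) :
    powerVec n x = ∑ p ∈ Finset.range n, x ^ p • monomialVec n p :=
  (sum_smul_monomialVec fun p => x ^ p).symm

/-- The product that appears with a new node is the value, at the points `t_i`, of the linear factor
split off in the recursion. -/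
theorem det_vandermonde_cons {m : ℕ} (x : ℂ) (t : Fin m → ℂ) :
    (Matrix.vandermonde (Fin.cons x t : Fin (m + 1) → ℂ)).det =
      (∏ i, (t i - x)) * (Matrix.vandermonde t).det := by
  rw [Matrix.det_vandermonde, Matrix.det_vandermonde, Fin.prod_univ_succ, Fin.prod_Ioi_zero]
  simp [Fin.prod_Ioi_succ]

/-- Moving a vector past two others changes the sign twice, so elements of degree two are central.
-/
theorem commute_ι_mul_ι {R M : Type*} [CommRing R] [AddCommGroup M] [Module R M] (a b : M)
    (z : ExteriorAlgebra R M) : Commute (ι R a * ι R b) z := by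
  have hs : ∀ x y : M, ι R x * ι R y = -(ι R y * ι R x) := fun x y =>
    eq_neg_of_add_eq_zero_left (ι_add_mul_swap x y)
  induction z using ExteriorAlgebra.induction with
  | algebraMap r => exact (Algebra.commutes r _).symm
  | ι x =>
    rw [commute_iff_eq, mul_assoc, hs b x, mul_neg, ← mul_assoc, hs a x, neg_mul, neg_neg,
      mul_assoc]
  | mul u v hu hv => exact hu.mul_right hv
  | add u v hu hv => exact hu.add_right hv

/-- The quadratic element of the exterior algebra built from the moments of real quadratics. -/
noncomputable def pairElement (n : ℕ) (s : ℂ) : ExteriorAlgebra ℂ (Fin n → ℂ) :=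
  ∑ p ∈ Finset.range n, ∑ r ∈ Finset.range n,
    (quadMoment s p r / 2) • (ι ℂ (monomialVec n p) * ι ℂ (monomialVec n r))

theorem commute_pairElement (n : ℕ) (s : ℂ) (z : ExteriorAlgebra ℂ (Fin n → ℂ)) :
    Commute (pairElement n s) z :=
  Commute.sum_left _ _ _ fun _ _ => Commute.sum_left _ _ _ fun _ _ =>
    (commute_ι_mul_ι _ _ z).smul_left _

/-- A bilinear expression in two power vectors, antisymmetrised. -/
theorem two_mul_bilin_powerVec {n : ℕ} (α β : ℂ) (φ : ExteriorAlgebra ℂ (Fin n → ℂ) →ₗ[ℂ] ℂ) :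
    φ (ι ℂ (powerVec n α) * ι ℂ (powerVec n β)) =
      (β - α) * ∑ p ∈ Finset.range n, ∑ r ∈ Finset.range n,
        altSym (α * β) (-(α + β)) p r *
          (φ (ι ℂ (monomialVec n p) * ι ℂ (monomialVec n r)) / 2) := by
  set D : ℕ → ℕ → ℂ := fun p r => φ (ι ℂ (monomialVec n p) * ι ℂ (monomialVec n r)) with hD
  have hswap : ∀ p r, D r p = -D p r := by
    intro p r
    exact (congrArg φ (eq_neg_of_add_eq_zero_left (ι_add_mul_swap _ _))).trans (map_neg φ _)
  have h1 : φ (ι ℂ (powerVec n α) * ι ℂ (powerVec n β)) =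
      ∑ p ∈ Finset.range n, ∑ r ∈ Finset.range n, α ^ p * β ^ r * D p r := by
    rw [powerVec_eq_sum, powerVec_eq_sum, map_sum, map_sum, Finset.sum_mul_sum, map_sum]
    refine Finset.sum_congr rfl fun p _ => ?_
    rw [map_sum]
    refine Finset.sum_congr rfl fun r _ => ?_
    rw [map_smul, map_smul, smul_mul_smul_comm, map_smul, smul_eq_mul]
  have h2 : φ (ι ℂ (powerVec n α) * ι ℂ (powerVec n β)) =
      ∑ p ∈ Finset.range n, ∑ r ∈ Finset.range n, -(α ^ r * β ^ p * D p r) := by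
    rw [h1, Finset.sum_comm]
    refine Finset.sum_congr rfl fun p _ => Finset.sum_congr rfl fun r _ => ?_
    rw [hswap]
    ring
  have h3 : (β - α) * ∑ p ∈ Finset.range n, ∑ r ∈ Finset.range n,
        altSym (α * β) (-(α + β)) p r * (D p r / 2) =
      ((∑ p ∈ Finset.range n, ∑ r ∈ Finset.range n, α ^ p * β ^ r * D p r) +
        ∑ p ∈ Finset.range n, ∑ r ∈ Finset.range n, -(α ^ r * β ^ p * D p r)) / 2 := by
    rw [← Finset.sum_add_distrib, Finset.sum_div, Finset.mul_sum]
    refine Finset.sum_congr rfl fun p _ => ?_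
    rw [← Finset.sum_add_distrib, Finset.sum_div, Finset.mul_sum]
    refine Finset.sum_congr rfl fun r _ => ?_
    have := sub_mul_altSym α β p r
    linear_combination D p r / 2 * this
  rw [h3, ← h1, ← h2]
  ring

theorem exists_quadratic_roots (q : Fin 2 → ℝ) : ∃ z : ℂ × ℂ,
    (q 0 : ℂ) = z.1 * z.2 ∧ (q 1 : ℂ) = -(z.1 + z.2) := by
  rcases exists_real_quadratic_roots (q 1) (q 0) with ⟨a, b, h0, h1⟩ | ⟨_, a, h0, h1⟩
  · exact ⟨(a, b), by rw [h0]; push_cast; rfl, by rw [h1]; push_cast; rfl⟩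
  · exact ⟨(a, starRingEnd ℂ a), h0, h1⟩

/-- Equal roots would make the quadratic the square of a real linear polynomial, a null event. This
permits cancelling `β - α` below. -/
theorem ae_quadratic_roots_ne {α β : (Fin 2 → ℝ) → ℂ}
    (h0 : ∀ q, (q 0 : ℂ) = α q * β q) (h1 : ∀ q, (q 1 : ℂ) = -(α q + β q)) :
    ∀ᵐ q : Fin 2 → ℝ, α q ≠ β q := by
  filter_upwards [ae_not_sq_dvd (m := 1) (n := 1) (K := ℝ) volume one_ne_zero] with q hq h
  have hα : (((-(q 1) / 2 : ℝ)) : ℂ) = α q := by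
    push_cast
    rw [h1, h]
    ring
  refine hq (X - C (-(q 1) / 2)) (monic_X_sub_C _) (natDegree_X_sub_C _) ?_
  have h2 : q 0 = (-(q 1) / 2) * (-(q 1) / 2) := by
    have := h0 q
    rw [← h, ← hα] at this
    exact_mod_cast this
  have : monPoly (n := 1 + 1) q = (X - C (-(q 1) / 2)) * (X - C (-(q 1) / 2)) := by
    have h3 : q 1 = -(-(q 1) / 2 + -(q 1) / 2) := by ring
    generalize -(q 1) / 2 = c at *
    rw [monPoly, lowPoly, Fin.sum_univ_two, h2, h3]
    simp
    ring
  rw [this]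

/-- Induction on the number `k` of quadratics split off. Each one inserts the wedge of the power
vectors of its two roots; integrated against its weight, after division by `β - α`, this becomes
`pairElement`. The element `L` carries the degree `e` that remains, and `k!` collects the degrees of
the multiplication maps. -/
theorem vandermonde_mul_realAverage {s : ℂ} {n e : ℕ} (he : e < 2)
    (L : ExteriorAlgebra ℂ (Fin n → ℂ)) (hs : (n : ℝ) < s.re)
    (hbase : ∀ m (t : Fin m → ℂ), m + e = n → (Matrix.vandermonde t).det * realAverage s e t =
      detForm n (L * ιMulti ℂ m fun i => powerVec n (t i))) (k : ℕ) :
    ∀ m (t : Fin m → ℂ), m + (e + 2 * k) = n →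
      (k.factorial : ℂ) * (Matrix.vandermonde t).det * realAverage s (e + 2 * k) t =
        detForm n (pairElement n s ^ k * L * ιMulti ℂ m fun i => powerVec n (t i)) := by
  induction k with
  | zero =>
    intro m t hm
    simpa using hbase m t hm
  | succ k ih =>
    intro m t hm
    choose z h0 h1 using exists_quadratic_roots
    have hroots : ∀ q : Fin 2 → ℝ, monPoly (fun i => (q i : ℂ)) =
        (X - C (z q).1) * (X - C (z q).2) := fun q => monPoly_quadratic_eq (h0 q) (h1 q)
    have hstep := realAverage_add_two (n := e + 2 * k) t (s := s)
      (by rw [show e + 2 * k + 2 + m = n by lia]; exact hs)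
      (fun q => (z q).1) (fun q => (z q).2) hroots
    rw [show (e + 2 * k + 2) / 2 = k + 1 by lia] at hstep
    set W := ιMulti ℂ m fun i => powerVec n (t i) with hW
    set φ : ExteriorAlgebra ℂ (Fin n → ℂ) →ₗ[ℂ] ℂ :=
      detForm n ∘ₗ LinearMap.mulLeft ℂ (pairElement n s ^ k * L) ∘ₗ LinearMap.mulRight ℂ W with hφ
    have hφa : ∀ y, φ y = detForm n (pairElement n s ^ k * L * (y * W)) := fun y => rfl
    set D : ℕ → ℕ → ℂ := fun p r => φ (ι ℂ (monomialVec n p) * ι ℂ (monomialVec n r)) with hD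
    -- The two roots extend the Vandermonde determinant by `(β - α) ∏ q(t_i)`, and the wedge of
    -- their power vectors is `β - α` times a combination of `altSym`. Cancelling `β - α` leaves a
    -- function of the coefficients of `q`.
    have hpt : ∀ᵐ q : Fin 2 → ℝ, (k.factorial : ℂ) * (Matrix.vandermonde t).det *
        (((monPoly fun i => (q i : ℂ)).mahlerMeasure : ℂ) ^ (-s) *
          (∏ i, (monPoly fun i => (q i : ℂ)).eval (t i)) *
          realAverage s (e + 2 * k) (Fin.cons (z q).1 (Fin.cons (z q).2 t))) =
        ∑ p ∈ Finset.range n, ∑ r ∈ Finset.range n,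
          ((monPoly fun i => (q i : ℂ)).mahlerMeasure : ℂ) ^ (-s) *
            altSym (q 0 : ℂ) (q 1 : ℂ) p r * (D p r / 2) := by
      filter_upwards [ae_quadratic_roots_ne (α := fun q => (z q).1) (β := fun q => (z q).2) h0 h1]
        with q hq
      have e1 := ih (m + 2) (Fin.cons (z q).1 (Fin.cons (z q).2 t)) (by lia)
      have e2 : (ιMulti ℂ (m + 2) fun i =>
          powerVec n ((Fin.cons (z q).1 (Fin.cons (z q).2 t) : Fin (m + 2) → ℂ) i)) =
          ι ℂ (powerVec n (z q).1) * ι ℂ (powerVec n (z q).2) * W := by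
        rw [ιMulti_succ_apply, ιMulti_succ_apply, mul_assoc]
        rfl
      rw [e2, ← hφa, two_mul_bilin_powerVec, det_vandermonde_cons, det_vandermonde_cons,
        Fin.prod_univ_succ] at e1
      simp only [Fin.cons_zero, Fin.cons_succ] at e1
      have e3 : ∀ i, (monPoly fun i => (q i : ℂ)).eval (t i) =
          (t i - (z q).1) * (t i - (z q).2) := by
        intro i
        rw [hroots]
        simp
      simp_rw [e3, Finset.prod_mul_distrib, mul_assoc _ (altSym _ _ _ _) _, ← Finset.mul_sum]
      rw [h0, h1]
      refine mul_left_cancel₀ (sub_ne_zero.2 hq.symm) ?_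
      linear_combination ((monPoly fun i => (q i : ℂ)).mahlerMeasure : ℂ) ^ (-s) * e1
    have hint : ∀ p ∈ Finset.range n, ∀ r ∈ Finset.range n, Integrable fun q : Fin 2 → ℝ =>
        ((monPoly fun i => (q i : ℂ)).mahlerMeasure : ℂ) ^ (-s) *
          altSym (q 0 : ℂ) (q 1 : ℂ) p r * (D p r / 2) := by
      intro p hp r hr
      rw [Finset.mem_range] at hp hr
      -- Indices below `n` are at most `(n - 2) + 1`, so convergence needs exactly `Re s > n`; here
      -- `n ≥ 2`, as a quadratic is being split off.
      refine (integrable_mahlerMeasure_cpow_mul_altSym (k := n - 2) (by lia) (by lia)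
        ?_).mul_const _
      rw [show n - 2 + 2 = n by lia]
      exact hs
    calc ((k + 1).factorial : ℂ) * (Matrix.vandermonde t).det * realAverage s (e + 2 * k + 2) t
        = (k.factorial : ℂ) * (Matrix.vandermonde t).det *
          (((k + 1 : ℕ) : ℂ) * realAverage s (e + 2 * k + 2) t) := by
          rw [Nat.factorial_succ]
          push_cast
          ring
      _ = ∑ p ∈ Finset.range n, ∑ r ∈ Finset.range n, quadMoment s p r * (D p r / 2) := by
          rw [hstep, ← integral_const_mul, integral_congr_ae hpt,
            integral_finsetSum _ fun p hp => integrable_finsetSum _ fun r hr => hint p hp r hr]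
          refine Finset.sum_congr rfl fun p hp => ?_
          rw [integral_finsetSum _ fun r hr => hint p hp r hr]
          refine Finset.sum_congr rfl fun r hr => ?_
          rw [integral_mul_const]
          rfl
      _ = φ (pairElement n s) := by
          rw [pairElement, map_sum]
          refine Finset.sum_congr rfl fun p hp => ?_
          rw [map_sum]
          refine Finset.sum_congr rfl fun r hr => ?_
          rw [map_smul, smul_eq_mul, hD]
          ring
      _ = _ := by
          rw [hφa, ← mul_assoc, mul_assoc _ L, ← (commute_pairElement n s L).eq, ← mul_assoc,
            ← pow_succ]

theorem realAverage_zero (s : ℂ) {m : ℕ} (t : Fin m → ℂ) : realAverage s 0 t = 1 := by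
  have h : ∀ a : Fin 0 → ℂ, monPoly a = 1 := fun a => by simp [monPoly, lowPoly]
  simp [realAverage, h, measureReal_def, volume_pi]

theorem vandermonde_mul_realAverage_zero {s : ℂ} {n m : ℕ} (t : Fin m → ℂ) (hm : m + 0 = n) :
    (Matrix.vandermonde t).det * realAverage s 0 t =
      detForm n (1 * ιMulti ℂ m fun i => powerVec n (t i)) := by
  subst hm
  rw [realAverage_zero, mul_one, one_mul]
  exact (detForm_ιMulti _).symm

/-- The element of the exterior algebra built from the moments of real linear factors. -/
noncomputable def linearElement (n : ℕ) (s : ℂ) : ExteriorAlgebra ℂ (Fin n → ℂ) :=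
  ι ℂ fun j : Fin n => ∫ x : ℝ, ((max 1 |x| : ℝ) : ℂ) ^ (-s) * (x : ℂ) ^ (j : ℕ)

theorem realAverage_one (s : ℂ) {m : ℕ} (t : Fin m → ℂ) :
    realAverage s 1 t = ∫ x : ℝ, ((max 1 |x| : ℝ) : ℂ) ^ (-s) * ∏ i, (t i - x) := by
  rw [realAverage, ← integral_neg_eq_self (fun x : ℝ => ((max 1 |x| : ℝ) : ℂ) ^ (-s) *
    ∏ i, (t i - x)), ← (volume_preserving_funUnique (Fin 1) ℝ).integral_comp
      (MeasurableEquiv.funUnique (Fin 1) ℝ).measurableEmbedding]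
  have h : ∀ a : Fin 1 → ℝ, monPoly (fun i => (a i : ℂ)) = X - C (-(a 0) : ℂ) := fun a => by
    simp [monPoly, lowPoly]
  refine integral_congr_ae (Filter.Eventually.of_forall fun a => ?_)
  simp only [h, mahlerMeasure_X_sub_C, norm_neg, Complex.norm_real, abs_neg,
    MeasurableEquiv.funUnique_apply, Fin.default_eq_zero, Real.norm_eq_abs, eval_sub, eval_X,
    eval_C, Complex.ofReal_neg]

/-- The integrand is the determinant whose first row is the power vector of the real root `x`.
Linearity in that row lets the integral act on each monomial. -/
theorem vandermonde_mul_realAverage_one {s : ℂ} {n m : ℕ} (hs : (n : ℝ) < s.re) (t : Fin m → ℂ)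
    (hm : m + 1 = n) :
    (Matrix.vandermonde t).det * realAverage s 1 t =
      detForm n (linearElement n s * ιMulti ℂ m fun i => powerVec n (t i)) := by
  subst hm
  set φ : (Fin (m + 1) → ℂ) →ₗ[ℂ] ℂ := detForm (m + 1) ∘ₗ
    LinearMap.mulRight ℂ (ιMulti ℂ m fun i => powerVec (m + 1) (t i)) ∘ₗ ι ℂ with hφ
  have h1 : ∀ x : ℝ, φ (powerVec (m + 1) x) =
      (∏ i, (t i - (x : ℂ))) * (Matrix.vandermonde t).det := by
    intro x
    rw [← det_vandermonde_cons]
    have : φ (powerVec (m + 1) x) = detForm (m + 1) (ιMulti ℂ (m + 1)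
        fun i => powerVec (m + 1) ((Fin.cons (x : ℂ) t : Fin (m + 1) → ℂ) i)) := by
      rw [ιMulti_succ_apply]
      rfl
    rw [this, detForm_ιMulti]
    rfl
  have h2 : ∀ x : ℝ, (Matrix.vandermonde t).det * (((max 1 |x| : ℝ) : ℂ) ^ (-s) *
      ∏ i, (t i - (x : ℂ))) = ∑ p ∈ Finset.range (m + 1),
        ((max 1 |x| : ℝ) : ℂ) ^ (-s) * (x : ℂ) ^ p * φ (monomialVec (m + 1) p) := by
    intro x
    have h3 := h1 x
    rw [powerVec_eq_sum, map_sum] at h3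
    simp_rw [mul_assoc, ← Finset.mul_sum]
    simp only [map_smul, smul_eq_mul] at h3
    rw [h3]
    ring
  rw [realAverage_one, ← integral_const_mul]
  simp_rw [h2]
  rw [integral_finsetSum _ fun p hp => (integrable_max_cpow_mul_pow (lt_of_le_of_lt
    (by exact_mod_cast Finset.mem_range.1 hp) hs)).mul_const _]
  simp_rw [integral_mul_const]
  change _ = φ _
  rw [← sum_smul_monomialVec (n := m + 1) fun p =>
    ∫ x : ℝ, ((max 1 |x| : ℝ) : ℂ) ^ (-s) * (x : ℂ) ^ p, map_sum]
  simp only [map_smul, smul_eq_mul]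

/-- The product `ι (z 0) * ι (z 1) * ⋯ * ι (z (j - 1))`. -/
noncomputable def seqProd {M : Type*} [AddCommGroup M] [Module ℂ M] (z : ℕ → M) :
    ℕ → ExteriorAlgebra ℂ M
  | 0 => 1
  | j + 1 => seqProd z j * ι ℂ (z j)

theorem ιMulti_eq_seqProd {M : Type*} [AddCommGroup M] [Module ℂ M] (z : ℕ → M) (n : ℕ) :
    (ιMulti ℂ n fun i : Fin n => z i) = seqProd z n := by
  rw [ιMulti_apply]
  induction n with
  | zero => simp [seqProd]
  | succ n ih =>
    rw [List.ofFn_succ', List.concat_eq_append, List.prod_append, seqProd, ← ih]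
    simp

theorem Commute.add_pow_succ_of_sq_eq_zero {A : Type*} [Ring A] {y x : A} (h : Commute y x)
    (hx : x * x = 0) (m : ℕ) : (y + x) ^ (m + 1) = y ^ (m + 1) + (m + 1 : ℕ) • (y ^ m * x) := by
  induction m with
  | zero => simp
  | succ m ih =>
    have h1 : y ^ m * x * (y + x) = y ^ (m + 1) * x := by
      rw [mul_add, mul_assoc _ x x, hx, mul_zero, add_zero, mul_assoc, ← h.eq, ← mul_assoc,
        ← pow_succ]
    rw [pow_succ, ih, add_mul, smul_mul_assoc, h1, mul_add, ← pow_succ, add_assoc,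
      succ_nsmul' _ (m + 1)]

/-- The summands commute and have square zero, so the `k`-th power is `k!` times the product of all.
The vanishing of the next power is carried along because it removes the other binomial term in the
induction. -/
theorem pow_sum_ι_mul_ι {M : Type*} [AddCommGroup M] [Module ℂ M] (z : ℕ → M) (k : ℕ) :
    (∑ b ∈ Finset.range k, ι ℂ (z (2 * b)) * ι ℂ (z (2 * b + 1))) ^ (k + 1) = 0 ∧
    (∑ b ∈ Finset.range k, ι ℂ (z (2 * b)) * ι ℂ (z (2 * b + 1))) ^ k =
      k.factorial • seqProd z (2 * k) := by
  induction k with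
  | zero => simp [seqProd]
  | succ k ih =>
    have hsq : ι ℂ (z (2 * k)) * ι ℂ (z (2 * k + 1)) * (ι ℂ (z (2 * k)) * ι ℂ (z (2 * k + 1))) =
        0 := by
      rw [← mul_assoc, (commute_ι_mul_ι _ _ (ι ℂ (z (2 * k)))).eq, ← mul_assoc, ι_sq_zero,
        zero_mul, zero_mul]
    have hc := (commute_ι_mul_ι (R := ℂ) (z (2 * k)) (z (2 * k + 1))
      (∑ b ∈ Finset.range k, ι ℂ (z (2 * b)) * ι ℂ (z (2 * b + 1)))).symm
    rw [Finset.sum_range_succ]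
    constructor
    · rw [Commute.add_pow_succ_of_sq_eq_zero hc hsq, pow_succ, ih.1]
      simp
    · rw [Commute.add_pow_succ_of_sq_eq_zero hc hsq, ih.1, ih.2, zero_add, smul_mul_assoc,
        smul_smul, ← Nat.factorial_succ]
      congr 1
      rw [show 2 * (k + 1) = 2 * k + 1 + 1 by ring, seqProd, seqProd, mul_assoc]

theorem sum_range_odd {A : Type*} [AddCommMonoid A] {e : ℕ} (he : e < 2) (k : ℕ) (F : ℕ → A) :
    ∑ r ∈ Finset.range (e + 2 * k), (if r % 2 = 1 then F r else 0) =
      ∑ b ∈ Finset.range k, F (2 * b + 1) := by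
  induction k with
  | zero => interval_cases e <;> simp
  | succ k ih =>
    rw [show e + 2 * (k + 1) = e + 2 * k + 1 + 1 by ring, Finset.sum_range_succ,
      Finset.sum_range_succ, ih, Finset.sum_range_succ]
    interval_cases e
    · rw [if_neg (by lia), if_pos (by lia), add_zero]
      simp
    · rw [if_pos (by lia), if_neg (by lia), add_zero, add_comm 1 (2 * k)]

/-- The vector of moments of quadratics against a fixed exponent, on the even monomials. -/
noncomputable def momentVec (n : ℕ) (s : ℂ) (r : ℕ) : Fin n → ℂ :=
  fun j => if (j : ℕ) % 2 = 0 then quadMoment s j r else 0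

/-- Moments of equal parity vanish, and antisymmetry of both the moments and the wedge identifies
the terms `(p, r)` and `(r, p)`. Collecting by the odd index leaves `k` decomposable terms. -/
theorem pairElement_eq {s : ℂ} {e k : ℕ} (he : e < 2)
    (hs : ((e + 2 * k : ℕ) : ℝ) < s.re) :
    pairElement (e + 2 * k) s = ∑ b ∈ Finset.range k,
      ι ℂ (momentVec (e + 2 * k) s (2 * b + 1)) *
        ι ℂ (monomialVec (e + 2 * k) (2 * b + 1)) := by
  set n := e + 2 * k with hn
  set f : ℕ → ℕ → ExteriorAlgebra ℂ (Fin n → ℂ) := fun p r =>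
    (quadMoment s p r) • (ι ℂ (monomialVec n p) * ι ℂ (monomialVec n r)) with hf
  have hsymm : ∀ p r, f r p = f p r := by
    intro p r
    simp only [hf]
    rw [quadMoment_swap, eq_neg_of_add_eq_zero_left (ι_add_mul_swap (monomialVec n r) _),
      neg_smul_neg]
  set g : ℕ → ℕ → ExteriorAlgebra ℂ (Fin n → ℂ) := fun p r =>
    if r % 2 = 1 then (if p % 2 = 0 then f p r else 0) else 0 with hg
  have hfg : ∀ p ∈ Finset.range n, ∀ r ∈ Finset.range n, f p r = g p r + g r p := by
    intro p hp r hr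
    rw [Finset.mem_range] at hp hr
    simp only [hg]
    have hz : p % 2 = r % 2 → f p r = 0 := by
      intro h
      simp only [hf]
      rcases eq_or_ne p r with rfl | hpr
      · rw [ι_sq_zero, smul_zero]
      · rw [quadMoment_same_parity (k := n - 2) (by lia) (by lia)
          (by rwa [show n - 2 + 2 = n by lia]) h, zero_smul]
    rcases Nat.mod_two_eq_zero_or_one p with h1 | h1 <;>
      rcases Nat.mod_two_eq_zero_or_one r with h2 | h2
    · simp [h1, h2, hz (h1.trans h2.symm)]
    · simp [h1, h2]
    · simp [h1, h2, hsymm]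
    · simp [h1, h2, hz (h1.trans h2.symm)]
  have h1 : pairElement n s = ∑ p ∈ Finset.range n, ∑ r ∈ Finset.range n, g p r := by
    have h2 : (2 : ℂ) • pairElement n s = ∑ p ∈ Finset.range n, ∑ r ∈ Finset.range n, f p r := by
      rw [pairElement, Finset.smul_sum]
      refine Finset.sum_congr rfl fun p _ => ?_
      rw [Finset.smul_sum]
      refine Finset.sum_congr rfl fun r _ => ?_
      rw [smul_smul, mul_div_cancel₀ _ two_ne_zero]
    have h3 : ∑ p ∈ Finset.range n, ∑ r ∈ Finset.range n, f p r =
        (2 : ℂ) • ∑ p ∈ Finset.range n, ∑ r ∈ Finset.range n, g p r := by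
      rw [Finset.sum_congr rfl fun p hp => Finset.sum_congr rfl fun r hr => hfg p hp r hr]
      simp_rw [Finset.sum_add_distrib]
      rw [two_smul]
      congr 1
      exact Finset.sum_comm
    exact smul_right_injective _ (two_ne_zero (α := ℂ)) (h2.trans h3)
  have h2 : ∀ r, momentVec n s r = ∑ p ∈ Finset.range n,
      (if p % 2 = 0 then quadMoment s p r else 0) • monomialVec n p := fun r =>
    (sum_smul_monomialVec fun p => if p % 2 = 0 then quadMoment s p r else 0).symm
  rw [h1, Finset.sum_comm, ← sum_range_odd he k fun r =>
    ι ℂ (momentVec n s r) * ι ℂ (monomialVec n r)]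
  refine Finset.sum_congr rfl fun r _ => ?_
  split_ifs with hr
  · rw [h2, map_sum, Finset.sum_mul]
    refine Finset.sum_congr rfl fun p _ => ?_
    simp only [hg, hr, if_true, hf]
    split_ifs <;> simp
  · simp [hg, hr]

/-- The rows of the matrix whose determinant is the real average. -/
noncomputable def momentRow (s : ℂ) (n k i : ℕ) : Fin n → ℂ :=
  if i % 2 = 1 then monomialVec n i else
    if i < 2 * k then momentVec n s (i + 1) else
      fun j : Fin n => ∫ x : ℝ, ((max 1 |x| : ℝ) : ℂ) ^ (-s) * (x : ℂ) ^ (j : ℕ)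

theorem pairElement_pow {s : ℂ} {e k : ℕ} (he : e < 2) (hs : ((e + 2 * k : ℕ) : ℝ) < s.re) :
    pairElement (e + 2 * k) s ^ k =
      k.factorial • seqProd (momentRow s (e + 2 * k) k) (2 * k) := by
  rw [← (pow_sum_ι_mul_ι _ k).2, pairElement_eq he hs]
  congr 1
  refine Finset.sum_congr rfl fun b hb => ?_
  rw [Finset.mem_range] at hb
  simp only [momentRow]
  rw [if_neg (by lia), if_pos (by lia), if_pos (by lia)]

/-- With no auxiliary points the Vandermonde determinant is `1`, and the `k!` on both sides cancel.
For `e = 1` the vector of linear moments becomes the last row. -/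
theorem realAverage_eq_det {s : ℂ} {e k : ℕ} (he : e < 2) (hs : ((e + 2 * k : ℕ) : ℝ) < s.re) :
    realAverage s (e + 2 * k) (Fin.elim0 : Fin 0 → ℂ) =
      (Matrix.of fun i : Fin (e + 2 * k) => momentRow s (e + 2 * k) k i).det := by
  have hΩ := pairElement_pow he hs
  rw [← detForm_ιMulti, ιMulti_eq_seqProd (momentRow s (e + 2 * k) k)]
  have hk : (k.factorial : ℂ) ≠ 0 := by exact_mod_cast k.factorial_ne_zero
  refine mul_left_cancel₀ hk ?_
  obtain rfl | rfl : e = 0 ∨ e = 1 := by lia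
  · have := vandermonde_mul_realAverage (by norm_num) 1 hs
      (fun m t hm => vandermonde_mul_realAverage_zero t hm) k 0 Fin.elim0 (by lia)
    rw [ιMulti_zero_apply, mul_one, mul_one, hΩ, map_nsmul, nsmul_eq_mul] at this
    simp only [Matrix.det_fin_zero, mul_one] at this
    rw [this]
    congr 3
    exact (zero_add _).symm
  · have := vandermonde_mul_realAverage (by norm_num) (linearElement (1 + 2 * k) s) hs
      (fun m t hm => vandermonde_mul_realAverage_one hs t hm) k 0 Fin.elim0 (by lia)
    rw [ιMulti_zero_apply, mul_one, hΩ, smul_mul_assoc, map_nsmul, nsmul_eq_mul] at this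
    simp only [Matrix.det_fin_zero, mul_one] at this
    have hl : linearElement (1 + 2 * k) s = ι ℂ (momentRow s (1 + 2 * k) k (2 * k)) := by
      simp only [momentRow]
      rw [if_neg (by lia), if_neg (by lia)]
      rfl
    have hl' : seqProd (momentRow s (1 + 2 * k) k) (1 + 2 * k) =
        seqProd (momentRow s (1 + 2 * k) k) (2 * k + 1) := by rw [add_comm]
    rw [this, hl, hl', seqProd]

/-- The even and the odd indices below `e + 2 * k`. -/
def evenOddEquiv {e : ℕ} (he : e < 2) (k : ℕ) : Fin (e + k) ⊕ Fin k ≃ Fin (e + 2 * k) where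
  toFun := Sum.elim (fun a => ⟨2 * a, by lia⟩) (fun b => ⟨2 * b + 1, by lia⟩)
  invFun i := if h : (i : ℕ) % 2 = 0 then Sum.inl ⟨i / 2, by lia⟩ else
    Sum.inr ⟨i / 2, by lia⟩
  left_inv := by
    rintro (a | b)
    · simp
    · have h : ¬ (2 * (b : ℕ) + 1) % 2 = 0 := by lia
      refine (dif_neg h).trans ?_
      congr 2
      simp only [Sum.elim_inr]
      lia
  right_inv i := by
    dsimp only
    split_ifs with h
    · ext
      simp only [Sum.elim_inl]
      lia
    · ext
      simp only [Sum.elim_inr]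
      lia

/-- Sorting indices by parity gives a block matrix: odd rows are basis vectors, and even rows vanish
in odd columns, by definition for `momentVec` and by oddness for the linear moments. Only the even
block contributes. -/
theorem realAverage_eq_det_even {s : ℂ} {e k : ℕ} (he : e < 2)
    (hs : ((e + 2 * k : ℕ) : ℝ) < s.re) :
    realAverage s (e + 2 * k) (Fin.elim0 : Fin 0 → ℂ) =
      (Matrix.of fun b a : Fin (e + k) => if (b : ℕ) < k then
        4 / (((2 * b + 1 : ℕ) : ℂ) - (2 * a : ℕ)) / ((2 * a : ℕ) + 1) *
          (s / (s - (2 * b + 1 + 1 : ℕ))) else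
        2 / ((2 * a : ℕ) + 1) * (s / (s - (2 * a + 1 : ℕ)))).det := by
  rw [realAverage_eq_det he hs, ← Matrix.det_submatrix_equiv_self (evenOddEquiv he k)]
  set P := Matrix.of fun b a : Fin (e + k) => if (b : ℕ) < k then
        4 / (((2 * b + 1 : ℕ) : ℂ) - (2 * a : ℕ)) / ((2 * a : ℕ) + 1) *
          (s / (s - (2 * b + 1 + 1 : ℕ))) else
        2 / ((2 * a : ℕ) + 1) * (s / (s - (2 * a + 1 : ℕ))) with hP
  have : (Matrix.of fun i : Fin (e + 2 * k) => momentRow s (e + 2 * k) k i).submatrix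
      (evenOddEquiv he k) (evenOddEquiv he k) = Matrix.fromBlocks P 0 0 1 := by
    ext (b | b) (a | a)
    · simp only [evenOddEquiv, Matrix.submatrix_apply, Equiv.coe_fn_mk, Sum.elim_inl,
        Matrix.of_apply, momentRow, Matrix.fromBlocks_apply₁₁, hP]
      rw [if_neg (by lia)]
      split_ifs with h1 h2 h2
      · rw [momentVec, if_pos (by lia), quadMoment_even_odd (k := e + 2 * k - 2) (by lia) (by lia)
          (by rwa [show e + 2 * k - 2 + 2 = e + 2 * k by lia]) (by lia) (by lia), div_div]
      · lia
      · lia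
      · refine (integral_max_cpow_mul_pow (p := 2 * (a : ℕ))
          (lt_of_le_of_lt (Nat.cast_le.2 (by lia)) hs)).trans ?_
        rw [pow_mul]
        norm_num
    · simp only [evenOddEquiv, Matrix.submatrix_apply, Equiv.coe_fn_mk, Sum.elim_inl,
        Sum.elim_inr, Matrix.of_apply, momentRow, Matrix.fromBlocks_apply₁₂, Matrix.zero_apply]
      rw [if_neg (by lia)]
      split_ifs with h1
      · rw [momentVec, if_neg (by lia)]
      · refine (integral_max_cpow_mul_pow (p := 2 * (a : ℕ) + 1)
          (lt_of_le_of_lt (Nat.cast_le.2 (by lia)) hs)).trans ?_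
        rw [pow_succ, pow_mul]
        norm_num
    · simp only [evenOddEquiv, Matrix.submatrix_apply, Equiv.coe_fn_mk, Sum.elim_inl,
        Sum.elim_inr, Matrix.of_apply, momentRow, Matrix.fromBlocks_apply₂₁, Matrix.zero_apply]
      rw [if_pos (by lia), monomialVec, if_neg (by simp only; lia)]
    · simp only [evenOddEquiv, Matrix.submatrix_apply, Equiv.coe_fn_mk,
        Sum.elim_inr, Matrix.of_apply, momentRow, Matrix.fromBlocks_apply₂₂, Matrix.one_apply]
      rw [if_pos (by lia), monomialVec]
      refine if_congr ?_ rfl rfl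
      rw [Fin.ext_iff]
      simp only
      lia
  rw [this, Matrix.det_fromBlocks_zero₁₂, Matrix.det_one, mul_one]

end RealExterior

/-! ### Cauchy determinants and the constant of the real formula -/

section CauchyDeterminant

/-- The Cauchy determinant of two sequences. -/
noncomputable def cauchyDet (x y : ℕ → ℂ) (n : ℕ) : ℂ :=
  (Matrix.of fun i j : Fin n => (y i - x j)⁻¹).det

/-- Take the Schur complement of the last diagonal entry: the remaining block is the smaller Cauchy
matrix with its rows and columns rescaled. -/
theorem cauchyDet_succ {x y : ℕ → ℂ} {n : ℕ} (h : ∀ i ≤ n, ∀ j ≤ n, y i - x j ≠ 0) :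
    cauchyDet x y (n + 1) = (y n - x n)⁻¹ * ((∏ i ∈ Finset.range n, (y n - y i) / (y i - x n)) *
      (∏ j ∈ Finset.range n, (x j - x n) / (y n - x j))) * cauchyDet x y n := by
  rw [cauchyDet, ← Matrix.det_submatrix_equiv_self (finSumFinEquiv (m := n) (n := 1))]
  have hu : IsUnit (Matrix.of fun _ _ : Fin 1 => (y n - x n)⁻¹).det := by
    simpa using h n le_rfl n le_rfl
  let := Matrix.invertibleOfIsUnitDet _ hu
  have hblock : (Matrix.of fun i j : Fin (n + 1) => (y i - x j)⁻¹).submatrix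
      (finSumFinEquiv (m := n) (n := 1)) (finSumFinEquiv (m := n) (n := 1)) =
      Matrix.fromBlocks (Matrix.of fun i j : Fin n => (y i - x j)⁻¹)
        (Matrix.of fun (i : Fin n) (_ : Fin 1) => (y i - x n)⁻¹)
        (Matrix.of fun (_ : Fin 1) (j : Fin n) => (y n - x j)⁻¹)
        (Matrix.of fun _ _ : Fin 1 => (y n - x n)⁻¹) := by
    ext (i | i) (j | j) <;> simp
  have hinv : (⅟ (Matrix.of fun _ _ : Fin 1 => (y n - x n)⁻¹)) =
      Matrix.of fun _ _ : Fin 1 => (y n - x n) := by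
    refine invOf_eq_right_inv ?_
    ext i j
    rw [Subsingleton.elim i j]
    simp [Matrix.mul_apply, inv_mul_cancel₀ (h n le_rfl n le_rfl)]
  have hschur : (Matrix.of fun i j : Fin n => (y i - x j)⁻¹) -
      (Matrix.of fun (i : Fin n) (_ : Fin 1) => (y i - x n)⁻¹) *
        (Matrix.of fun _ _ : Fin 1 => (y n - x n)) *
        (Matrix.of fun (_ : Fin 1) (j : Fin n) => (y n - x j)⁻¹) =
      Matrix.of fun i j : Fin n => ((y n - y i) / (y i - x n)) *
        (Matrix.of (fun i j : Fin n => ((x j - x n) / (y n - x j)) *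
          (Matrix.of (fun i j : Fin n => (y i - x j)⁻¹)) i j)) i j := by
    ext i j
    simp only [Matrix.sub_apply, Matrix.of_apply, Matrix.mul_apply, Finset.univ_unique,
      Finset.sum_singleton]
    have h1 := h i i.2.le j j.2.le
    have h2 := h i i.2.le n le_rfl
    have h3 := h n le_rfl j j.2.le
    field_simp
    ring
  rw [hblock, Matrix.det_fromBlocks₂₂, hinv, hschur, Matrix.det_mul_column, Matrix.det_mul_row,
    Finset.prod_range, Finset.prod_range, cauchyDet]
  simp
  ring

/-- With `j = k - i` the factors are `2j / (2j - 1)`; shifting the denominators to `2j + 1` costs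
`2k + 1`. This product and the next one are the scalings in a Cauchy step. -/
theorem prod_two_mul_div (k : ℕ) :
    ∏ i ∈ Finset.range k, (2 * (k : ℚ) - 2 * i) / (2 * k - 1 - 2 * i) =
      (2 * k + 1) * ∏ m ∈ Finset.Icc 1 k, (2 * (m : ℚ)) / (2 * m + 1) := by
  induction k with
  | zero => simp
  | succ k ih =>
    rw [Finset.prod_range_succ', Finset.prod_Icc_succ_top (by lia)]
    have : ∀ i ∈ Finset.range k, (2 * ((k + 1 : ℕ) : ℚ) - 2 * (i + 1 : ℕ)) /
        (2 * ((k + 1 : ℕ) : ℚ) - 1 - 2 * (i + 1 : ℕ)) =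
          (2 * (k : ℚ) - 2 * i) / (2 * k - 1 - 2 * i) := by
      intro i _
      push_cast
      congr 1 <;> ring
    rw [Finset.prod_congr rfl this, ih]
    have h1 : 2 * (k : ℚ) + 1 ≠ 0 := by positivity
    push_cast
    rw [show 2 * ((k : ℚ) + 1) - 1 - 2 * 0 = 2 * k + 1 by ring,
      show 2 * ((k : ℚ) + 1) + 1 = 2 * k + 3 by ring]
    field_simp
    ring

theorem prod_two_mul_div' (k : ℕ) :
    ∏ i ∈ Finset.range k, (2 * (k : ℚ) - 2 * i) / (2 * k + 1 - 2 * i) =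
      ∏ m ∈ Finset.Icc 1 k, (2 * (m : ℚ)) / (2 * m + 1) := by
  induction k with
  | zero => simp
  | succ k ih =>
    rw [Finset.prod_range_succ', Finset.prod_Icc_succ_top (by lia)]
    have : ∀ i ∈ Finset.range k, (2 * ((k + 1 : ℕ) : ℚ) - 2 * (i + 1 : ℕ)) /
        (2 * ((k + 1 : ℕ) : ℚ) + 1 - 2 * (i + 1 : ℕ)) =
          (2 * (k : ℚ) - 2 * i) / (2 * k + 1 - 2 * i) := by
      intro i _
      push_cast
      congr 1 <;> ring
    rw [Finset.prod_congr rfl this, ih]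
    simp

theorem mahlerConst_two_mul_add_one (k : ℕ) :
    mahlerConst (2 * k + 1) =
      2 * (∏ m ∈ Finset.Icc 1 k, (2 * (m : ℚ)) / (2 * m + 1)) * mahlerConst (2 * k) := by
  -- The range may be extended to `k`, since the factor at `m = k` has exponent zero.
  have h1 : ∏ m ∈ Finset.Icc 1 ((2 * k - 1) / 2), ((2 * (m : ℚ)) / (2 * m + 1)) ^ (2 * k - 2 * m) =
      ∏ m ∈ Finset.Icc 1 k, ((2 * (m : ℚ)) / (2 * m + 1)) ^ (2 * k - 2 * m) := by
    refine Finset.prod_subset (Finset.Icc_subset_Icc_right (by lia)) fun m hm hm' => ?_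
    rw [Finset.mem_Icc] at hm hm'
    rw [show 2 * k - 2 * m = 0 by lia, pow_zero]
  rw [mahlerConst, mahlerConst, h1, show (2 * k + 1 - 1) / 2 = k by lia, pow_succ]
  have h2 : ∏ m ∈ Finset.Icc 1 k, ((2 * (m : ℚ)) / (2 * m + 1)) ^ (2 * k + 1 - 2 * m) =
      (∏ m ∈ Finset.Icc 1 k, (2 * (m : ℚ)) / (2 * m + 1)) *
        ∏ m ∈ Finset.Icc 1 k, ((2 * (m : ℚ)) / (2 * m + 1)) ^ (2 * k - 2 * m) := by
    rw [← Finset.prod_mul_distrib]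
    refine Finset.prod_congr rfl fun m hm => ?_
    rw [Finset.mem_Icc] at hm
    rw [← pow_succ']
    congr 1
    lia
  rw [h2]
  ring

theorem mahlerConst_two_mul_add_two (k : ℕ) :
    mahlerConst (2 * (k + 1)) =
      4 * (∏ m ∈ Finset.Icc 1 k, (2 * (m : ℚ)) / (2 * m + 1)) ^ 2 * mahlerConst (2 * k) := by
  have h1 : ∏ m ∈ Finset.Icc 1 ((2 * k - 1) / 2), ((2 * (m : ℚ)) / (2 * m + 1)) ^ (2 * k - 2 * m) =
      ∏ m ∈ Finset.Icc 1 k, ((2 * (m : ℚ)) / (2 * m + 1)) ^ (2 * k - 2 * m) := by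
    refine Finset.prod_subset (Finset.Icc_subset_Icc_right (by lia)) fun m hm hm' => ?_
    rw [Finset.mem_Icc] at hm hm'
    rw [show 2 * k - 2 * m = 0 by lia, pow_zero]
  rw [mahlerConst, mahlerConst, h1, show (2 * (k + 1) - 1) / 2 = k by lia]
  have h2 : ∏ m ∈ Finset.Icc 1 k, ((2 * (m : ℚ)) / (2 * m + 1)) ^ (2 * (k + 1) - 2 * m) =
      (∏ m ∈ Finset.Icc 1 k, (2 * (m : ℚ)) / (2 * m + 1)) ^ 2 *
        ∏ m ∈ Finset.Icc 1 k, ((2 * (m : ℚ)) / (2 * m + 1)) ^ (2 * k - 2 * m) := by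
    rw [← Finset.prod_pow, ← Finset.prod_mul_distrib]
    refine Finset.prod_congr rfl fun m hm => ?_
    rw [Finset.mem_Icc] at hm
    rw [← pow_add]
    congr 1
    lia
  rw [h2, show 2 * (k + 1) = 2 * k + 2 by ring, pow_add]
  ring

theorem cauchyDet_congr {x y y' : ℕ → ℂ} {n : ℕ} (h : ∀ i < n, y i = y' i) :
    cauchyDet x y n = cauchyDet x y' n := by
  unfold cauchyDet
  congr 2
  ext i j
  rw [h i i.2]

theorem det_scaled_cauchy (w v x y : ℕ → ℂ) (n : ℕ) :
    (Matrix.of fun b a : Fin n => w b * (v a * (y b - x a)⁻¹)).det =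
      (∏ b ∈ Finset.range n, w b) * ((∏ a ∈ Finset.range n, v a) * cauchyDet x y n) := by
  rw [Finset.prod_range, Finset.prod_range, cauchyDet, ← Matrix.det_mul_row, ← Matrix.det_mul_column]
  rfl

theorem odd_sub_even_ne_zero (i j : ℕ) : (2 * (i : ℂ) + 1) - 2 * j ≠ 0 := by
  intro h
  have : ((2 * i + 1 : ℕ) : ℂ) = ((2 * j : ℕ) : ℂ) := by
    push_cast
    linear_combination h
  have := Nat.cast_injective this
  lia

/-- Both sides satisfy the same recursion in `k`: by the two product lemmas, a Cauchy step
multiplies by the square of the product of `2m / (2m + 1)`, up to `4` and the factor `2k + 1`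
cancelled by the column weight. -/
theorem cauchyDet_mul_eq_mahlerConst (k : ℕ) :
    (4 : ℂ) ^ k * ((∏ a ∈ Finset.range k, (2 * (a : ℂ) + 1)⁻¹) *
      cauchyDet (fun a => 2 * a) (fun b => 2 * b + 1) k) = (mahlerConst (2 * k) : ℂ) := by
  induction k with
  | zero => simp [cauchyDet, mahlerConst]
  | succ k ih =>
    rw [mahlerConst_two_mul_add_two, cauchyDet_succ (fun i _ j _ => odd_sub_even_ne_zero i j),
      Finset.prod_range_succ, ← Finset.prod_mul_distrib]
    have h1 := congrArg (Rat.cast : ℚ → ℂ) (prod_two_mul_div k)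
    have h2 := congrArg (Rat.cast : ℚ → ℂ) (prod_two_mul_div' k)
    push_cast at h1 h2 ⊢
    have h3 : ∏ i ∈ Finset.range k, (2 * (k : ℂ) + 1 - (2 * i + 1)) / (2 * i + 1 - 2 * k) *
        ((2 * (i : ℂ) - 2 * k) / (2 * k + 1 - 2 * i)) =
        (∏ i ∈ Finset.range k, (2 * (k : ℂ) - 2 * i) / (2 * k - 1 - 2 * i)) *
          ∏ i ∈ Finset.range k, (2 * (k : ℂ) - 2 * i) / (2 * k + 1 - 2 * i) := by
      rw [← Finset.prod_mul_distrib]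
      refine Finset.prod_congr rfl fun i _ => ?_
      rw [show (2 * (i : ℂ) + 1 - 2 * k) = -(2 * k - 1 - 2 * i) by ring,
        show (2 * (i : ℂ) - 2 * k) = -(2 * k - 2 * i) by ring,
        show (2 * (k : ℂ) + 1 - (2 * i + 1)) = 2 * k - 2 * i by ring, div_neg, neg_div, neg_mul_neg]
    have h4 : 2 * (k : ℂ) + 1 ≠ 0 := by exact_mod_cast Nat.succ_ne_zero (2 * k)
    rw [h3, h1, h2, ← ih, show (2 * (k : ℂ) + 1 - 2 * k) = 1 by ring]
    field_simp
    ring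

/-- In the last row of the odd case `s - (2a + 1) = (s - 1) - 2a`, so the linear moments extend the
Cauchy matrix by the node `s - 1`. -/
theorem realAverage_eq_cauchyDet {s : ℂ} {e k : ℕ} (he : e < 2)
    (hs : ((e + 2 * k : ℕ) : ℝ) < s.re) :
    realAverage s (e + 2 * k) (Fin.elim0 : Fin 0 → ℂ) =
      (∏ b ∈ Finset.range (e + k), if b < k then 4 * s / (s - (2 * b + 2)) else 2 * s) *
        ((∏ a ∈ Finset.range (e + k), (2 * (a : ℂ) + 1)⁻¹) *
          cauchyDet (fun a => 2 * a) (fun b => if b < k then 2 * b + 1 else s - 1) (e + k)) := by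
  rw [realAverage_eq_det_even he hs, ← det_scaled_cauchy]
  congr 2
  ext b a
  push_cast
  split_ifs
  · rw [show (s - (2 * (b : ℂ) + 1 + 1)) = s - (2 * b + 2) by ring, div_eq_mul_inv, div_eq_mul_inv,
      div_eq_mul_inv, div_eq_mul_inv]
    ring
  · rw [show s - (2 * (a : ℂ) + 1) = s - 1 - 2 * a by ring, div_eq_mul_inv, div_eq_mul_inv]
    ring

theorem sub_ne_zero_of_lt_re {s : ℂ} {N m : ℕ} (hs : (N : ℝ) < s.re) (hm : m ≤ N) :
    s - m ≠ 0 := by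
  intro h
  rw [sub_eq_zero.1 h, Complex.natCast_re] at hs
  exact absurd (Nat.cast_lt.1 hs) (by lia)

theorem realAverage_even {s : ℂ} {k : ℕ} (hs : ((2 * k : ℕ) : ℝ) < s.re) :
    realAverage s (2 * k) (Fin.elim0 : Fin 0 → ℂ) =
      mahlerConst (2 * k) * ∏ b ∈ Finset.range k, s / (s - (2 * b + 2)) := by
  have := realAverage_eq_cauchyDet (e := 0) (k := k) (by norm_num) (by rwa [zero_add])
  simp only [zero_add] at this
  rw [this, cauchyDet_congr (y' := fun b => 2 * b + 1) (fun i hi => if_pos hi),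
    ← cauchyDet_mul_eq_mahlerConst]
  have h : ∏ b ∈ Finset.range k, (if b < k then 4 * s / (s - (2 * b + 2)) else 2 * s) =
      4 ^ k * ∏ b ∈ Finset.range k, s / (s - (2 * b + 2)) := by
    rw [← Finset.card_range k, ← Finset.prod_const, Finset.card_range, ← Finset.prod_mul_distrib]
    refine Finset.prod_congr rfl fun b hb => ?_
    rw [if_pos (Finset.mem_range.1 hb), mul_div_assoc]
  rw [h]
  ring

theorem realAverage_odd {s : ℂ} {k : ℕ} (hs : ((2 * k + 1 : ℕ) : ℝ) < s.re) :
    realAverage s (2 * k + 1) (Fin.elim0 : Fin 0 → ℂ) =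
      mahlerConst (2 * k + 1) * ∏ b ∈ Finset.range (k + 1), s / (s - (2 * b + 1)) := by
  have := realAverage_eq_cauchyDet (e := 1) (k := k) (by norm_num) (by rwa [add_comm])
  have hcomm : realAverage s (2 * k + 1) (Fin.elim0 : Fin 0 → ℂ) =
      realAverage s (1 + 2 * k) (Fin.elim0 : Fin 0 → ℂ) := by rw [add_comm]
  have hodd : ∀ i ≤ k, s - 1 - 2 * (i : ℂ) ≠ 0 := by
    intro i hi
    have := sub_ne_zero_of_lt_re (m := 2 * i + 1) hs (by lia)
    push_cast at this
    rwa [sub_sub, add_comm]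
  have heven : ∀ i < k, s - (2 * (i : ℂ) + 2) ≠ 0 := by
    intro i hi
    have := sub_ne_zero_of_lt_re (m := 2 * i + 2) hs (by lia)
    push_cast at this
    exact this
  rw [hcomm, this, add_comm 1 k, cauchyDet_succ, cauchyDet_congr (y' := fun b => 2 * b + 1)
    (fun i hi => if_pos hi), mahlerConst_two_mul_add_one, Finset.prod_range_succ,
    Finset.prod_range_succ, Finset.prod_range_succ _ k]
  · push_cast
    rw [← cauchyDet_mul_eq_mahlerConst, if_neg (lt_irrefl k)]
    have h1 := congrArg (Rat.cast : ℚ → ℂ) (prod_two_mul_div k)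
    push_cast at h1
    -- The node `s - 1` gives numerators `s - (2i + 2)`, which cancel the even poles of the row
    -- weights, and denominators `s - (2i + 1)`, the odd poles of the answer.
    have h2 : (∏ b ∈ Finset.range k, if b < k then 4 * s / (s - (2 * b + 2)) else 2 * s) *
        ((∏ i ∈ Finset.range k, (s - 1 - if i < k then 2 * (i : ℂ) + 1 else s - 1) /
          ((if i < k then 2 * (i : ℂ) + 1 else s - 1) - 2 * k)) *
        ∏ j ∈ Finset.range k, (2 * (j : ℂ) - 2 * k) / (s - 1 - 2 * j)) =
        4 ^ k * (∏ i ∈ Finset.range k, (2 * (k : ℂ) - 2 * i) / (2 * k - 1 - 2 * i)) *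
          ∏ b ∈ Finset.range k, s / (s - (2 * b + 1)) := by
      rw [← Finset.card_range k, ← Finset.prod_const, Finset.card_range,
        ← Finset.prod_mul_distrib, ← Finset.prod_mul_distrib, ← Finset.prod_mul_distrib,
        ← Finset.prod_mul_distrib]
      refine Finset.prod_congr rfl fun i hi => ?_
      rw [Finset.mem_range] at hi
      rw [if_pos hi, if_pos hi, show (2 * (i : ℂ) + 1 - 2 * k) = -(2 * k - 1 - 2 * i) by ring,
        show (2 * (i : ℂ) - 2 * k) = -(2 * k - 2 * i) by ring,
        show s - 1 - (2 * (i : ℂ) + 1) = s - (2 * i + 2) by ring,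
        show s - (2 * (i : ℂ) + 1) = s - 1 - 2 * i by ring, div_neg, neg_div, mul_assoc,
        neg_mul_neg]
      have h3 := heven i hi
      have h4 := hodd i hi.le
      have h5 : 2 * (k : ℂ) - 1 - 2 * i ≠ 0 := fun h => odd_sub_even_ne_zero i k (by
        linear_combination -h)
      generalize s - (2 * (i : ℂ) + 2) = w at *
      field_simp
    have h3 : 2 * (k : ℂ) + 1 ≠ 0 := by exact_mod_cast Nat.succ_ne_zero (2 * k)
    rw [h1] at h2
    simp only [lt_irrefl, if_false]
    rw [show s - (2 * (k : ℂ) + 1) = s - 1 - 2 * k by ring]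
    generalize (∏ b ∈ Finset.range k, if b < k then 4 * s / (s - (2 * b + 2)) else 2 * s) = A at *
    generalize (∏ i ∈ Finset.range k, (s - 1 - if i < k then 2 * (i : ℂ) + 1 else s - 1) /
          ((if i < k then 2 * (i : ℂ) + 1 else s - 1) - 2 * k)) = B at *
    generalize (∏ j ∈ Finset.range k, (2 * (j : ℂ) - 2 * k) / (s - 1 - 2 * j)) = D at *
    generalize cauchyDet (fun a => 2 * a) (fun b => 2 * b + 1) k = K
    generalize (∏ a ∈ Finset.range k, (2 * (a : ℂ) + 1)⁻¹) = V
    generalize (∏ b ∈ Finset.range k, s / (s - (2 * (b : ℂ) + 1))) = U at *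
    generalize (∏ m ∈ Finset.Icc 1 k, 2 * (m : ℂ) / (2 * m + 1)) = ρ at *
    have h6 : (2 * (k : ℂ) + 1) * (2 * (k : ℂ) + 1)⁻¹ = 1 := mul_inv_cancel₀ h3
    rw [div_eq_mul_inv]
    linear_combination (2 * s * V * (2 * (k : ℂ) + 1)⁻¹ * (s - 1 - 2 * k)⁻¹ * K) * h2 +
      (2 * s * V * (s - 1 - 2 * k)⁻¹ * K * 4 ^ k * ρ * U) * h6
  · intro i hi j hj
    split_ifs
    · exact odd_sub_even_ne_zero i j
    · exact hodd j hj

theorem realAverage_eval {s : ℂ} {N : ℕ} (hN : 1 ≤ N) (hs : (N : ℝ) < s.re) :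
    realAverage s N (Fin.elim0 : Fin 0 → ℂ) = mahlerConst N *
      ∏ m ∈ Finset.range ((N - 1) / 2 + 1), s / (s - ((N : ℂ) - 2 * m)) := by
  -- The poles were found in increasing order, whereas the statement lists them downwards from `N`.
  rw [← Finset.prod_range_reflect]
  obtain ⟨k, rfl | rfl⟩ := Nat.even_or_odd' N
  · rw [realAverage_even hs, show (2 * k - 1) / 2 + 1 = k by lia]
    congr 1
    refine Finset.prod_congr rfl fun b hb => ?_
    rw [Finset.mem_range] at hb
    have : ((k - 1 - b : ℕ) : ℂ) = k - 1 - b := by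
      rw [Nat.cast_sub (by lia), Nat.cast_sub (by lia)]
      simp
    rw [this]
    push_cast
    congr 2
    ring
  · rw [realAverage_odd hs, show (2 * k + 1 - 1) / 2 + 1 = k + 1 by lia]
    congr 1
    refine Finset.prod_congr rfl fun b hb => ?_
    rw [Finset.mem_range] at hb
    have : ((k + 1 - 1 - b : ℕ) : ℂ) = k - b := by
      rw [Nat.add_sub_cancel, Nat.cast_sub (by lia)]
    rw [this]
    push_cast
    congr 2
    ring

end CauchyDeterminant

/-! ### The complex average as an iterated diagonal form -/

section ComplexExterior

open Polynomial ExteriorAlgebra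

theorem complexAverage_zero (s : ℂ) {m : ℕ} (t : Fin m → ℂ) : complexAverage s 0 t = 1 := by
  have h : ∀ a : Fin 0 → ℂ, monPoly a = 1 := fun a => by simp [monPoly, lowPoly]
  simp [complexAverage, h, measureReal_def, volume_pi]

/-- The iterated contraction of a sesquilinear form with weights `c` on monomials. -/
noncomputable def iterForm (n : ℕ) (c : ℕ → ℂ) :
    ℕ → ExteriorAlgebra ℂ (Fin n → ℂ) → ExteriorAlgebra ℂ (Fin n → ℂ) → ℂ
  | 0, ω, η => detForm n ω * starRingEnd ℂ (detForm n η)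
  | k + 1, ω, η => ∑ p ∈ Finset.range n,
      c p * iterForm n c k (ι ℂ (monomialVec n p) * ω) (ι ℂ (monomialVec n p) * η)

/-- The form is linear in the first argument and conjugate linear in the second; this is the case
needed to expand a power vector in both. -/
theorem iterForm_sum {n : ℕ} (c : ℕ → ℂ) (k : ℕ) {I : Type*} (S : Finset I) (a : I → ℂ) :
    ∀ u : I → ExteriorAlgebra ℂ (Fin n → ℂ),
    iterForm n c k (∑ p ∈ S, a p • u p) (∑ q ∈ S, a q • u q) =
      ∑ p ∈ S, ∑ q ∈ S, (a p * starRingEnd ℂ (a q)) * iterForm n c k (u p) (u q) := by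
  induction k with
  | zero =>
    intro u
    simp only [iterForm, map_sum, map_smul, smul_eq_mul, map_mul, Finset.sum_mul_sum]
    exact Finset.sum_congr rfl fun p _ => Finset.sum_congr rfl fun q _ => by ring
  | succ k ih =>
    intro u
    simp only [iterForm, Finset.mul_sum, mul_smul_comm, ih]
    rw [Finset.sum_comm]
    refine Finset.sum_congr rfl fun p _ => ?_
    rw [Finset.sum_comm]
    exact Finset.sum_congr rfl fun q _ => Finset.sum_congr rfl fun r _ => by ring

/-- The moments of a complex linear factor. -/
noncomputable def diskMoment (s : ℂ) (p : ℕ) : ℂ :=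
  (Real.pi : ℂ) / (p + 1) * (s / (s - (p + 1 : ℕ)))

/-- Splitting off a root `z` inserts its power vector in both arguments. Expanding gives `z^p` times
conjugate powers `z^q`, and orthogonality of the moments leaves one diagonal contraction per root.
-/
theorem normSq_vandermonde_mul_complexAverage {s : ℂ} {n : ℕ} (hs : (n : ℝ) < s.re) (k : ℕ) :
    ∀ m (t : Fin m → ℂ), m + k = n →
      (k.factorial : ℂ) * ((Matrix.vandermonde t).det *
        starRingEnd ℂ (Matrix.vandermonde t).det) * complexAverage s k t =
        iterForm n (diskMoment s) k (ιMulti ℂ m fun i => powerVec n (t i))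
          (ιMulti ℂ m fun i => powerVec n (t i)) := by
  induction k with
  | zero =>
    rintro m t rfl
    rw [complexAverage_zero, iterForm]
    have := detForm_ιMulti (n := m) fun i => powerVec m (t i)
    rw [add_zero, this]
    simp
    rfl
  | succ k ih =>
    intro m t hm
    have hstep := complexAverage_succ (n := k) t (s := s)
      (by rw [show k + 1 + m = n by lia]; exact hs)
    set W := ιMulti ℂ m fun i => powerVec n (t i) with hW
    set D : ℕ → ℕ → ℂ := fun p q => iterForm n (diskMoment s) k (ι ℂ (monomialVec n p) * W)
      (ι ℂ (monomialVec n q) * W) with hD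
    have hpt : ∀ z : ℂ, (k.factorial : ℂ) * ((Matrix.vandermonde t).det *
        starRingEnd ℂ (Matrix.vandermonde t).det) *
        (((max 1 ‖z‖ : ℝ) : ℂ) ^ (-(2 * s)) * (∏ i, (‖t i - z‖ ^ 2 : ℂ)) *
          complexAverage s k (Fin.cons z t : Fin (m + 1) → ℂ)) =
        ∑ p ∈ Finset.range n, ∑ q ∈ Finset.range n,
          ((max 1 ‖z‖ : ℝ) : ℂ) ^ (-(2 * s)) * (z ^ p * starRingEnd ℂ z ^ q) * D p q := by
      intro z
      have e1 := ih (m + 1) (Fin.cons z t) (by lia)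
      have e2 : (ιMulti ℂ (m + 1) fun i => powerVec n ((Fin.cons z t : Fin (m + 1) → ℂ) i)) =
          ∑ p ∈ Finset.range n, z ^ p • (ι ℂ (monomialVec n p) * W) := by
        rw [ιMulti_succ_apply]
        change ι ℂ (powerVec n z) * W = _
        rw [powerVec_eq_sum, map_sum, Finset.sum_mul]
        refine Finset.sum_congr rfl fun p _ => ?_
        rw [map_smul, smul_mul_assoc]
      have e3 : (∏ i, (‖t i - z‖ ^ 2 : ℂ)) =
          (∏ i, (t i - z)) * starRingEnd ℂ (∏ i, (t i - z)) := by
        rw [map_prod, ← Finset.prod_mul_distrib]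
        exact Finset.prod_congr rfl fun i _ => (Complex.mul_conj' _).symm
      rw [e2, iterForm_sum, det_vandermonde_cons, map_mul] at e1
      simp_rw [mul_assoc _ (_ * _) (D _ _), ← Finset.mul_sum]
      rw [e3]
      simp only [map_pow] at e1
      linear_combination ((max 1 ‖z‖ : ℝ) : ℂ) ^ (-(2 * s)) * e1
    have hlt : ∀ p ∈ Finset.range n, ((p + 1 : ℕ) : ℝ) < s.re := fun p hp =>
      lt_of_le_of_lt (Nat.cast_le.2 (Finset.mem_range.1 hp)) hs
    have hint : ∀ p ∈ Finset.range n, ∀ q ∈ Finset.range n, Integrable fun z : ℂ =>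
        ((max 1 ‖z‖ : ℝ) : ℂ) ^ (-(2 * s)) * (z ^ p * starRingEnd ℂ z ^ q) * D p q := by
      intro p hp q hq
      refine (integrable_max_cpow_mul_pow_mul_conj ?_).mul_const _
      have h1 := hlt p hp
      have h2 := hlt q hq
      rw [show (2 * s).re = 2 * s.re by simp]
      push_cast at h1 h2 ⊢
      linarith
    calc ((k + 1).factorial : ℂ) * ((Matrix.vandermonde t).det *
          starRingEnd ℂ (Matrix.vandermonde t).det) * complexAverage s (k + 1) t
        = (k.factorial : ℂ) * ((Matrix.vandermonde t).det *
          starRingEnd ℂ (Matrix.vandermonde t).det) *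
          (((k + 1 : ℕ) : ℂ) * complexAverage s (k + 1) t) := by
          rw [Nat.factorial_succ]
          push_cast
          ring
      _ = ∑ p ∈ Finset.range n, diskMoment s p * D p p := by
          rw [hstep, ← integral_const_mul]
          simp_rw [hpt]
          rw [integral_finsetSum _ fun p hp => integrable_finsetSum _ fun q hq => hint p hp q hq]
          refine Finset.sum_congr rfl fun p hp => ?_
          rw [integral_finsetSum _ fun q hq => hint p hp q hq]
          rw [Finset.sum_congr rfl fun q hq => by
            rw [integral_mul_const, integral_max_norm_cpow_mul_pow (hlt p hp) (hlt q hq)]]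
          simp only [ite_mul, zero_mul]
          rw [Finset.sum_ite_eq, if_pos hp]
          rfl
      _ = _ := rfl

theorem ιMulti_snoc {M : Type*} [AddCommGroup M] [Module ℂ M] {k : ℕ} (v : Fin k → M) (x : M) :
    ιMulti ℂ (k + 1) (Fin.snoc v x : Fin (k + 1) → M) = ιMulti ℂ k v * ι ℂ x := by
  rw [ιMulti_apply, ιMulti_apply, List.ofFn_succ', List.concat_eq_append, List.prod_append]
  simp

theorem iterForm_eq_sum {n : ℕ} (c : ℕ → ℂ) (k : ℕ) : ∀ ω : ExteriorAlgebra ℂ (Fin n → ℂ),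
    iterForm n c k ω ω = ∑ P : Fin k → Fin n, (∏ i, c (P i)) *
      (detForm n (ιMulti ℂ k (fun i => monomialVec n (P i)) * ω) *
        starRingEnd ℂ (detForm n (ιMulti ℂ k (fun i => monomialVec n (P i)) * ω))) := by
  induction k with
  | zero => intro ω; simp [iterForm]
  | succ k ih =>
    intro ω
    -- The outermost contraction puts its vector next to `ω`, so the new index is appended at the
    -- end.
    rw [iterForm, Finset.sum_range, ← (Fin.snocEquiv fun _ : Fin (k + 1) => Fin n).sum_comp,
      Fintype.sum_prod_type]
    refine Finset.sum_congr rfl fun p _ => ?_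
    rw [ih, Finset.mul_sum]
    refine Finset.sum_congr rfl fun P _ => ?_
    have h1 : (fun i => monomialVec n ((Fin.snoc P p : Fin (k + 1) → Fin n) i)) =
        (Fin.snoc (fun i => monomialVec n (P i)) (monomialVec n p) : Fin (k + 1) → _) := by
      ext i j
      refine Fin.lastCases ?_ (fun i => ?_) i <;> simp
    simp only [Fin.snocEquiv_apply]
    rw [h1, ιMulti_snoc, Fin.prod_univ_castSucc, mul_assoc _ (ι ℂ _) ω]
    simp only [Fin.snoc_castSucc, Fin.snoc_last]
    ring

/-- The determinant of basis vectors vanishes if an index repeats, and is a sign for each of the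
`n!` permutations; the squared modulus removes the sign. -/
theorem iterForm_one {n : ℕ} (c : ℕ → ℂ) :
    iterForm n c n 1 1 = (n.factorial : ℂ) * ∏ p ∈ Finset.range n, c p := by
  rw [iterForm_eq_sum]
  simp only [mul_one, detForm_ιMulti]
  rw [← Fintype.sum_of_injective (fun σ : Equiv.Perm (Fin n) => (σ : Fin n → Fin n))
    DFunLike.coe_injective (fun _ => ∏ p ∈ Finset.range n, c p)]
  · simp [Fintype.card_perm]
  · intro P hP
    have hP' : ¬ Function.Injective P := fun h => hP
      ⟨Equiv.ofBijective P (Finite.injective_iff_bijective.1 h), rfl⟩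
    simp only [Function.Injective, not_forall] at hP'
    obtain ⟨i, j, hij, hne⟩ := hP'
    rw [Matrix.det_zero_of_row_eq hne]
    · simp
    · ext l
      simp [hij]
  · intro σ
    have h1 : (Matrix.of fun i => monomialVec n (σ i)) =
        (1 : Matrix (Fin n) (Fin n) ℂ).submatrix σ id := by
      ext i j
      simp only [Matrix.of_apply, monomialVec, Matrix.submatrix_apply, Matrix.one_apply, id]
      refine if_congr ?_ rfl rfl
      rw [Fin.ext_iff, eq_comm]
    rw [h1, Matrix.det_permute, Matrix.det_one, mul_one, Finset.prod_range,
      Equiv.prod_comp σ fun i => c i]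
    rcases Int.units_eq_one_or (Equiv.Perm.sign σ) with h | h <;> simp [h]

theorem complexAverage_eval {s : ℂ} {N : ℕ} (hs : (N : ℝ) < s.re) :
    complexAverage s N (Fin.elim0 : Fin 0 → ℂ) =
      (Real.pi : ℂ) ^ N / (N.factorial : ℂ) * ∏ n ∈ Finset.Icc 1 N, s / (s - (n : ℂ)) := by
  have h := normSq_vandermonde_mul_complexAverage hs N 0 Fin.elim0 (zero_add N)
  have hk : (N.factorial : ℂ) ≠ 0 := by exact_mod_cast N.factorial_ne_zero
  rw [ιMulti_zero_apply, iterForm_one, Matrix.det_fin_zero, map_one, mul_one, mul_one] at h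
  have h1 : ∏ n ∈ Finset.Icc 1 N, s / (s - (n : ℂ)) =
      ∏ p ∈ Finset.range N, s / (s - ((p + 1 : ℕ) : ℂ)) := by
    rw [Finset.range_eq_Ico, Finset.prod_Ico_add' (fun n : ℕ => s / (s - (n : ℂ))) 0 N 1]
    rfl
  have h2 : (N.factorial : ℂ) = ∏ p ∈ Finset.range N, ((p : ℂ) + 1) := by
    rw [← Finset.prod_range_add_one_eq_factorial]
    push_cast
    rfl
  rw [mul_left_cancel₀ hk h, h1, h2]
  simp only [diskMoment, Finset.prod_mul_distrib]
  rw [Finset.prod_div_distrib, Finset.prod_const, Finset.card_range]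

end ComplexExterior

/-! ### Rational continuation and the moment functions -/

section MomentFunctions

open Polynomial

/-- Analyticity of `F` follows from the formula, since the half plane is open and the denominator
has no zero in it. -/
theorem continuesToRational_of_eval {F : ℂ → ℂ} {σ : ℝ} {R : RatFunc ℂ}
    (h : ∀ s : ℂ, σ < s.re → R.denom.eval s ≠ 0 ∧ F s = R.eval (RingHom.id ℂ) s) :
    ContinuesToRational F σ R := by
  refine ⟨fun s hs => ?_, h⟩
  have han : AnalyticAt ℂ (fun z => R.num.eval z / R.denom.eval z) s :=
    (R.num.differentiable.analyticAt s).div (R.denom.differentiable.analyticAt s) (h s hs).1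
  refine han.congr ?_
  filter_upwards [(isOpen_lt continuous_const Complex.continuous_re).mem_nhds hs] with z hz
  rw [(h z hz).2]
  rfl

theorem ratFunc_denom_eval_mul_ne_zero {A B : RatFunc ℂ} {s : ℂ} (hA : A.denom.eval s ≠ 0)
    (hB : B.denom.eval s ≠ 0) : (A * B).denom.eval s ≠ 0 := fun h =>
  mul_ne_zero hA hB (by
    rw [← eval_mul]
    exact eval_eq_zero_of_dvd_of_eval_eq_zero (RatFunc.denom_mul_dvd A B) h)

theorem ratFunc_X_div_X_sub_C {b s : ℂ} (h : s - b ≠ 0) :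
    ((RatFunc.X / (RatFunc.X - RatFunc.C b) : RatFunc ℂ)).denom.eval s ≠ 0 ∧
      s / (s - b) = (RatFunc.X / (RatFunc.X - RatFunc.C b) : RatFunc ℂ).eval (RingHom.id ℂ) s := by
  have hq : (X - C b : ℂ[X]) ≠ 0 := X_sub_C_ne_zero b
  have heq : (RatFunc.X / (RatFunc.X - RatFunc.C b) : RatFunc ℂ) =
      algebraMap ℂ[X] (RatFunc ℂ) X / algebraMap ℂ[X] (RatFunc ℂ) (X - C b) := by
    rw [map_sub, RatFunc.algebraMap_X, RatFunc.algebraMap_C]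
  have hd : ((RatFunc.X / (RatFunc.X - RatFunc.C b) : RatFunc ℂ)).denom.eval s ≠ 0 := by
    intro h0
    have := eval_eq_zero_of_dvd_of_eval_eq_zero
      (RatFunc.denom_div_dvd (X : ℂ[X]) (X - C b)) (heq ▸ h0)
    simp only [eval_sub, eval_X, eval_C] at this
    exact h this
  refine ⟨hd, ?_⟩
  have h1 : (RatFunc.X / (RatFunc.X - RatFunc.C b) : RatFunc ℂ) *
      algebraMap ℂ[X] (RatFunc ℂ) (X - C b) = RatFunc.X := by
    rw [heq, div_mul_cancel₀, RatFunc.algebraMap_X]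
    exact (map_ne_zero_iff _ (RatFunc.algebraMap_injective ℂ)).2 hq
  have h2 := congrArg (RatFunc.eval (RingHom.id ℂ) s) h1
  rw [RatFunc.eval_mul _ _ (by simpa using hd) (by rw [RatFunc.denom_algebraMap]; simp),
    RatFunc.eval_algebraMap,
    RatFunc.eval_X] at h2
  rw [div_eq_iff h]
  simpa using h2.symm

/-- Evaluation of rational functions is multiplicative away from poles, so nonvanishing of the
denominators is carried through the induction. -/
theorem ratFunc_eval_const_mul_prod {ι : Type*} (S : Finset ι) (c : ℂ) {b : ι → ℂ} {s : ℂ}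
    (h : ∀ i ∈ S, s - b i ≠ 0) :
    (RatFunc.C c * ∏ i ∈ S, RatFunc.X / (RatFunc.X - RatFunc.C (b i))).denom.eval s ≠ 0 ∧
      c * ∏ i ∈ S, s / (s - b i) =
        (RatFunc.C c * ∏ i ∈ S, RatFunc.X / (RatFunc.X - RatFunc.C (b i))).eval
          (RingHom.id ℂ) s := by
  classical
  induction S using Finset.induction_on with
  | empty => simp
  | insert i S hi ih =>
    obtain ⟨h1, h2⟩ := ih fun j hj => h j (Finset.mem_insert_of_mem hj)
    obtain ⟨h3, h4⟩ := ratFunc_X_div_X_sub_C (h i (Finset.mem_insert_self i S))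
    rw [Finset.prod_insert hi, Finset.prod_insert hi, mul_left_comm, mul_left_comm c, h2, h4]
    exact ⟨ratFunc_denom_eval_mul_ne_zero h3 h1,
      (RatFunc.eval_mul _ _ (by simpa using h3) (by simpa using h1)).symm⟩

/-- The statement lists coefficients from the top degree down, the proof from the constant term up;
the reversal preserves Lebesgue measure. -/
theorem monicPoly_eq_monPoly_rev {N : ℕ} (b : Fin N → ℂ) :
    monicPoly b = monPoly fun i => b (Fin.rev i) := by
  have h : ∀ i : Fin N, N - ((Fin.rev i : ℕ) + 1) = i := fun i => by
    rw [Fin.val_rev]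
    lia
  rw [monicPoly, monPoly, lowPoly]
  refine congrArg _ ((Equiv.sum_comp Fin.revPerm
    (fun i : Fin N => C (b i) * X ^ (N - ((i : ℕ) + 1)))).symm.trans
      (Finset.sum_congr rfl fun i _ => ?_))
  rw [Fin.revPerm_apply, h]

theorem rev_eq_piCongrLeft (K : Type*) [MeasurableSpace K] (N : ℕ) :
    (fun (b : Fin N → K) i => b (Fin.rev i)) =
      MeasurableEquiv.piCongrLeft (fun _ : Fin N => K) Fin.revPerm := by
  funext b i
  have h := MeasurableEquiv.piCongrLeft_apply_apply (β := fun _ : Fin N => K) Fin.revPerm b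
    (Fin.rev i)
  rw [Fin.revPerm_apply, Fin.rev_rev] at h
  exact h.symm

theorem measurePreserving_rev (K : Type*) [MeasureSpace K] [SigmaFinite (volume : Measure K)]
    (N : ℕ) : MeasurePreserving (fun (b : Fin N → K) i => b (Fin.rev i)) volume volume :=
  rev_eq_piCongrLeft K N ▸ volume_measurePreserving_piCongrLeft (fun _ : Fin N => K) Fin.revPerm

theorem measurableEmbedding_rev (K : Type*) [MeasurableSpace K] (N : ℕ) :
    MeasurableEmbedding (fun (b : Fin N → K) i => b (Fin.rev i)) :=
  rev_eq_piCongrLeft K N ▸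
    (MeasurableEquiv.piCongrLeft (fun _ : Fin N => K) Fin.revPerm).measurableEmbedding

theorem realMomentIntegrand_eq (N : ℕ) (s : ℂ) (b : Fin N → ℝ) :
    realMomentIntegrand mahlerMeasure N s b = (fun a : Fin N → ℝ =>
      ((monPoly fun i => (a i : ℂ)).mahlerMeasure : ℂ) ^ (-s) *
        ∏ i : Fin 0, (monPoly fun i => (a i : ℂ)).eval (Fin.elim0 i)) fun i => b (Fin.rev i) := by
  simp only [realMomentIntegrand, monicRestriction, monicPoly_eq_monPoly_rev,
    Finset.univ_eq_empty, Finset.prod_empty, mul_one]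

theorem complexMomentIntegrand_eq (N : ℕ) (s : ℂ) (b : Fin N → ℂ) :
    complexMomentIntegrand mahlerMeasure N s b = (fun a : Fin N → ℂ =>
      ((monPoly a).mahlerMeasure : ℂ) ^ (-(2 * s)) *
        ∏ i : Fin 0, (‖(monPoly a).eval (Fin.elim0 i)‖ ^ 2 : ℂ)) fun i => b (Fin.rev i) := by
  simp only [complexMomentIntegrand, monicRestriction, monicPoly_eq_monPoly_rev,
    Finset.univ_eq_empty, Finset.prod_empty, mul_one]

theorem integrable_realMomentIntegrand {N : ℕ} {s : ℂ} (hs : (N : ℝ) < s.re) :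
    Integrable (realMomentIntegrand mahlerMeasure N s) := by
  rw [funext (realMomentIntegrand_eq N s)]
  exact ((measurePreserving_rev ℝ N).integrable_comp_emb (measurableEmbedding_rev ℝ N)).2
    (integrable_realAverage Fin.elim0 hs)

theorem integrable_complexMomentIntegrand {N : ℕ} {s : ℂ} (hs : (N : ℝ) < s.re) :
    Integrable (complexMomentIntegrand mahlerMeasure N s) := by
  rw [funext (complexMomentIntegrand_eq N s)]
  exact ((measurePreserving_rev ℂ N).integrable_comp_emb (measurableEmbedding_rev ℂ N)).2
    (integrable_complexAverage Fin.elim0 hs)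

theorem realMoment_eq_realAverage (N : ℕ) (s : ℂ) :
    realMoment mahlerMeasure N s = realAverage s N (Fin.elim0 : Fin 0 → ℂ) := by
  rw [realMoment, funext (realMomentIntegrand_eq N s)]
  exact (measurePreserving_rev ℝ N).integral_comp (measurableEmbedding_rev ℝ N) _

theorem complexMoment_eq_complexAverage (N : ℕ) (s : ℂ) :
    complexMoment mahlerMeasure N s = complexAverage s N (Fin.elim0 : Fin 0 → ℂ) := by
  rw [complexMoment, funext (complexMomentIntegrand_eq N s)]
  exact (measurePreserving_rev ℂ N).integral_comp (measurableEmbedding_rev ℂ N) _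

end MomentFunctions

theorem theorem7 (N : ℕ) (hN : 1 ≤ N) :
    -- the complex moment function
    (ContinuesToRational (complexMoment Polynomial.mahlerMeasure N) N
        (RatFunc.C ((Real.pi : ℂ) ^ N / (N.factorial : ℂ)) *
          ∏ n ∈ Finset.Icc 1 N, RatFunc.X / (RatFunc.X - RatFunc.C (n : ℂ))) ∧
      ∀ s : ℂ, (N : ℝ) < s.re →
        Integrable (complexMomentIntegrand Polynomial.mahlerMeasure N s) ∧
        complexMoment Polynomial.mahlerMeasure N s =
          (Real.pi : ℂ) ^ N / (N.factorial : ℂ) *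
            ∏ n ∈ Finset.Icc 1 N, s / (s - (n : ℂ))) ∧
    -- the real moment function
    (ContinuesToRational (realMoment Polynomial.mahlerMeasure N) N
        (RatFunc.C (mahlerConst N : ℂ) *
          ∏ m ∈ Finset.range ((N - 1) / 2 + 1),
            RatFunc.X / (RatFunc.X - RatFunc.C ((N : ℂ) - 2 * (m : ℂ)))) ∧
      ∀ s : ℂ, (N : ℝ) < s.re →
        Integrable (realMomentIntegrand Polynomial.mahlerMeasure N s) ∧
        realMoment Polynomial.mahlerMeasure N s =
          (mahlerConst N : ℂ) *
            ∏ m ∈ Finset.range ((N - 1) / 2 + 1), s / (s - ((N : ℂ) - 2 * (m : ℂ)))) := by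
  have hC : ∀ s : ℂ, (N : ℝ) < s.re →
      Integrable (complexMomentIntegrand Polynomial.mahlerMeasure N s) ∧
      complexMoment Polynomial.mahlerMeasure N s =
        (Real.pi : ℂ) ^ N / (N.factorial : ℂ) *
          ∏ n ∈ Finset.Icc 1 N, s / (s - (n : ℂ)) := fun s hs =>
    ⟨integrable_complexMomentIntegrand hs, by
      rw [complexMoment_eq_complexAverage, complexAverage_eval hs]⟩
  have hR : ∀ s : ℂ, (N : ℝ) < s.re →
      Integrable (realMomentIntegrand Polynomial.mahlerMeasure N s) ∧
      realMoment Polynomial.mahlerMeasure N s =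
        (mahlerConst N : ℂ) *
          ∏ m ∈ Finset.range ((N - 1) / 2 + 1), s / (s - ((N : ℂ) - 2 * (m : ℂ))) := fun s hs =>
    ⟨integrable_realMomentIntegrand hs, by
      rw [realMoment_eq_realAverage, realAverage_eval hN hs]⟩
  refine ⟨⟨continuesToRational_of_eval fun s hs => ?_, hC⟩,
    ⟨continuesToRational_of_eval fun s hs => ?_, hR⟩⟩
  · rw [(hC s hs).2]
    refine ratFunc_eval_const_mul_prod _ _ fun n hn => ?_
    exact sub_ne_zero_of_lt_re hs (Finset.mem_Icc.1 hn).2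
  · rw [(hR s hs).2]
    refine ratFunc_eval_const_mul_prod _ _ fun m hm => ?_
    rw [Finset.mem_range] at hm
    have := sub_ne_zero_of_lt_re (m := N - 2 * m) hs (by lia)
    rwa [Nat.cast_sub (by lia), Nat.cast_mul, Nat.cast_ofNat] at this
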